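/- All surfaces are connected and of class $C^3$. A metric Lie group is a three-dimensional simply connected Lie group $X$ with a left invariant Riemannian metric $\langle\,,\rangle$. Fix a left invariant orthonormal frame $E_1,E_2,E_3$ of $X$ and orient $X$ so that it is positive. An immersed oriented surface in $X$ is regarded as a conformal immersion $\psi:\Sigma\to X$ of class $C^3$ of a Riemann surface $\Sigma$, with unit normal $N=\sum_i\nu_i E_i$ such that $(\psi_x,\psi_y,N)$ is positively oriented for every conformal parameter $z=x+iy$. Its Gauss map is $\nu=(\nu_1,\nu_2,\nu_3):\Sigma\to\mathbb S^2$, where $\mathbb S^2$, the unit sphere of $T_eX\cong\mathbb R^3$, has its standard orientation (outward normal). Given $\mathcal H\in C^1(\mathbb S^2)$, the surface has prescribed mean curvature $\mathcal H$ if its mean curvature function $H_\Sigma$ (half the trace of the second fundamental form $-\langle\nabla N,d\psi\rangle$) satisfies $H_\Sigma=\mathcal H\circ\nu$. Let $S$ be an immersed oriented surface (not necessarily compact), given by $\psi_S:S\to X$, with prescribed mean curvature $\mathcal H\in C^1(\mathbb S^2)$ in a metric Lie group $X$, whose Gauss map $G:S\to\mathbb S^2$ is an orientation preserving diffeomorphism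 onto its image $\mathcal U=G(S)$. Then there exists a complex quadratic differential $Q_{\mathcal H}\,dz^2$ defined on every immersed surface $\psi:\Sigma\to X$ with prescribed mean curvature $\mathcal H$ and Gauss map image contained in $\mathcal U$, such that (1)–(3) below hold. More precisely, there are functions $b_{jk}:\mathcal U\to\mathbb C$ of class $C^1$ ($j,k=1,2,3$), independent of $\Sigma$ and $\psi$, such that $$Q_{\mathcal H}\,dz^2=\sum_{j,k=1}^3 b_{jk}(\nu)\,\frac{\partial\nu_j}{\partial z}\frac{\partial\nu_k}{\partial z}\,dz^2$$ ($z$ any conformal parameter on $\Sigma$, $\nu$ the Gauss map of $\psi$) satisfies: 1. $Q_{\mathcal H}\,dz^2$ vanishes identically on $S$. 2. If $Q_{\mathcal H}\,dz^2$ vanishes identically on $\psi:\Sigma\to X$, then $\psi(\Sigma)$ is a left translation in $X$ of an open subset of $S$, i.e. $\psi(\Sigma)=x\cdot\psi_S(V)$ for some $x\in X$ and some open $V\subset S$. 3. If $Q_{\mathcal H}\,dz^2$ does not vanish identically on $\psi:\Sigma\to X$, then all zeros of $Q_{\mathcal H}\,dz^2$ on $\Sigma$ are isolated and of negative index. Here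 the index of $Q\,dz^2$ at an isolated zero is $-k/2$, where $k$ is the winding number around $0$ of the coefficient $Q$ along a small positively oriented circle about the zero. -/

import Mathlib

open scoped Manifold ContDiff Topology

noncomputable section

namespace MetricLie

/-- Euclidean three-space, used as model space and as space of coordinates in a frame. -/
abbrev E3 : Type := EuclideanSpace ℝ (Fin 3)

/-- The unit sphere of Euclidean three-space. -/
abbrev S2 : Type := Metric.sphere (0 : EuclideanSpace ℝ (Fin 3)) 1

/-- A (smooth) left invariant Riemannian metric on a three-dimensional Lie group:
every left translation `y ↦ x * y` is an isometry. -/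
structure LeftInvariantMetric (X : Type*) [TopologicalSpace X] [ChartedSpace E3 X] [Group X]
    [IsManifold (𝓡 3) ∞ X] where
  /-- the underlying Riemannian metric -/
  metric : Bundle.ContMDiffRiemannianMetric (𝓡 3) ∞ E3 (fun x : X => TangentSpace (𝓡 3) x)
  left_invariant : ∀ (x y : X) (v w : TangentSpace (𝓡 3) y),
    metric.inner (x * y) (mfderiv (𝓡 3) (𝓡 3) (fun a : X => x * a) y v)
      (mfderiv (𝓡 3) (𝓡 3) (fun a : X => x * a) y w) = metric.inner y v w

section Group

variable {X : Type*} [TopologicalSpace X] [ChartedSpace E3 X] [Group X] [IsManifold (𝓡 3) ∞ X]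

/-- An orthonormal basis `E₁, E₂, E₃` of the Lie algebra `T_e X`. It identifies the unit sphere of
`T_e X` with `S2`, and `X` is oriented by declaring `(E₁, E₂, E₃)` to be positive. -/
structure OrthonormalFrame (g : LeftInvariantMetric X) where
  /-- the basis of the Lie algebra -/
  basis : Module.Basis (Fin 3) ℝ (GroupLieAlgebra (𝓡 3) X)
  orthonormal : ∀ i j, g.metric.inner 1 (basis i) (basis j) = if i = j then 1 else 0

variable {g : LeftInvariantMetric X} (E : OrthonormalFrame g)

/-- The left invariant vector field `E_i` on `X`. -/
def OrthonormalFrame.field (i : Fin 3) (x : X) : TangentSpace (𝓡 3) x :=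
  mulInvariantVectorField (E.basis i) x

/-- The structure constants `⟨[E_i, E_j], E_k⟩`. -/
def OrthonormalFrame.structureConst (i j k : Fin 3) : ℝ :=
  g.metric.inner 1 ⁅E.basis i, E.basis j⁆ (E.basis k)

/-- The numbers `⟨∇_{E_i} E_j, E_k⟩` for the Levi-Civita connection `∇`, which are constant on `X`
and given by the Koszul formula for left invariant orthonormal fields. -/
def OrthonormalFrame.christoffel (i j k : Fin 3) : ℝ :=
  (E.structureConst i j k - E.structureConst j k i + E.structureConst k i j) / 2

/-- The vector of `T_x X` obtained from `n ∈ T_e X` (with coordinates `n₁, n₂, n₃` in the frame) by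
the differential of the left translation by `x`. -/
def OrthonormalFrame.leftTranslate (n : E3) (x : X) : TangentSpace (𝓡 3) x :=
  ∑ i, n i • E.field i x

end Group

section Riemann

variable {M : Type*} [TopologicalSpace M] [ChartedSpace ℂ M]

/-- The (real) differential of the `i`-th coordinate of a map `ν : M → S2`. The tangent space of `M`
at `p` is `ℂ`, through the preferred complex chart at `p`. -/
def dCoord (ν : M → S2) (p : M) (i : Fin 3) : ℂ →L[ℝ] ℝ :=
  mfderiv 𝓘(ℝ, ℂ) 𝓘(ℝ, ℝ) (fun q => (ν q : E3) i) p

/-- The complex linear part of the differential of the `i`-th coordinate of `ν`; in a complex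
coordinate `z` it is `(∂ν_i/∂z) dz`. -/
def delCoord (ν : M → S2) (p : M) (i : Fin 3) (v : ℂ) : ℂ :=
  ((dCoord ν p i v : ℝ) - Complex.I * (dCoord ν p i (Complex.I * v) : ℝ)) / 2

/-- `ν : M → S2` is an orientation preserving diffeomorphism onto its image (an injective local
diffeomorphism), where `S2` carries its standard orientation: a basis `(a, b)` of the tangent space
at `n` is positive if `(a, b, n)` is positive in three-space. -/
structure IsOrientedDiffeoOntoImage (ν : M → S2) : Prop where
  injective : Function.Injective ν
  localDiffeo : IsLocalDiffeomorph 𝓘(ℝ, ℂ) (𝓡 2) 1 ν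
  orientation : ∀ p : M, 0 < Matrix.det
    ![fun i => dCoord ν p i 1, fun i => dCoord ν p i Complex.I, fun i => (ν p : E3) i]

variable (M) in
/-- A complex quadratic differential on a Riemann surface: on each (complex) tangent line a complex
valued form that is homogeneous of degree two over `ℂ`. -/
structure QuadraticDifferential where
  /-- the form on the tangent line at `p` -/
  form : ∀ p : M, TangentSpace 𝓘(ℂ, ℂ) p → ℂ
  form_smul : ∀ (p : M) (c : ℂ) (v : TangentSpace 𝓘(ℂ, ℂ) p), form p (c • v) = c ^ 2 * form p v

namespace QuadraticDifferential

variable (Q : QuadraticDifferential M)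

/-- `p` is a zero of `Q`. -/
def IsZero (p : M) : Prop := ∀ v, Q.form p v = 0

/-- `Q` vanishes identically. -/
def VanishesIdentically : Prop := ∀ p, Q.IsZero p

/-- The coefficient `f` in the local expression `Q = f(z) dz²` in the preferred complex chart
at `p`. -/
def coeff (p : M) (z : ℂ) : ℂ :=
  Q.form ((chartAt ℂ p).symm z)
    (mfderiv 𝓘(ℂ, ℂ) 𝓘(ℂ, ℂ) (chartAt ℂ p).symm z (1 : ℂ))

/-- `f` has no zeros on small circles around `a`, and its argument increases by `2πk` along each of
them. -/
def HasWindingNumber (f : ℂ → ℂ) (a : ℂ) (k : ℤ) : Prop :=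
  ∃ r₀ : ℝ, 0 < r₀ ∧ ∀ r : ℝ, 0 < r → r < r₀ → ∃ θ : ℝ → ℝ, Continuous θ ∧
    (∀ t : ℝ, f (circleMap a r t) ≠ 0 ∧
      f (circleMap a r t) = ‖f (circleMap a r t)‖ * Complex.exp (θ t * Complex.I)) ∧
    θ (2 * Real.pi) - θ 0 = 2 * Real.pi * k

/-- The index of `Q` at `p`, that is, the rotation number of the line field on which `Q` is real and
positive: it is `-k/2` if the coefficient of `dz²` winds `k` times around the origin. -/
def HasIndex (p : M) (j : ℚ) : Prop :=
  ∃ k : ℤ, HasWindingNumber (Q.coeff p) (chartAt ℂ p p) k ∧ j = -(k : ℚ) / 2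

/-- `p` has a punctured neighbourhood on which `Q` has no zero. -/
def IsIsolatedAt (p : M) : Prop := ∀ᶠ q in 𝓝[≠] p, ¬ Q.IsZero q

end QuadraticDifferential

lemma delCoord_mul (ν : M → S2) (p : M) (i : Fin 3) (c v : ℂ) :
    delCoord ν p i (c * v) = c * delCoord ν p i v := by
  have key : ∀ L : ℂ →L[ℝ] ℝ, ∀ w : ℂ, L w = w.re * L 1 + w.im * L Complex.I := by
    intro L w
    have hw : w = w.re • (1 : ℂ) + w.im • Complex.I := by
      simp [Complex.re_add_im]
    calc L w = L (w.re • (1 : ℂ) + w.im • Complex.I) := by rw [← hw]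
      _ = _ := by rw [map_add, map_smul, map_smul, smul_eq_mul, smul_eq_mul]
  unfold delCoord
  rw [key _ (c * v), key _ v, key _ (Complex.I * (c * v)), key _ (Complex.I * v)]
  apply Complex.ext <;> simp <;> ring

/-- Given coefficients `b_{jk}` on the sphere, the quadratic differential
`∑_{j,k} b_{jk}(ν) (∂ν_j/∂z) (∂ν_k/∂z) dz²` of a map `ν` into the sphere. -/
def gaussQuadraticDifferential (b : S2 → Fin 3 → Fin 3 → ℂ) (ν : M → S2) :
    QuadraticDifferential M where
  form p v := ∑ j, ∑ k, b (ν p) j k * (delCoord ν p j v * delCoord ν p k v)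
  form_smul p c v := by
    have key : ∀ w : ℂ,
        (∑ j, ∑ k, b (ν p) j k * (delCoord ν p j (c * w) * delCoord ν p k (c * w))) =
          c ^ 2 * ∑ j, ∑ k, b (ν p) j k * (delCoord ν p j w * delCoord ν p k w) := by
      intro w
      simp only [delCoord_mul, Finset.mul_sum]
      refine Finset.sum_congr rfl fun j _ => Finset.sum_congr rfl fun k _ => ?_
      ring
    exact key v

end Riemann

section Surface

variable {X : Type*} [TopologicalSpace X] [ChartedSpace E3 X] [Group X] [IsManifold (𝓡 3) ∞ X]
  {g : LeftInvariantMetric X} (E : OrthonormalFrame g)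
  {M : Type*} [TopologicalSpace M] [ChartedSpace ℂ M]

/-- The (real) differential of `ψ` at `p`, on `T_p M = ℂ`. -/
def dMap (ψ : M → X) (p : M) : ℂ →L[ℝ] TangentSpace (𝓡 3) (ψ p) :=
  mfderiv 𝓘(ℝ, ℂ) (𝓡 3) ψ p

/-- The component `⟨dψ(v), E_i⟩`. -/
def tangentComponent (ψ : M → X) (p : M) (i : Fin 3) (v : ℂ) : ℝ :=
  g.metric.inner (ψ p) (dMap ψ p v) (E.field i (ψ p))

variable (M) in
/-- An immersed oriented surface of class `C³`: a conformal immersion `ψ` of a Riemann surface `M`,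
together with its Gauss map `ν`, which is given by `N = dl_ψ(ν)`, where `N` is the unit normal such
that `(dψ(1), dψ(i), N)` is positive. -/
structure ImmersedSurface where
  /-- the immersion -/
  map : M → X
  /-- the Gauss map, in coordinates with respect to the frame -/
  gauss : M → S2
  contMDiff : ContMDiff 𝓘(ℝ, ℂ) (𝓡 3) 3 map
  conformal : ∀ p : M, ∃ l : ℝ, 0 < l ∧ ∀ v w : ℂ,
    g.metric.inner (map p) (dMap map p v) (dMap map p w) = l * inner ℝ v w
  normal : ∀ (p : M) (v : ℂ),
    g.metric.inner (map p) (dMap map p v) (E.leftTranslate (gauss p) (map p)) = 0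
  orientation : ∀ p : M, 0 < Matrix.det
    ![fun i => tangentComponent E map p i 1, fun i => tangentComponent E map p i Complex.I,
      fun i => (gauss p : E3) i]

namespace ImmersedSurface

variable {E} (σ : ImmersedSurface E M)

/-- The `k`-th component of the covariant derivative `∇_v N` of the unit normal
`N = ∑ ν_j E_j` along the immersion, for the Levi-Civita connection of `X`. -/
def covDerivNormal (p : M) (v : ℂ) (k : Fin 3) : ℝ :=
  dCoord σ.gauss p k v +
    ∑ i, ∑ j, tangentComponent E σ.map p i v * (σ.gauss p : E3) j * E.christoffel i j k

/-- The second fundamental form `-⟨∇_v N, dψ(w)⟩`. -/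
def secondFundamentalForm (p : M) (v w : ℂ) : ℝ :=
  -∑ k, σ.covDerivNormal p v k * tangentComponent E σ.map p k w

/-- The mean curvature: half the trace of the second fundamental form with respect to the induced
metric, computed in the orthogonal basis `1, i` of the tangent plane, whose two vectors have the
same induced length. -/
def meanCurvature (p : M) : ℝ :=
  (σ.secondFundamentalForm p 1 1 + σ.secondFundamentalForm p Complex.I Complex.I) /
    (2 * g.metric.inner (σ.map p) (dMap σ.map p 1) (dMap σ.map p 1))

/-- The surface has prescribed mean curvature `h`. -/
def HasPrescribedMeanCurvature (h : S2 → ℝ) : Prop :=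
  ∀ p, σ.meanCurvature p = h (σ.gauss p)

end ImmersedSurface

end Surface

end MetricLie

end

/-! Let `f = G⁻¹ ∘ ν : Σ → S`, written `φ` in conformal parameters. At corresponding points both
surfaces have the same normal in the left invariant frame, hence the same tangent plane there. So
the frame components `A = (a - ib)/2` of `∂ψ/∂z` and their analogue `A'` on `S` satisfy `A = t · (A'
∘ φ)` with a nonvanishing complex factor `t`.

The Maurer-Cartan equation prescribes `a_y - b_x`, and the mean curvature equation prescribes `ν_x ·
a + ν_y · b`. Both right-hand sides depend only on the normal and on `a`, `b`, and get multiplied by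
`|t|²` when `a - ib` is multiplied by `t`. With conformality they determine `∂A/∂z̄` and `D = ∑
(ν_k)_z conj A_k`, so these two quantities are `|t|²` times those of `S` (`Jet.compare`,
`Matched.dbar_cvec_eq_and`). The chain rule for `ν = G ∘ f` then gives `t = φ_z + m conj(φ_z̄)`,
where `|m| < 1` because `G` preserves orientation (`Matched.scaleFactor_eq`, `norm_offPart_lt`).
Differentiating `A = t · (A' ∘ φ)` shows that `t_z̄` is a multiple of `φ_z̄`. For `u = conj(φ_z̄)`
the two formulas for `t_z̄` combine to `conj(u_z̄) + m u_z̄ = O(|u|)`, whence `|u_z̄| ≤ K |u|`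
locally. By the similarity principle (`exists_exp_mul_holomorphic`) `u` is locally a holomorphic
function times a nonvanishing continuous one.

With `P' = ∂G/∂w` and normal `N`, the differential is `Q = (∑ (ν_j)_z conj A'_j) · det(ν_z, P', N) /
|A'|²`. The determinant vanishes on `S` itself, where `ν_z = P'`. On `Σ` the first factor is `t D'`,
never zero, and the determinant is `u` times a nonzero multiple of the Jacobian of `G`. So `Q` is
`u` times a nonvanishing continuous function: near each point it vanishes or has a zero of finite
order `k`, of index `-k/2`, and connectedness makes this alternative global. If `Q ≡ 0`, then `φ` is
holomorphic and `t = φ_z`, so `ψ` and `ψ_S ∘ f` have the same Maurer-Cartan form and differ by a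
left translation; `f` is open since `t ≠ 0`. -/

noncomputable section

/-! ### Wirtinger derivatives, the Cauchy-Pompeiu formula and the Cauchy transform -/

namespace Wirtinger

open MeasureTheory Set Complex Filter

/-- The Wirtinger derivative `∂f/∂z̄`. -/
def dbar (f : ℂ → ℂ) (z : ℂ) : ℂ := (fderiv ℝ f z 1 + I * fderiv ℝ f z I) / 2

/-- The Wirtinger derivative `∂f/∂z`. -/
def del (f : ℂ → ℂ) (z : ℂ) : ℂ := (fderiv ℝ f z 1 - I * fderiv ℝ f z I) / 2

/-- The point with polar coordinates `(r, θ)`. -/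
def polarPt (r θ : ℝ) : ℂ := r * (Real.cos θ + Real.sin θ * I)

lemma real_clm_apply (L : ℂ →L[ℝ] ℂ) (w : ℂ) : L w = w.re * L 1 + w.im * L I := by
  have hw : w = w.re • (1 : ℂ) + w.im • I := by simp [Complex.re_add_im]
  conv_lhs => rw [hw, map_add, map_smul, map_smul]
  simp

lemma contDiff_polarPt_continuous : Continuous fun p : ℝ × ℝ => polarPt p.1 p.2 := by
  unfold polarPt; fun_prop

lemma norm_polarPt (r θ : ℝ) : ‖polarPt r θ‖ = |r| := by
  have := Complex.norm_polarCoord_symm (r, θ)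
  rwa [Complex.polarCoord_symm_apply] at this

lemma hasDerivAt_polarPt_fst (r θ : ℝ) :
    HasDerivAt (fun r => polarPt r θ) (Real.cos θ + Real.sin θ * I) r := by
  have := ((hasDerivAt_id r).ofReal_comp).mul_const ((Real.cos θ : ℂ) + Real.sin θ * I)
  simpa [polarPt] using! this

lemma hasDerivAt_polarPt_snd (r θ : ℝ) :
    HasDerivAt (fun θ => polarPt r θ) (r * (-Real.sin θ + Real.cos θ * I)) θ := by
  have h := (((Real.hasDerivAt_cos θ).ofReal_comp).add
    (((Real.hasDerivAt_sin θ).ofReal_comp).mul_const I)).const_mul (r : ℂ)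
  simpa [polarPt] using! h

variable {g : ℂ → ℂ}

/-- The integrand is the derivative of `r ↦ g(r e^{iθ})`, so only the endpoint value at the origin
survives. -/
lemma integral_radial (hg : ContDiff ℝ 1 g) (hc : HasCompactSupport g) (θ : ℝ) :
    ∫ r in Ioi (0 : ℝ), fderiv ℝ g (polarPt r θ) (Real.cos θ + Real.sin θ * I) = - g 0 := by
  have hd : ∀ r : ℝ, HasDerivAt (fun r => g (polarPt r θ))
      (fderiv ℝ g (polarPt r θ) (Real.cos θ + Real.sin θ * I)) r := fun r =>
    ((hg.differentiable one_ne_zero _).hasFDerivAt).comp_hasDerivAt r (hasDerivAt_polarPt_fst r θ)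
  obtain ⟨R, hR⟩ := hc.isCompact.isBounded.subset_closedBall 0
  have hzero : ∀ r : ℝ, R < |r| → polarPt r θ ∉ tsupport g := fun r hr h => by
    have := hR h
    rw [mem_closedBall_zero_iff, norm_polarPt] at this
    linarith
  have hint : IntegrableOn (fun r => fderiv ℝ g (polarPt r θ) (Real.cos θ + Real.sin θ * I))
      (Ioi (0 : ℝ)) := by
    refine (Continuous.integrable_of_hasCompactSupport ?_ ?_).integrableOn
    · have h1 : Continuous fun r : ℝ => polarPt r θ := by unfold polarPt; fun_prop
      exact ((hg.continuous_fderiv one_ne_zero).comp h1).clm_apply continuous_const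
    · refine HasCompactSupport.of_support_subset_isCompact (isCompact_Icc (a := -R) (b := R)) ?_
      intro r hr
      rw [mem_Icc, ← abs_le]
      by_contra! hlt
      exact hr (by simp [fderiv_of_notMem_tsupport ℝ (hzero r hlt)])
  have htend : Tendsto (fun r => g (polarPt r θ)) atTop (𝓝 0) := by
    refine tendsto_const_nhds.congr' ?_
    filter_upwards [eventually_gt_atTop R, eventually_ge_atTop 0] with r hr h0
    exact (image_eq_zero_of_notMem_tsupport (hzero r (by rwa [abs_of_nonneg h0]))).symm
  have := integral_Ioi_of_hasDerivAt_of_tendsto' (fun r _ => hd r) hint htend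
  simpa [polarPt] using this

/-- Up to the factor `r` the integrand is the `θ`-derivative of `g(r e^{iθ})`, which is
`2π`-periodic. -/
lemma integral_angular (hg : ContDiff ℝ 1 g) {r : ℝ} (hr : 0 < r) :
    ∫ θ in Ioo (-Real.pi) Real.pi,
      fderiv ℝ g (polarPt r θ) (-Real.sin θ + Real.cos θ * I) = 0 := by
  have hd : ∀ θ : ℝ, HasDerivAt (fun θ => g (polarPt r θ))
      (fderiv ℝ g (polarPt r θ) (r * (-Real.sin θ + Real.cos θ * I))) θ := fun θ =>
    ((hg.differentiable one_ne_zero _).hasFDerivAt).comp_hasDerivAt θ (hasDerivAt_polarPt_snd r θ)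
  have hcont : Continuous fun θ : ℝ =>
      fderiv ℝ g (polarPt r θ) (r * (-Real.sin θ + Real.cos θ * I)) := by
    have h1 : Continuous fun θ : ℝ => polarPt r θ := by unfold polarPt; fun_prop
    exact ((hg.continuous_fderiv one_ne_zero).comp h1).clm_apply (by fun_prop)
  have h := intervalIntegral.integral_eq_sub_of_hasDerivAt (fun θ _ => hd θ)
    (hcont.intervalIntegrable (-Real.pi) Real.pi)
  rw [intervalIntegral.integral_of_le (by linarith [Real.pi_pos]), integral_Ioc_eq_integral_Ioo]
    at h
  have e : ∀ θ : ℝ, fderiv ℝ g (polarPt r θ) (r * (-Real.sin θ + Real.cos θ * I)) =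
      (r : ℂ) * fderiv ℝ g (polarPt r θ) (-Real.sin θ + Real.cos θ * I) := fun θ => by
    rw [← Complex.real_smul, map_smul, Complex.real_smul]
  simp only [e] at h
  rw [integral_const_mul] at h
  have : g (polarPt r Real.pi) - g (polarPt r (-Real.pi)) = 0 := by simp [polarPt]
  rw [this] at h
  exact (mul_eq_zero.1 h).resolve_left (by exact_mod_cast hr.ne')

/-- The Cauchy-Pompeiu formula for compactly supported functions. -/
theorem integral_inv_mul_dbar (hg : ContDiff ℝ 1 g) (hc : HasCompactSupport g) :
    ∫ ζ, ζ⁻¹ * dbar g ζ = - Real.pi * g 0 := by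
  obtain ⟨R, hR⟩ := hc.isCompact.isBounded.subset_closedBall 0
  have hfc := hg.continuous_fderiv one_ne_zero
  -- Integrability on the unbounded strip, needed for Fubini in both orders: the integrand is
  -- continuous and vanishes for `r > R`.
  have key : ∀ v : ℝ → ℂ, Continuous v → Integrable
      (fun p : ℝ × ℝ => fderiv ℝ g (polarPt p.1 p.2) (v p.2))
      ((volume.restrict (Ioi (0 : ℝ))).prod (volume.restrict (Ioo (-Real.pi) Real.pi))) := by
    intro v hv
    have hcont : Continuous (fun p : ℝ × ℝ => fderiv ℝ g (polarPt p.1 p.2) (v p.2)) :=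
      (hfc.comp contDiff_polarPt_continuous).clm_apply (by fun_prop)
    rw [Measure.prod_restrict]
    have h1 : IntegrableOn (fun p : ℝ × ℝ => fderiv ℝ g (polarPt p.1 p.2) (v p.2))
        (Icc 0 R ×ˢ Icc (-Real.pi) Real.pi) (volume.prod volume) :=
      (hcont.continuousOn).integrableOn_compact (isCompact_Icc.prod isCompact_Icc)
    refine IntegrableOn.of_forall_sdiff_eq_zero (s := (Ioi (0 : ℝ) ∩ Iic R) ×ˢ
      Ioo (-Real.pi) Real.pi) ?_ (measurableSet_Ioi.prod measurableSet_Ioo) ?_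
    · refine h1.mono_set (Set.prod_mono ?_ Ioo_subset_Icc_self)
      rintro x ⟨hx, hx'⟩
      exact ⟨le_of_lt hx, hx'⟩
    · rintro ⟨r, θ⟩ ⟨⟨hr, hθ⟩, hn⟩
      have hr' : R < r := by
        by_contra! hle
        exact hn ⟨⟨hr, hle⟩, hθ⟩
      have : polarPt r θ ∉ tsupport g := fun h => by
        have := hR h
        rw [mem_closedBall_zero_iff, norm_polarPt, abs_of_pos hr] at this
        linarith
      simp [fderiv_of_notMem_tsupport ℝ this]
  have k1 := key (fun θ => Real.cos θ + Real.sin θ * I) (by fun_prop)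
  have k2 := key (fun θ => -Real.sin θ + Real.cos θ * I) (by fun_prop)
  -- The area factor `r` cancels `|ζ⁻¹|`, and the phase of `ζ⁻¹` cancels that of `∂/∂z̄`, leaving
  -- `(∂_r g + (i/r) ∂_θ g) / 2`.
  have hstep : ∀ p ∈ polarCoord.target,
      p.1 • ((Complex.polarCoord.symm p)⁻¹ * dbar g (Complex.polarCoord.symm p)) =
      (fderiv ℝ g (polarPt p.1 p.2) (Real.cos p.2 + Real.sin p.2 * I) +
        I * fderiv ℝ g (polarPt p.1 p.2) (-Real.sin p.2 + Real.cos p.2 * I)) / 2 := by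
    rintro ⟨r, θ⟩ hp
    have hr : (0 : ℝ) < r := hp.1
    have hrc : (r : ℂ) ≠ 0 := by exact_mod_cast hr.ne'
    rw [Complex.polarCoord_symm_apply]
    change r • ((polarPt r θ)⁻¹ * dbar g (polarPt r θ)) = _
    have hcs : ((Real.cos θ : ℂ) + Real.sin θ * I) * (Real.cos θ - Real.sin θ * I) = 1 := by
      have : ((Real.cos θ : ℂ)) ^ 2 + (Real.sin θ : ℂ) ^ 2 = 1 := by
        exact_mod_cast Real.cos_sq_add_sin_sq θ
      linear_combination this - (Real.sin θ : ℂ) ^ 2 * Complex.I_sq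
    have hinv : (polarPt r θ)⁻¹ = (r : ℂ)⁻¹ * (Real.cos θ - Real.sin θ * I) := by
      rw [polarPt, mul_inv, inv_eq_of_mul_eq_one_right hcs]
    rw [hinv, real_clm_apply _ (_ + _), real_clm_apply _ (-_ + _), dbar, Complex.real_smul]
    simp
    field_simp
    linear_combination (-(Complex.sin θ) * fderiv ℝ g (polarPt r θ) I) * Complex.I_sq
  rw [← Complex.integral_comp_polarCoord_symm,
    setIntegral_congr_fun polarCoord.open_target.measurableSet hstep, polarCoord_target,
    Measure.volume_eq_prod, ← Measure.prod_restrict]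
  rw [integral_div, integral_add k1 (k2.const_mul I), integral_const_mul, integral_prod_symm _ k1,
    integral_prod _ k2]
  have e2 : ∫ r in Ioi (0 : ℝ), ∫ θ in Ioo (-Real.pi) Real.pi,
      fderiv ℝ g (polarPt r θ) (-Real.sin θ + Real.cos θ * I) = 0 := by
    rw [setIntegral_congr_fun measurableSet_Ioi (fun r hr => integral_angular hg hr)]
    simp
  simp only [integral_radial hg hc]
  rw [e2]
  simp [Measure.real, Real.pi_pos.le]
  ring

/-- The Cauchy transform. -/
def cauchyTransform (μ : ℂ → ℂ) (z : ℂ) : ℂ := (Real.pi : ℂ)⁻¹ * ∫ ζ, ζ⁻¹ * μ (z - ζ)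

lemma locallyIntegrable_inv : LocallyIntegrable (fun ζ : ℂ => ζ⁻¹) volume := by
  refine locallyIntegrable_of_norm_le_rpow (C := 1) (α := 1) (by simp) (by simp)
    (Eventually.of_forall fun x => ?_) (measurable_inv.aestronglyMeasurable)
  rw [norm_inv, one_mul, Real.rpow_neg_one]

open scoped Convolution in
lemma cauchyTransform_eq (μ : ℂ → ℂ) : cauchyTransform μ = fun z =>
    (Real.pi : ℂ)⁻¹ * ((fun ζ : ℂ => ζ⁻¹) ⋆[ContinuousLinearMap.mul ℝ ℂ, volume] μ) z := rfl

lemma contDiff_cauchyTransform {μ : ℂ → ℂ} (hμ : ContDiff ℝ 1 μ) (hc : HasCompactSupport μ) :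
    ContDiff ℝ 1 (cauchyTransform μ) := by
  rw [cauchyTransform_eq]
  exact contDiff_const.mul (hc.contDiff_convolution_right (n := 1)
    (ContinuousLinearMap.mul ℝ ℂ) locallyIntegrable_inv hμ)

open scoped Convolution in
lemma fderiv_cauchyTransform {μ : ℂ → ℂ} (hμ : ContDiff ℝ 1 μ) (hc : HasCompactSupport μ)
    (z v : ℂ) : fderiv ℝ (cauchyTransform μ) z v =
      (Real.pi : ℂ)⁻¹ * ∫ ζ, ζ⁻¹ * fderiv ℝ μ (z - ζ) v := by
  have h := (hc.hasFDerivAt_convolution_right (ContinuousLinearMap.mul ℝ ℂ)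
    locallyIntegrable_inv hμ z).const_mul (Real.pi : ℂ)⁻¹
  rw [cauchyTransform_eq, h.fderiv]
  have hex := (hc.fderiv (𝕜 := ℝ)).convolutionExists_right
    ((ContinuousLinearMap.mul ℝ ℂ).precompR ℂ) locallyIntegrable_inv
    (hμ.continuous_fderiv one_ne_zero) z
  simp only [_root_.smul_apply, smul_eq_mul]
  rw [MeasureTheory.convolution, ← ContinuousLinearMap.apply_apply (𝕜 := ℝ) v,
    ← ContinuousLinearMap.integral_comp_comm _ hex.integrable]
  rfl

lemma integrable_inv_mul {φ : ℂ → ℂ} (hφ : Continuous φ) (hc : HasCompactSupport φ) :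
    Integrable (fun ζ : ℂ => ζ⁻¹ * φ ζ) := by
  have := locallyIntegrable_inv.integrable_smul_right_of_hasCompactSupport hφ hc
  simpa [smul_eq_mul] using this

/-- The Cauchy transform is a right inverse of `∂/∂z̄`. -/
theorem dbar_cauchyTransform {μ : ℂ → ℂ} (hμ : ContDiff ℝ 1 μ) (hc : HasCompactSupport μ) (z : ℂ) :
    dbar (cauchyTransform μ) z = μ z := by
  -- Cauchy-Pompeiu is applied to the reflected density; the reflection reverses derivatives and so
  -- absorbs the sign in `-π g(0)`.
  set g : ℂ → ℂ := fun ζ => μ (z - ζ) with hgdef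
  have hg : ContDiff ℝ 1 g := hμ.comp (contDiff_const.sub contDiff_id)
  have hgc : HasCompactSupport g := hc.comp_homeomorph (Homeomorph.subLeft z)
  have hfd : ∀ ζ v, fderiv ℝ μ (z - ζ) v = - fderiv ℝ g ζ v := by
    intro ζ v
    have h1 : HasFDerivAt g ((fderiv ℝ μ (z - ζ)).comp (-ContinuousLinearMap.id ℝ ℂ)) ζ :=
      ((hμ.differentiable one_ne_zero _).hasFDerivAt).comp ζ ((hasFDerivAt_id ζ).const_sub z)
    rw [h1.fderiv]; simp
  have hint : ∀ v, Integrable (fun ζ : ℂ => ζ⁻¹ * fderiv ℝ g ζ v) := fun v =>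
    integrable_inv_mul ((hg.continuous_fderiv one_ne_zero).clm_apply continuous_const)
      (hgc.fderiv_apply (𝕜 := ℝ) v)
  have h0 := integral_inv_mul_dbar hg hgc
  have e : ∀ ζ : ℂ, ζ⁻¹ * dbar g ζ = (ζ⁻¹ * fderiv ℝ g ζ 1 + I * (ζ⁻¹ * fderiv ℝ g ζ I)) / 2 :=
    fun ζ => by rw [dbar]; ring
  simp only [e] at h0
  rw [integral_div, integral_add (hint 1) ((hint I).const_mul I), integral_const_mul] at h0
  rw [dbar, fderiv_cauchyTransform hμ hc, fderiv_cauchyTransform hμ hc]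
  simp only [hfd, mul_neg, integral_neg]
  have hπ : (Real.pi : ℂ) ≠ 0 := by exact_mod_cast Real.pi_ne_zero
  have hz : μ z = g 0 := by simp [hgdef]
  rw [hz]
  generalize (∫ a : ℂ, a⁻¹ * fderiv ℝ g a 1) = x at *
  generalize (∫ a : ℂ, a⁻¹ * fderiv ℝ g a I) = y at *
  field_simp
  linear_combination (-2) * h0

end Wirtinger

/-! ### The similarity principle for `|∂f/∂z̄| ≤ K |f|` -/

namespace Wirtinger

open MeasureTheory Set Complex Filter Metric
open scoped Interval
open scoped ENNReal

/-- The truncated Cauchy kernel. -/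
lemma memLp_indicator_inv (R : ℝ) :
    MemLp ((ball (0 : ℂ) R).indicator fun ζ => ζ⁻¹) (ENNReal.ofReal (3 / 2)) volume := by
  rw [memLp_indicator_iff_restrict measurableSet_ball]
  have hm : AEStronglyMeasurable (fun ζ : ℂ => ζ⁻¹) volume := measurable_inv.aestronglyMeasurable
  rw [← integrable_norm_rpow_iff hm.restrict (by simp) (by simp)]
  -- `|ζ|^(-3/2)` is integrable near `0` in the plane because `3/2 < 2`.
  have := integrableOn_ball_of_norm_le_rpow (E := ℂ) (F := ℝ) (μ := volume)
    (f := fun ζ : ℂ => ‖ζ⁻¹‖ ^ (3 / 2 : ℝ)) (C := 1) (α := 3 / 2) (r := R) (by simp)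
    (by norm_num) (Eventually.of_forall fun x => ?_) ?_
  · rw [ENNReal.toReal_ofReal (by norm_num)]
    exact this
  · rw [norm_inv, Real.inv_rpow (norm_nonneg _), one_mul, Real.rpow_neg (norm_nonneg _),
      Real.norm_of_nonneg (by positivity)]
  · exact (measurable_inv.norm.pow_const _).aestronglyMeasurable

/-- Hölder with exponents `3/2` and `3`: the kernel is locally in `L^p` only for `p < 2`, so the
density needs an exponent above `2`. If `z` and `z - ζ` lie in the ball of radius `R`, then `|ζ| ≤
2R`; cutting the kernel off at `2R + 1` therefore changes nothing and makes the constant independent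
of `z`. -/
lemma cauchyTransform_estimate (a : ℂ) (R : ℝ) : ∃ C : ℝ, 0 ≤ C ∧ ∀ η : ℂ → ℂ, MemLp η 3 volume →
    (∀ z ∉ closedBall a R, η z = 0) → ∀ z ∈ closedBall a R,
      Integrable (fun ζ => ζ⁻¹ * η (z - ζ)) ∧
      ‖cauchyTransform η z‖ ≤ C * (eLpNorm η 3 volume).toReal := by
  set k : ℂ → ℂ := (ball (0 : ℂ) (2 * R + 1)).indicator fun ζ => ζ⁻¹ with hk
  have hkL := memLp_indicator_inv (2 * R + 1)
  refine ⟨Real.pi⁻¹ * (eLpNorm k (ENNReal.ofReal (3 / 2)) volume).toReal, by positivity, ?_⟩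
  intro η hη hsupp z hz
  have hmp : MeasurePreserving (fun ζ : ℂ => z - ζ) volume volume := Measure.measurePreserving_sub_left volume z
  have hη' : MemLp (fun ζ => η (z - ζ)) 3 volume := hη.comp_measurePreserving hmp
  have heq : (fun ζ => ζ⁻¹ * η (z - ζ)) = k • (fun ζ => η (z - ζ)) := by
    funext ζ
    simp only [Pi.smul_apply', smul_eq_mul, hk]
    by_cases hζ : ζ ∈ ball (0 : ℂ) (2 * R + 1)
    · rw [indicator_of_mem hζ]
    · rw [indicator_of_notMem hζ, zero_mul, hsupp (z - ζ), mul_zero]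
      intro h
      apply hζ
      rw [mem_ball_zero_iff]
      rw [mem_closedBall, dist_eq_norm] at h hz
      have : ζ = (z - a) - (z - ζ - a) := by ring
      rw [this]
      linarith [norm_sub_le (z - a) (z - ζ - a)]
  have hT : ENNReal.HolderTriple (ENNReal.ofReal (3 / 2)) 3 1 := by
    refine ⟨?_⟩
    have h3 : (3 : ℝ≥0∞) = ENNReal.ofReal 3 := by simp
    rw [h3, ← ENNReal.ofReal_inv_of_pos (by norm_num), ← ENNReal.ofReal_inv_of_pos (by norm_num),
      ← ENNReal.ofReal_add (by norm_num) (by norm_num)]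
    norm_num
  have hint : MemLp (fun ζ => ζ⁻¹ * η (z - ζ)) 1 volume := by
    rw [heq]; exact hη'.smul hkL
  refine ⟨memLp_one_iff_integrable.1 hint, ?_⟩
  have hle : eLpNorm (fun ζ => ζ⁻¹ * η (z - ζ)) 1 volume ≤
      eLpNorm k (ENNReal.ofReal (3 / 2)) volume * eLpNorm η 3 volume := by
    rw [heq, ← eLpNorm_comp_measurePreserving hη.1 hmp]
    exact eLpNorm_smul_le_mul_eLpNorm hη'.1 hkL.1
  have hn : ‖∫ ζ, ζ⁻¹ * η (z - ζ)‖ ≤ (eLpNorm (fun ζ => ζ⁻¹ * η (z - ζ)) 1 volume).toReal := by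
    rw [eLpNorm_one_eq_lintegral_enorm, ← integral_norm_eq_lintegral_enorm hint.1]
    exact norm_integral_le_integral_norm _
  rw [cauchyTransform, norm_mul, norm_inv, Complex.norm_of_nonneg Real.pi_pos.le, mul_assoc]
  refine mul_le_mul_of_nonneg_left (hn.trans ?_) (by positivity)
  rw [← ENNReal.toReal_mul]
  exact ENNReal.toReal_mono (ENNReal.mul_ne_top hkL.2.ne hη.2.ne) hle

/-- Bounds the double integral from Green's formula by an area integral, whatever the order of the
endpoints. -/
lemma norm_iterated_integral_le {G : ℂ → ℂ} {a b c d : ℝ}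
    (hG : IntegrableOn G ([[a, b]] ×ℂ [[c, d]])) :
    ‖∫ x in a..b, ∫ y in c..d, G (x + y * I)‖ ≤ ∫ z in [[a, b]] ×ℂ [[c, d]], ‖G z‖ := by
  have hmp := Complex.volume_preserving_equiv_real_prod.symm
  have hme := Complex.measurableEquivRealProd.symm.measurableEmbedding
  have hsymm : ∀ p : ℝ × ℝ, Complex.measurableEquivRealProd.symm p = p.1 + p.2 * I := fun p => by
    rw [← Complex.mk_eq_add_mul_I]; rfl
  have hpre : Complex.measurableEquivRealProd.symm ⁻¹' ([[a, b]] ×ℂ [[c, d]]) =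
      [[a, b]] ×ˢ [[c, d]] := by
    rfl
  have h1 : ∫ z in [[a, b]] ×ℂ [[c, d]], ‖G z‖ =
      ∫ p in [[a, b]] ×ˢ [[c, d]], ‖G (p.1 + p.2 * I)‖ := by
    rw [← hmp.setIntegral_preimage_emb hme, hpre]
    simp only [hsymm]
  have h2 : IntegrableOn (fun p : ℝ × ℝ => G (p.1 + p.2 * I)) ([[a, b]] ×ˢ [[c, d]]) := by
    rw [← hmp.integrableOn_comp_preimage hme, hpre] at hG
    refine hG.congr_fun ?_ (measurableSet_uIcc.prod measurableSet_uIcc)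
    intro p _
    simp only [Function.comp_apply, hsymm]
  have hsub : Ι a b ×ˢ Ι c d ⊆ [[a, b]] ×ˢ [[c, d]] :=
    Set.prod_mono uIoc_subset_uIcc uIoc_subset_uIcc
  rw [h1, intervalIntegral.norm_intervalIntegral_eq]
  simp only [intervalIntegral.intervalIntegral_eq_integral_uIoc (a := c) (b := d)]
  rw [integral_smul, norm_smul]
  have hs : ‖(if c ≤ d then 1 else -1 : ℝ)‖ = 1 := by split_ifs <;> simp
  rw [hs, one_mul, ← setIntegral_prod _ (h2.mono_set hsub)]
  refine (norm_integral_le_integral_norm _).trans ?_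
  exact setIntegral_mono_set h2.norm (Eventually.of_forall fun _ => norm_nonneg _)
    (LE.le.eventuallyLE hsub)

lemma dbar_mul_exp_neg {f w : ℂ → ℂ} {z : ℂ} (hf : DifferentiableAt ℝ f z)
    (hw : DifferentiableAt ℝ w z) :
    dbar (fun z => f z * exp (-w z)) z = (dbar f z - dbar w z * f z) * exp (-w z) := by
  have h1 : HasFDerivAt (fun z => exp (-w z)) (exp (-w z) • (-fderiv ℝ w z)) z :=
    (hw.hasFDerivAt.neg).cexp
  have h2 := (hf.hasFDerivAt.mul h1).fderiv
  simp only [dbar]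
  rw [show (fun z => f z * exp (-w z)) = f * (fun z => exp (-w z)) from rfl, h2]
  simp
  ring

/-- The similarity principle: a solution of `|∂f/∂z̄| ≤ K |f|` is locally the product of a
nonvanishing continuous function and a holomorphic one. -/
theorem exists_exp_mul_holomorphic {f : ℂ → ℂ} {a : ℂ} {r K : ℝ} (hr : 0 < r)
    (hf : ContDiffOn ℝ 1 f (ball a r)) (hK : ∀ z ∈ ball a r, ‖dbar f z‖ ≤ K * ‖f z‖) :
    ∃ w : ℂ → ℂ, ContinuousOn w (ball a (r / 4)) ∧
      DifferentiableOn ℂ (fun z => f z * exp (-w z)) (ball a (r / 4)) := by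
  set R := r / 4 with hR
  have hRpos : 0 < R := by positivity
  have hsub : closedBall a R ⊆ ball a r := closedBall_subset_ball (by linarith)
  have hsub2 : closedBall a R ⊆ closedBall a (2 * R) := closedBall_subset_closedBall (by linarith)
  have hfd : ∀ z ∈ ball a r, DifferentiableAt ℝ f z := fun z hz =>
    (hf.differentiableOn one_ne_zero).differentiableAt (isOpen_ball.mem_nhds hz)
  have hdf : ContinuousOn (dbar f) (ball a r) := by
    have h := hf.continuousOn_fderiv_of_isOpen isOpen_ball le_rfl
    unfold dbar
    exact ((h.clm_apply continuousOn_const).add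
      (continuousOn_const.mul (h.clm_apply continuousOn_const))).div_const 2
  -- Formally `μ = ∂(log f)/∂z̄`, so if `∂w/∂z̄ = μ` then `f exp(-w)` is holomorphic. As `μ` is only
  -- bounded and measurable, its Cauchy transform is not differentiated; `μ` is approximated in `L³`
  -- by `C¹` densities `m n` and holomorphy is obtained in the limit.
  set μ : ℂ → ℂ := (closedBall a R).indicator fun z => dbar f z / f z with hμ
  have hμf : ∀ z ∈ closedBall a R, dbar f z = μ z * f z := by
    intro z hz
    rw [hμ, indicator_of_mem hz]
    -- At a zero of `f` the inequality forces `∂f/∂z̄ = 0`, so the convention for division by zero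
    -- does no harm.
    by_cases h0 : f z = 0
    · have := hK z (hsub hz)
      rw [h0, norm_zero, mul_zero, norm_le_zero_iff] at this
      simp [h0, this]
    · field_simp
  have hμL : MemLp μ 3 volume := by
    rw [hμ, memLp_indicator_iff_restrict measurableSet_closedBall]
    have : IsFiniteMeasure (volume.restrict (closedBall a R)) :=
      isFiniteMeasure_restrict.2 measure_closedBall_lt_top.ne
    refine MemLp.of_bound (C := |K|) ?_ ?_
    · exact (((hdf.mono hsub).aemeasurable measurableSet_closedBall).div
        ((hf.continuousOn.mono hsub).aemeasurable measurableSet_closedBall)).aestronglyMeasurable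
    · refine (ae_restrict_iff' measurableSet_closedBall).2 (Eventually.of_forall fun z hz => ?_)
      rw [norm_div]
      exact div_le_of_le_mul₀ (norm_nonneg _) (abs_nonneg _)
        ((hK z (hsub hz)).trans (mul_le_mul_of_nonneg_right (le_abs_self K) (norm_nonneg _)))
  -- The cutoff is `1` on the support of `μ`, so multiplying the approximants by it confines them to
  -- the double ball without increasing their distance to `μ`.
  let χ : ContDiffBump a := ⟨R, 2 * R, hRpos, by linarith⟩
  have happ : ∀ n : ℕ, ∃ m : ℂ → ℂ, ContDiff ℝ 1 m ∧ HasCompactSupport m ∧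
      (∀ z ∉ closedBall a (2 * R), m z = 0) ∧
      eLpNorm (μ - m) 3 volume ≤ ENNReal.ofReal (1 / ((n : ℝ) + 1)) := by
    intro n
    obtain ⟨g, hg1, hg2, hg3⟩ := hμL.exist_eLpNorm_sub_le (by simp) (by norm_num)
      (Nat.one_div_pos_of_nat (α := ℝ) (n := n))
    have hχz : ∀ z ∉ closedBall a (2 * R), χ z = 0 := fun z hz =>
      χ.zero_of_le_dist (by rw [mem_closedBall, not_le] at hz; exact hz.le)
    refine ⟨fun z => (χ z : ℂ) * g z, ?_, ?_, ?_, ?_⟩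
    · exact (ofRealCLM.contDiff.comp (χ.contDiff (n := 1))).mul (hg2.of_le (by simp))
    · exact hg1.mul_left
    · intro z hz
      simp [hχz z hz]
    · refine le_trans (eLpNorm_mono fun z => ?_) hg3
      have hχμ : (χ z : ℂ) * μ z = μ z := by
        by_cases hz : z ∈ closedBall a R
        · rw [χ.one_of_mem_closedBall hz]; simp
        · rw [hμ, indicator_of_notMem hz, mul_zero]
      have : (μ - fun z => (χ z : ℂ) * g z) z = (χ z : ℂ) * (μ - g) z := by
        simp only [Pi.sub_apply]; rw [mul_sub, hχμ]
      rw [this, norm_mul, Complex.norm_of_nonneg χ.nonneg]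
      exact mul_le_of_le_one_left (norm_nonneg _) χ.le_one
  choose m hm1 hm2 hm3 hm4 using happ
  have hmL : ∀ n, MemLp (m n) 3 volume := fun n =>
    (hm1 n).continuous.memLp_of_hasCompactSupport (hm2 n)
  have hμ0 : ∀ z ∉ closedBall a (2 * R), μ z = 0 := fun z hz =>
    indicator_of_notMem (fun h => hz (hsub2 h)) _
  obtain ⟨C, hC0, hC⟩ := cauchyTransform_estimate a (2 * R)
  have hnat : Tendsto (fun n : ℕ => 1 / ((n : ℝ) + 1)) atTop (𝓝 0) :=
    tendsto_one_div_add_atTop_nhds_zero_nat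
  have hdist : ∀ n, ∀ z ∈ closedBall a R,
      ‖cauchyTransform μ z - cauchyTransform (m n) z‖ ≤ C * (1 / ((n : ℝ) + 1)) := by
    intro n z hz
    have e : cauchyTransform μ z - cauchyTransform (m n) z = cauchyTransform (μ - m n) z := by
      rw [cauchyTransform, cauchyTransform, ← mul_sub, ← integral_sub
        (hC μ hμL hμ0 z (hsub2 hz)).1 (hC _ (hmL n) (hm3 n) z (hsub2 hz)).1]
      simp [cauchyTransform, mul_sub]
    rw [e]
    refine ((hC _ (hμL.sub (hmL n)) (fun y hy => by simp [hμ0 y hy, hm3 n y hy])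
      z (hsub2 hz)).2).trans (mul_le_mul_of_nonneg_left ?_ hC0)
    exact ENNReal.toReal_le_of_le_ofReal (by positivity) (hm4 n)
  have hunif : TendstoUniformlyOn (fun n => cauchyTransform (m n)) (cauchyTransform μ) atTop
      (closedBall a R) := by
    rw [Metric.tendstoUniformlyOn_iff]
    intro ε hε
    have hCn : Tendsto (fun n : ℕ => C * (1 / ((n : ℝ) + 1))) atTop (𝓝 0) := by
      simpa using hnat.const_mul C
    filter_upwards [hCn.eventually_lt_const hε] with n hn z hz
    rw [dist_eq_norm]
    exact (hdist n z hz).trans_lt hn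
  have hcn : ∀ n, Continuous (cauchyTransform (m n)) := fun n =>
    (contDiff_cauchyTransform (hm1 n) (hm2 n)).continuous
  have hwc : ContinuousOn (cauchyTransform μ) (closedBall a R) :=
    hunif.continuousOn (Eventually.of_forall fun n => (hcn n).continuousOn).frequently
  refine ⟨cauchyTransform μ, hwc.mono ball_subset_closedBall, ?_⟩
  set F : ℂ → ℂ := fun z => f z * exp (-cauchyTransform μ z) with hF
  set G : ℕ → ℂ → ℂ := fun n z => f z * exp (-cauchyTransform (m n) z) with hG
  have hfc : ContinuousOn f (closedBall a R) := hf.continuousOn.mono hsub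
  have hFc : ContinuousOn F (closedBall a R) := hfc.mul hwc.neg.cexp
  have hGc : ∀ n, ContinuousOn (G n) (closedBall a R) := fun n =>
    hfc.mul (hcn n).continuousOn.neg.cexp
  obtain ⟨Mw, hMw⟩ := (isCompact_closedBall a R).exists_bound_of_continuousOn hwc
  obtain ⟨Mf, hMf⟩ := (isCompact_closedBall a R).exists_bound_of_continuousOn hfc
  have hbd : ∀ n, ∀ z ∈ closedBall a R, ‖exp (-cauchyTransform (m n) z)‖ ≤ Real.exp (Mw + C) := by
    intro n z hz
    rw [Complex.norm_exp]
    refine Real.exp_le_exp.2 ((Complex.re_le_norm _).trans ?_)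
    rw [norm_neg]
    have h1 : ‖cauchyTransform (m n) z‖ ≤ ‖cauchyTransform μ z‖ +
        ‖cauchyTransform μ z - cauchyTransform (m n) z‖ := by
      have := norm_sub_norm_le (cauchyTransform (m n) z) (cauchyTransform μ z)
      rw [norm_sub_rev] at this
      linarith
    have h2 : C * (1 / ((n : ℝ) + 1)) ≤ C := by
      refine mul_le_of_le_one_right hC0 ?_
      rw [div_le_one (by positivity)]; linarith [n.cast_nonneg (α := ℝ)]
    linarith [hMw z hz, hdist n z hz]
  have hGF : TendstoUniformlyOn G F atTop (closedBall a R) := by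
    rw [Metric.tendstoUniformlyOn_iff]
    intro ε hε
    have hCn : Tendsto (fun n : ℕ => C * (1 / ((n : ℝ) + 1))) atTop (𝓝 0) := by
      simpa using hnat.const_mul C
    have hCn2 : Tendsto (fun n : ℕ => Mf * (Real.exp Mw * (2 * (C * (1 / ((n : ℝ) + 1)))))) atTop
        (𝓝 0) := by
      simpa using ((hCn.const_mul 2).const_mul (Real.exp Mw)).const_mul Mf
    filter_upwards [hCn2.eventually_lt_const hε, hCn.eventually_lt_const one_pos] with n hn hn1 z hz
    have hMf0 : 0 ≤ Mf := (norm_nonneg _).trans (hMf z hz)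
    refine lt_of_le_of_lt ?_ hn
    have e : F z - G n z = f z * (exp (-cauchyTransform μ z) *
        (-(exp (cauchyTransform μ z - cauchyTransform (m n) z) - 1))) := by
      have : exp (-cauchyTransform (m n) z) = exp (-cauchyTransform μ z) *
          exp (cauchyTransform μ z - cauchyTransform (m n) z) := by
        rw [← Complex.exp_add]; congr 1; ring
      simp only [hF, hG, this]; ring
    rw [dist_eq_norm, e, norm_mul, norm_mul, norm_neg]
    refine mul_le_mul (hMf z hz) (mul_le_mul ?_ ?_ (norm_nonneg _) (Real.exp_pos _).le)
      (by positivity) hMf0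
    · rw [Complex.norm_exp]
      refine Real.exp_le_exp.2 ((Complex.re_le_norm _).trans ?_)
      rw [norm_neg]; exact hMw z hz
    · refine (Complex.norm_exp_sub_one_le ((hdist n z hz).trans hn1.le)).trans ?_
      linarith [hdist n z hz]
  -- Morera: it suffices that the integrals of `F` over boundaries of rectangles vanish, and these
  -- are limits of the ones for `G n`.
  refine ((isConservativeOn_and_continuousOn_iff_isDifferentiableOn isOpen_ball).1
    ⟨?_, hFc.mono ball_subset_closedBall⟩)
  intro z w hzw
  have hrect : [[z.re, w.re]] ×ℂ [[z.im, w.im]] ⊆ closedBall a R :=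
    Subset.trans hzw ball_subset_closedBall
  rw [← add_eq_zero_iff_eq_neg]
  have hlim : Tendsto (fun n => wedgeIntegral z w (G n) + wedgeIntegral w z (G n)) atTop
      (𝓝 (wedgeIntegral z w F + wedgeIntegral w z F)) := by
    simp only [wedgeIntegral_add_wedgeIntegral_eq]
    have hre : ∀ y ∈ [[z.im, w.im]], Tendsto (fun n => ∫ x : ℝ in z.re..w.re, G n (x + y * I)) atTop
        (𝓝 (∫ x : ℝ in z.re..w.re, F (x + y * I))) := by
      intro y hy
      have hmaps : [[z.re, w.re]] ⊆ (fun x : ℝ => (x + y * I : ℂ)) ⁻¹' closedBall a R :=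
        fun x hx => hrect (by simp [Complex.mem_reProdIm, hx, hy])
      exact TendstoUniformlyOn.tendsto_intervalIntegral_of_continuousOn
        (Eventually.of_forall fun n => (hGc n).comp (by fun_prop) hmaps)
        ((hGF.comp _).mono hmaps)
    have him : ∀ x ∈ [[z.re, w.re]], Tendsto (fun n => ∫ y : ℝ in z.im..w.im, G n (x + y * I)) atTop
        (𝓝 (∫ y : ℝ in z.im..w.im, F (x + y * I))) := by
      intro x hx
      have hmaps : [[z.im, w.im]] ⊆ (fun y : ℝ => (x + y * I : ℂ)) ⁻¹' closedBall a R :=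
        fun y hy => hrect (by simp [Complex.mem_reProdIm, hx, hy])
      exact TendstoUniformlyOn.tendsto_intervalIntegral_of_continuousOn
        (Eventually.of_forall fun n => (hGc n).comp (by fun_prop) hmaps)
        ((hGF.comp _).mono hmaps)
    exact ((((hre _ left_mem_uIcc).sub (hre _ right_mem_uIcc)).add
      ((him _ right_mem_uIcc).const_smul I)).sub ((him _ left_mem_uIcc).const_smul I))
  refine tendsto_nhds_unique hlim ?_
  have hGd : ∀ n, ∀ y ∈ closedBall a R, DifferentiableAt ℝ (G n) y := by
    intro n y hy
    have hwd := (contDiff_cauchyTransform (hm1 n) (hm2 n)).differentiable one_ne_zero y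
    exact (hfd y (hsub hy)).mul hwd.neg.cexp
  -- The integrand in Green's formula is `2i ∂(G n)/∂z̄`, and `∂(G n)/∂z̄ = (μ - m n) G n` tends to
  -- zero in `L¹`.
  have hGdbar : ∀ n, ∀ y ∈ closedBall a R,
      I • fderiv ℝ (G n) y 1 - fderiv ℝ (G n) y I =
        2 * I * ((μ - m n) y * (f y * exp (-cauchyTransform (m n) y))) := by
    intro n y hy
    have hwd := (contDiff_cauchyTransform (hm1 n) (hm2 n)).differentiable one_ne_zero y
    have h1 := dbar_mul_exp_neg (hfd y (hsub hy)) hwd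
    rw [dbar_cauchyTransform (hm1 n) (hm2 n), hμf y hy] at h1
    have h2 : I • fderiv ℝ (G n) y 1 - fderiv ℝ (G n) y I = 2 * I * dbar (G n) y := by
      rw [dbar, smul_eq_mul]; linear_combination -(fderiv ℝ (G n) y I) * Complex.I_sq
    rw [h2, h1, Pi.sub_apply]; ring
  have hfin : IsFiniteMeasure (volume.restrict (closedBall a R)) :=
    isFiniteMeasure_restrict.2 measure_closedBall_lt_top.ne
  have hrc : IsCompact ([[z.re, w.re]] ×ℂ [[z.im, w.im]]) :=
    isCompact_uIcc.reProdIm isCompact_uIcc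
  have hLint : ∀ n, IntegrableOn (μ - m n) (closedBall a R) := fun n =>
    (((hμL.sub (hmL n)).restrict (closedBall a R)).integrable (by norm_num))
  have hbound : ∀ n, ‖wedgeIntegral z w (G n) + wedgeIntegral w z (G n)‖ ≤
      ∫ y in closedBall a R, 2 * (Mf * Real.exp (Mw + C)) * ‖(μ - m n) y‖ := by
    intro n
    have hmeas : IntegrableOn (fun y => 2 * I * ((μ - m n) y *
        (f y * exp (-cauchyTransform (m n) y)))) ([[z.re, w.re]] ×ℂ [[z.im, w.im]]) := by
      refine Integrable.const_mul ?_ _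
      exact IntegrableOn.mul_continuousOn ((hLint n).mono_set hrect) ((hGc n).mono hrect) hrc
    have hInt : IntegrableOn (fun y => I • fderiv ℝ (G n) y 1 - fderiv ℝ (G n) y I)
        ([[z.re, w.re]] ×ℂ [[z.im, w.im]]) :=
      hmeas.congr_fun (fun y hy => (hGdbar n y (hrect hy)).symm) hrc.measurableSet
    rw [wedgeIntegral_add_wedgeIntegral_eq, integral_boundary_rect_of_differentiableOn_real _ _ _
      (fun y hy => (hGd n y (hrect hy)).differentiableWithinAt) hInt]
    refine (norm_iterated_integral_le
      (G := fun y => I • fderiv ℝ (G n) y 1 - fderiv ℝ (G n) y I) hInt).trans ?_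
    have hR : IntegrableOn (fun y => 2 * (Mf * Real.exp (Mw + C)) * ‖(μ - m n) y‖)
        (closedBall a R) := ((hLint n).norm).const_mul _
    refine (setIntegral_mono_on hInt.norm (hR.mono_set hrect) hrc.measurableSet fun y hy => ?_).trans
      (setIntegral_mono_set hR (Eventually.of_forall fun y => ?_) (LE.le.eventuallyLE hrect))
    · rw [hGdbar n y (hrect hy)]
      have hMf0 : 0 ≤ Mf := (norm_nonneg _).trans (hMf y (hrect hy))
      simp only [norm_mul, Complex.norm_I, mul_one, Complex.norm_ofNat]
      have := mul_le_mul (hMf y (hrect hy)) (hbd n y (hrect hy)) (norm_nonneg _) hMf0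
      nlinarith [norm_nonneg ((μ - m n) y)]
    · have hMf0 : 0 ≤ Mf := (norm_nonneg _).trans (hMf a (mem_closedBall_self hRpos.le))
      positivity
  refine squeeze_zero_norm hbound ?_
  simp only [integral_const_mul]
  rw [← mul_zero (2 * (Mf * Real.exp (Mw + C)))]
  refine Tendsto.const_mul _ ?_
  -- The Hölder factor that bounds the `L¹` norm on the ball by the `L³` norm.
  set V := (volume.restrict (closedBall a R) univ) ^ (1 / (1 : ℝ≥0∞).toReal - 1 / (3 : ℝ≥0∞).toReal)
    with hV
  have hVtop : V ≠ ⊤ := ENNReal.rpow_ne_top_of_nonneg (by norm_num) (measure_ne_top _ _)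
  have hle : ∀ n, ∫ y in closedBall a R, ‖(μ - m n) y‖ ≤ (1 / ((n : ℝ) + 1)) * V.toReal := by
    intro n
    rw [integral_norm_eq_lintegral_enorm (hLint n).1, ← eLpNorm_one_eq_lintegral_enorm]
    have h1 := eLpNorm_le_eLpNorm_mul_rpow_measure_univ (p := 1) (q := 3) (by norm_num)
      (hLint n).1
    have h2 := (eLpNorm_mono_measure (p := 3) (μ - m n)
      (Measure.restrict_le_self (μ := volume) (s := closedBall a R))).trans (hm4 n)
    have h3 := h1.trans (mul_le_mul_left h2 _)
    refine (ENNReal.toReal_mono (ENNReal.mul_ne_top ENNReal.ofReal_ne_top hVtop) h3).trans ?_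
    rw [ENNReal.toReal_mul, ENNReal.toReal_ofReal (by positivity)]
  refine squeeze_zero (fun n => integral_nonneg fun _ => norm_nonneg _) hle ?_
  simpa using hnat.mul_const V.toReal

end Wirtinger

/-! ### Zeros of finite order and their winding numbers -/

namespace Wirtinger

open Set Complex Filter Metric

/-- A solution of `|∂f/∂z̄| ≤ K |f|` either vanishes near `a` or has a zero of finite order there. -/
theorem eventually_zero_or_pow_mul {f : ℂ → ℂ} {a : ℂ} {K : ℝ}
    (hf : ContDiffAt ℝ 1 f a) (hK : ∀ᶠ z in 𝓝 a, ‖dbar f z‖ ≤ K * ‖f z‖) :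
    (∀ᶠ z in 𝓝 a, f z = 0) ∨ ∃ (k : ℕ) (g : ℂ → ℂ), (∀ᶠ z in 𝓝 a, ContinuousAt g z) ∧ g a ≠ 0 ∧
      ∀ᶠ z in 𝓝 a, f z = (z - a) ^ k * g z := by
  have h1 : ∀ᶠ z in 𝓝 a, ContDiffAt ℝ 1 f z := hf.eventually (by simp)
  obtain ⟨r, hr, hball⟩ := Metric.eventually_nhds_iff_ball.1 (h1.and hK)
  obtain ⟨w, hw, hh⟩ := exists_exp_mul_holomorphic hr
    (fun z hz => (hball z hz).1.contDiffWithinAt) (fun z hz => (hball z hz).2)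
  have hr4 : 0 < r / 4 := by positivity
  have hnhds : ball a (r / 4) ∈ 𝓝 a := ball_mem_nhds a hr4
  have han : AnalyticAt ℂ (fun z => f z * exp (-w z)) a := hh.analyticAt hnhds
  have hfe : ∀ z, f z = f z * exp (-w z) * exp (w z) := fun z => by
    rw [mul_assoc, ← Complex.exp_add]; simp
  rcases han.eventually_eq_zero_or_eventually_ne_zero with h0 | hne
  · left
    filter_upwards [h0] with z hz
    rw [hfe, hz, zero_mul]
  · right
    have hnz : ¬ ∀ᶠ z in 𝓝 a, f z * exp (-w z) = 0 := fun h => by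
      obtain ⟨z, hz1, hz2⟩ := (hne.and (h.filter_mono nhdsWithin_le_nhds)).exists
      exact hz1 hz2
    obtain ⟨k, g, hg, hg0, hgk⟩ := han.exists_eventuallyEq_pow_smul_nonzero_iff.2 hnz
    refine ⟨k, fun z => g z * exp (w z), ?_, mul_ne_zero hg0 (exp_ne_zero _), ?_⟩
    · filter_upwards [hg.eventually_analyticAt, isOpen_ball.mem_nhds (mem_ball_self hr4)]
        with z hz hzb
      exact hz.continuousAt.mul (hw.continuousAt (isOpen_ball.mem_nhds hzb)).cexp
    · filter_upwards [hgk] with z hz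
      rw [hfe, hz, smul_eq_mul]; ring

open MetricLie.QuadraticDifferential in
/-- The winding number of `(z - a)ᵏ g(z)` with `g` continuous and nonvanishing. -/
theorem hasWindingNumber_pow_mul {f g : ℂ → ℂ} {a : ℂ} {k : ℕ}
    (hg : ∀ᶠ z in 𝓝 a, ContinuousAt g z) (hg0 : g a ≠ 0)
    (hf : ∀ᶠ z in 𝓝 a, f z = (z - a) ^ k * g z) : HasWindingNumber f a k := by
  -- Near `a` the quotient `g / g(a)` is close to `1`, so its principal argument is continuous and
  -- does not wind.
  have hslit : ∀ᶠ z in 𝓝 a, g z / g a ∈ slitPlane := by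
    have hc : ContinuousAt (fun z => g z / g a) a := (hg.self_of_nhds).div_const _
    refine hc.eventually (isOpen_slitPlane.mem_nhds ?_)
    simp only [div_self hg0]; exact one_mem_slitPlane
  obtain ⟨r, hr, hball⟩ := Metric.eventually_nhds_iff_ball.1 (hg.and (hslit.and hf))
  refine ⟨r, hr, fun ρ hρ hρr => ?_⟩
  have hmem : ∀ t : ℝ, circleMap a ρ t ∈ ball a r := fun t => by
    have := circleMap_mem_sphere a hρ.le t
    rw [mem_sphere] at this
    rw [mem_ball, this]; exact hρr
  -- `k t` is the argument of `(ρ e^{it})^k`; the other two terms take the same value at `0` and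
  -- `2π`.
  refine ⟨fun t => k * t + arg (g (circleMap a ρ t) / g a) + arg (g a), ?_, ?_, ?_⟩
  · refine ((continuous_const.mul continuous_id).add ?_).add continuous_const
    rw [continuous_iff_continuousAt]
    intro t
    have h := hball _ (hmem t)
    have hc : ContinuousAt (fun t => g (circleMap a ρ t) / g a) t :=
      ((ContinuousAt.comp (f := circleMap a ρ) h.1 (continuous_circleMap a ρ).continuousAt)).div_const _
    exact ContinuousAt.comp (f := fun t => g (circleMap a ρ t) / g a)
      (continuousAt_arg h.2.1) hc
  · intro t
    have h := hball _ (hmem t)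
    have hgz : g (circleMap a ρ t) ≠ 0 := fun h0 => by
      have := h.2.1
      rw [h0, zero_div] at this
      exact zero_notMem_slitPlane this
    have hval : f (circleMap a ρ t) = (ρ * exp (t * I)) ^ k * g (circleMap a ρ t) := by
      rw [h.2.2]; simp [circleMap]
    have hρc : (ρ : ℂ) ≠ 0 := by exact_mod_cast hρ.ne'
    refine ⟨?_, ?_⟩
    · rw [hval]
      exact mul_ne_zero (pow_ne_zero _ (mul_ne_zero hρc (exp_ne_zero _))) hgz
    · have e1 := norm_mul_exp_arg_mul_I (g (circleMap a ρ t) / g a)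
      have e2 := norm_mul_exp_arg_mul_I (g a)
      have hn : ‖f (circleMap a ρ t)‖ = ρ ^ k * (‖g (circleMap a ρ t) / g a‖ * ‖g a‖) := by
        rw [hval, norm_mul, norm_pow, norm_mul, Complex.norm_exp_ofReal_mul_I, mul_one,
          Complex.norm_of_nonneg hρ.le, norm_div, div_mul_cancel₀ _ (norm_ne_zero_iff.2 hg0)]
      have e3 : g (circleMap a ρ t) = (g (circleMap a ρ t) / g a) * g a := by field_simp
      rw [← e1] at e3
      rw [hn, hval]
      beta_reduce
      generalize ‖g (circleMap a ρ t) / g a‖ = A at *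
      generalize (g (circleMap a ρ t) / g a).arg = B at *
      rw [← e2] at e3
      generalize ‖g a‖ = A' at *
      generalize (g a).arg = B' at *
      rw [e3]
      push_cast
      rw [mul_pow, ← Complex.exp_nat_mul, add_mul, add_mul, Complex.exp_add, Complex.exp_add]
      ring_nf
  · have : circleMap a ρ (2 * Real.pi) = circleMap a ρ 0 := by simp [circleMap]
    simp only [this]; push_cast; ring

end Wirtinger

/-! ### Calculus rules for the Wirtinger derivatives -/

namespace Wirtinger

open Set Complex Filter
open scoped ComplexConjugate

variable {f g φ : ℂ → ℂ} {z : ℂ}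

lemma fderiv_eq_del_add_dbar (f : ℂ → ℂ) (z w : ℂ) :
    fderiv ℝ f z w = del f z * w + dbar f z * conj w := by
  rw [real_clm_apply, del, dbar]
  conv_rhs => rw [← Complex.re_add_im w]
  simp only [map_add, map_mul, Complex.conj_ofReal, Complex.conj_I]
  linear_combination ((w.im : ℂ) * fderiv ℝ f z I) * Complex.I_sq

lemma del_dbar_of_fderiv {p q : ℂ} (h : ∀ v, fderiv ℝ f z v = p * v + q * conj v) :
    del f z = p ∧ dbar f z = q := by
  rw [del, dbar, h, h]
  simp only [map_one, Complex.conj_I]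
  constructor
  · linear_combination (-(p - q) / 2) * Complex.I_sq
  · linear_combination ((p - q) / 2) * Complex.I_sq

lemma del_dbar_comp (hf : DifferentiableAt ℝ f (φ z)) (hφ : DifferentiableAt ℝ φ z) :
    del (fun z => f (φ z)) z = del f (φ z) * del φ z + dbar f (φ z) * conj (dbar φ z) ∧
    dbar (fun z => f (φ z)) z = del f (φ z) * dbar φ z + dbar f (φ z) * conj (del φ z) := by
  refine del_dbar_of_fderiv fun v => ?_
  rw [show (fun z => f (φ z)) = f ∘ φ from rfl, fderiv_comp z hf hφ, ContinuousLinearMap.comp_apply,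
    fderiv_eq_del_add_dbar f, fderiv_eq_del_add_dbar φ]
  simp only [map_add, map_mul, Complex.conj_conj]
  ring

lemma dbar_mul (hf : DifferentiableAt ℝ f z) (hg : DifferentiableAt ℝ g z) :
    dbar (fun z => f z * g z) z = dbar f z * g z + f z * dbar g z := by
  have := (hf.hasFDerivAt.mul hg.hasFDerivAt).fderiv
  rw [dbar, show (fun z => f z * g z) = f * g from rfl, this, dbar, dbar]
  simp; ring

lemma dbar_add (hf : DifferentiableAt ℝ f z) (hg : DifferentiableAt ℝ g z) :
    dbar (fun z => f z + g z) z = dbar f z + dbar g z := by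
  have := (hf.hasFDerivAt.add hg.hasFDerivAt).fderiv
  rw [dbar, show (fun z => f z + g z) = f + g from rfl, this, dbar, dbar]
  simp; ring

lemma fderiv_conj (hf : DifferentiableAt ℝ f z) (v : ℂ) :
    fderiv ℝ (fun z => conj (f z)) z v = conj (fderiv ℝ f z v) := by
  have := ((Complex.conjCLE.toContinuousLinearMap.hasFDerivAt).comp z hf.hasFDerivAt).fderiv
  have e : (fun z => conj (f z)) = (Complex.conjCLE.toContinuousLinearMap : ℂ → ℂ) ∘ f := by
    funext z; simp
  rw [e, this]; simp

lemma dbar_conj (hf : DifferentiableAt ℝ f z) :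
    dbar (fun z => conj (f z)) z = conj (del f z) := by
  rw [dbar, fderiv_conj hf, fderiv_conj hf, del]
  simp [sub_eq_add_neg, Complex.conj_ofNat]

lemma dbar_congr (h : f =ᶠ[𝓝 z] g) : dbar f z = dbar g z := by rw [dbar, dbar, h.fderiv_eq]

lemma del_congr (h : f =ᶠ[𝓝 z] g) : del f z = del g z := by rw [del, del, h.fderiv_eq]

lemma contDiffOn_dbar {O : Set ℂ} (hO : IsOpen O) {n : ℕ∞ω} (hf : ContDiffOn ℝ (n + 1) f O) :
    ContDiffOn ℝ n (dbar f) O := by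
  have h := hf.fderiv_of_isOpen hO le_rfl
  exact (((h.clm_apply contDiffOn_const).add
    (contDiffOn_const.mul (h.clm_apply contDiffOn_const))).div_const 2)

lemma contDiffOn_del {O : Set ℂ} (hO : IsOpen O) {n : ℕ∞ω} (hf : ContDiffOn ℝ (n + 1) f O) :
    ContDiffOn ℝ n (del f) O := by
  have h := hf.fderiv_of_isOpen hO le_rfl
  exact (((h.clm_apply contDiffOn_const).sub
    (contDiffOn_const.mul (h.clm_apply contDiffOn_const))).div_const 2)

/-- Symmetry of the second derivative: both sides are a quarter of the Laplacian. -/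
lemma dbar_del_comm (hf : ContDiffAt ℝ 2 f z) : dbar (del f) z = del (dbar f) z := by
  have hsymm : IsSymmSndFDerivAt ℝ f z := hf.isSymmSndFDerivAt (by simp)
  have hd : DifferentiableAt ℝ (fderiv ℝ f) z :=
    (hf.fderiv_right (m := 1) (by norm_num)).differentiableAt one_ne_zero
  have h1 : ∀ v w, fderiv ℝ (fun z => fderiv ℝ f z v) z w = fderiv ℝ (fderiv ℝ f) z w v := by
    intro v w
    have := (hd.hasFDerivAt.clm_apply (hasFDerivAt_const v z)).fderiv
    rw [this]; simp
  have hdv : ∀ v, HasFDerivAt (fun z => fderiv ℝ f z v) (fderiv ℝ (fun z => fderiv ℝ f z v) z) z :=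
    fun v => (hd.clm_apply (differentiableAt_const v)).hasFDerivAt
  have e1 : ∀ w, fderiv ℝ (del f) z w = (fderiv ℝ (fderiv ℝ f) z w 1 -
      I * fderiv ℝ (fderiv ℝ f) z w I) / 2 := by
    intro w
    have := (((hdv 1).sub ((hdv I).const_mul I)).mul_const (2⁻¹ : ℂ)).fderiv
    rw [show del f = fun z => (fderiv ℝ f z 1 - I * fderiv ℝ f z I) * 2⁻¹ from by
      funext z; rw [del, div_eq_mul_inv]]
    simp only [← h1]
    rw [show (fun z => (fderiv ℝ f z 1 - I * fderiv ℝ f z I) * 2⁻¹) = fun z =>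
      (((fun z => fderiv ℝ f z 1) - fun z => I * fderiv ℝ f z I) z) * 2⁻¹ from rfl, this]
    simp; ring
  have e2 : ∀ w, fderiv ℝ (dbar f) z w = (fderiv ℝ (fderiv ℝ f) z w 1 +
      I * fderiv ℝ (fderiv ℝ f) z w I) / 2 := by
    intro w
    have := (((hdv 1).add ((hdv I).const_mul I)).mul_const (2⁻¹ : ℂ)).fderiv
    rw [show dbar f = fun z => (fderiv ℝ f z 1 + I * fderiv ℝ f z I) * 2⁻¹ from by
      funext z; rw [dbar, div_eq_mul_inv]]
    simp only [← h1]
    rw [show (fun z => (fderiv ℝ f z 1 + I * fderiv ℝ f z I) * 2⁻¹) = fun z =>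
      (((fun z => fderiv ℝ f z 1) + fun z => I * fderiv ℝ f z I) z) * 2⁻¹ from rfl, this]
    simp; ring
  rw [dbar, del, e1, e1, e2, e2, hsymm.eq 1 I]
  ring

end Wirtinger

/-! ### Linear algebra of first order surface data -/

namespace Wirtinger

open Set Complex Filter Matrix
open scoped ComplexConjugate

/-- Vectors of Euclidean three-space given by their coordinates. -/
abbrev V3 : Type := Fin 3 → ℝ

lemma dot3 (a b : V3) : a ⬝ᵥ b = a 0 * b 0 + a 1 * b 1 + a 2 * b 2 := by
  simp [dotProduct, Fin.sum_univ_three]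

lemma dot_self_pos {a : V3} (ha : a ≠ 0) : 0 < a ⬝ᵥ a := by
  have h0 : 0 ≤ a ⬝ᵥ a := by rw [dot3]; nlinarith [sq_nonneg (a 0), sq_nonneg (a 1), sq_nonneg (a 2)]
  exact h0.lt_of_ne fun h => ha (dotProduct_self_eq_zero.1 h.symm)

/-- A vector orthogonal to `n`, `a` and `n × a` vanishes. -/
lemma eq_zero_of_dot_eq_zero {n a w : V3} (hn : n ⬝ᵥ n = 1) (han : a ⬝ᵥ n = 0) (ha : a ≠ 0)
    (h1 : w ⬝ᵥ n = 0) (h2 : w ⬝ᵥ a = 0) (h3 : w ⬝ᵥ (n ⨯₃ a) = 0) : w = 0 := by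
  have hpos := dot_self_pos ha
  have key : ∀ i, (a ⬝ᵥ a) * w i = 0 := by
    simp only [dot3, cross_apply, Matrix.cons_val] at *
    intro i
    fin_cases i
    · simp only [Fin.zero_eta, Fin.isValue]
      -- Cramer's rule for `w` in the basis `n`, `a`, `n × a`, whose determinant is `|n × a|² =
      -- |n|²|a|² - (a · n)²`; the other two coordinates follow cyclically.
      linear_combination (-(a 0 ^ 2 + a 1 ^ 2 + a 2 ^ 2) * w 0) * hn
        + (a 0 * n 0 + a 1 * n 1 + a 2 * n 2) * w 0 * han
        + h2 * ((n 2 * a 0 - n 0 * a 2) * n 2 - (n 0 * a 1 - n 1 * a 0) * n 1)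
        + h3 * (n 1 * a 2 - n 2 * a 1)
        + h1 * (a 1 * (n 0 * a 1 - n 1 * a 0) - a 2 * (n 2 * a 0 - n 0 * a 2))
    · simp only [Fin.mk_one, Fin.isValue]
      linear_combination (-(a 0 ^ 2 + a 1 ^ 2 + a 2 ^ 2) * w 1) * hn
        + (a 0 * n 0 + a 1 * n 1 + a 2 * n 2) * w 1 * han
        + h2 * ((n 0 * a 1 - n 1 * a 0) * n 0 - (n 1 * a 2 - n 2 * a 1) * n 2)
        + h3 * (n 2 * a 0 - n 0 * a 2)
        + h1 * (a 2 * (n 1 * a 2 - n 2 * a 1) - a 0 * (n 0 * a 1 - n 1 * a 0))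
    · simp only [Fin.reduceFinMk, Fin.isValue]
      linear_combination (-(a 0 ^ 2 + a 1 ^ 2 + a 2 ^ 2) * w 2) * hn
        + (a 0 * n 0 + a 1 * n 1 + a 2 * n 2) * w 2 * han
        + h2 * ((n 1 * a 2 - n 2 * a 1) * n 1 - (n 2 * a 0 - n 0 * a 2) * n 0)
        + h3 * (n 0 * a 1 - n 1 * a 0)
        + h1 * (a 0 * (n 2 * a 0 - n 0 * a 2) - a 1 * (n 1 * a 2 - n 2 * a 1))
  funext i
  exact (mul_eq_zero.1 (key i)).resolve_left hpos.ne'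

lemma cross_dot_self_eq {n a : V3} (hn : n ⬝ᵥ n = 1) (han : a ⬝ᵥ n = 0) :
    (n ⨯₃ a) ⬝ᵥ (n ⨯₃ a) = a ⬝ᵥ a := by
  simp only [dot3, cross_apply, Matrix.cons_val] at *
  linear_combination (a 0 ^ 2 + a 1 ^ 2 + a 2 ^ 2) * hn -
    (a 0 * n 0 + a 1 * n 1 + a 2 * n 2) * han

lemma cross_cross_eq_neg {n a : V3} (hn : n ⬝ᵥ n = 1) (han : a ⬝ᵥ n = 0) :
    n ⨯₃ (n ⨯₃ a) = -a := by
  simp only [dot3] at *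
  funext i
  fin_cases i <;> simp [cross_apply, Matrix.cons_val]
  · linear_combination n 0 * han - a 0 * hn
  · linear_combination n 1 * han - a 1 * hn
  · linear_combination n 2 * han - a 2 * hn

/-- The first order data of a surface at a point: normal `n`, positive conformal basis `a`, `b` of
the tangent plane, derivatives of these in the two coordinate directions, the torsion `L` of the
basis and the trace `T` of the differential of the normal. -/
structure Jet (n a b nx ny ax ay bx by' L : V3) (T : ℝ) : Prop where
  unit : n ⬝ᵥ n = 1
  orth : a ⬝ᵥ n = 0
  rot : b = n ⨯₃ a
  ne : a ≠ 0
  an_x : ax ⬝ᵥ n + a ⬝ᵥ nx = 0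
  bn_y : by' ⬝ᵥ n + b ⬝ᵥ ny = 0
  an_y : ay ⬝ᵥ n + a ⬝ᵥ ny = 0
  bn_x : bx ⬝ᵥ n + b ⬝ᵥ nx = 0
  ab_x : ax ⬝ᵥ b + a ⬝ᵥ bx = 0
  ab_y : ay ⬝ᵥ b + a ⬝ᵥ by' = 0
  aa_x : ax ⬝ᵥ a = bx ⬝ᵥ b
  aa_y : ay ⬝ᵥ a = by' ⬝ᵥ b
  torsion : ay - bx = L
  trace : nx ⬝ᵥ a + ny ⬝ᵥ b = T

/-- The scaling `(x + iy) (a - ib)` of a basis by a complex number. -/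
lemma exists_rotScale {n a a' : V3} (hn : n ⬝ᵥ n = 1) (han : a ⬝ᵥ n = 0) (ha'n : a' ⬝ᵥ n = 0)
    (ha' : a' ≠ 0) :
    a = ((a ⬝ᵥ a') / (a' ⬝ᵥ a')) • a' + ((a ⬝ᵥ (n ⨯₃ a')) / (a' ⬝ᵥ a')) • (n ⨯₃ a') ∧
    n ⨯₃ a = -((a ⬝ᵥ (n ⨯₃ a')) / (a' ⬝ᵥ a')) • a' + ((a ⬝ᵥ a') / (a' ⬝ᵥ a')) • (n ⨯₃ a') := by
  have hpos := (dot_self_pos ha').ne'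
  have h1 : a = ((a ⬝ᵥ a') / (a' ⬝ᵥ a')) • a' +
      ((a ⬝ᵥ (n ⨯₃ a')) / (a' ⬝ᵥ a')) • (n ⨯₃ a') := by
    rw [← sub_eq_zero]
    have e1 : (n ⨯₃ a') ⬝ᵥ n = 0 := by rw [dotProduct_comm]; exact dot_self_cross _ _
    have e2 : (n ⨯₃ a') ⬝ᵥ a' = 0 := by rw [dotProduct_comm]; exact dot_cross_self _ _
    have e3 : a' ⬝ᵥ (n ⨯₃ a') = 0 := dot_cross_self _ _
    refine eq_zero_of_dot_eq_zero hn ha'n ha' ?_ ?_ ?_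
    · simp [sub_dotProduct, add_dotProduct, han, ha'n, e1]
    · simp [sub_dotProduct, add_dotProduct, e2, hpos]
    · simp [sub_dotProduct, add_dotProduct, e3, cross_dot_self_eq hn ha'n, hpos]
  refine ⟨h1, ?_⟩
  conv_lhs => rw [h1]
  rw [map_add, map_smul, map_smul, cross_cross_eq_neg hn ha'n]
  module

section Jet

variable {n a b nx ny ax ay bx by' L a' b' nx' ny' ax' ay' bx' by'' L' : V3} {T T' : ℝ}

/-- These four identities express the divergence `a_x + b_y` through the trace and the curl `a_y -
b_x`, and the antisymmetric part of the differential of the normal through the curl alone. They come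
from the differentiated orthogonality relations and, for the tangential components, from `|a| = |b|`
and `a · b = 0`. -/
lemma Jet.div_dot_normal (h : Jet n a b nx ny ax ay bx by' L T) :
    (ax + by') ⬝ᵥ n = -(nx ⬝ᵥ a + ny ⬝ᵥ b) := by
  have e1 := h.an_x; have e2 := h.bn_y
  simp only [dot3, Pi.add_apply] at *
  linear_combination e1 + e2

lemma Jet.div_dot_fst (h : Jet n a b nx ny ax ay bx by' L T) :
    (ax + by') ⬝ᵥ a = -((ay - bx) ⬝ᵥ b) := by
  have e1 := h.ab_y; have e2 := h.aa_x
  simp only [dot3, Pi.add_apply, Pi.sub_apply] at *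
  linear_combination e1 + e2

lemma Jet.div_dot_snd (h : Jet n a b nx ny ax ay bx by' L T) :
    (ax + by') ⬝ᵥ b = (ay - bx) ⬝ᵥ a := by
  have e1 := h.ab_x; have e2 := h.aa_y
  simp only [dot3, Pi.add_apply, Pi.sub_apply] at *
  linear_combination e1 - e2

lemma Jet.curl_dot_normal (h : Jet n a b nx ny ax ay bx by' L T) :
    nx ⬝ᵥ b - ny ⬝ᵥ a = (ay - bx) ⬝ᵥ n := by
  have e1 := h.an_y; have e2 := h.bn_x
  simp only [dot3, Pi.sub_apply] at *
  linear_combination e2 - e1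

/-- Comparison of two surfaces with the same normal at a point. -/
lemma Jet.compare (h : Jet n a b nx ny ax ay bx by' L T)
    (h' : Jet n a' b' nx' ny' ax' ay' bx' by'' L' T')
    {x y : ℝ} (ha : a = x • a' + y • b') (hb : b = -y • a' + x • b')
    (hL : L = (x ^ 2 + y ^ 2) • L') (hT : T = (x ^ 2 + y ^ 2) * T') :
    ax + by' = (x ^ 2 + y ^ 2) • (ax' + by'') ∧ ay - bx = (x ^ 2 + y ^ 2) • (ay' - bx') ∧
    nx ⬝ᵥ a + ny ⬝ᵥ b = (x ^ 2 + y ^ 2) * (nx' ⬝ᵥ a' + ny' ⬝ᵥ b') ∧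
    nx ⬝ᵥ b - ny ⬝ᵥ a = (x ^ 2 + y ^ 2) * (nx' ⬝ᵥ b' - ny' ⬝ᵥ a') := by
  have hLL : ay - bx = (x ^ 2 + y ^ 2) • (ay' - bx') := by rw [h.torsion, hL, h'.torsion]
  have hTT : nx ⬝ᵥ a + ny ⬝ᵥ b = (x ^ 2 + y ^ 2) * (nx' ⬝ᵥ a' + ny' ⬝ᵥ b') := by
    rw [h.trace, hT, h'.trace]
  refine ⟨?_, hLL, hTT, ?_⟩
  · have e1 := h'.div_dot_fst
    have e2 := h'.div_dot_snd
    have f1 := h.div_dot_fst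
    have f2 := h.div_dot_snd
    rw [hLL, smul_dotProduct, smul_eq_mul] at f1 f2
    rw [← sub_eq_zero]
    -- The difference is tested against `n`, `a` and `b`: the trace controls the first component,
    -- the torsion the other two.
    refine eq_zero_of_dot_eq_zero h.unit h.orth h.ne ?_ ?_ ?_
    · rw [sub_dotProduct, smul_dotProduct, h.div_dot_normal, h'.div_dot_normal, hTT, smul_eq_mul]
      ring
    · rw [sub_dotProduct, smul_dotProduct, f1]
      generalize ax' + by'' = W at *
      generalize ay' - bx' = C at *
      rw [ha, hb]
      simp only [dotProduct_add, dotProduct_smul, smul_eq_mul, e1, e2]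
      ring
    · rw [← h.rot, sub_dotProduct, smul_dotProduct, f2]
      generalize ax' + by'' = W at *
      generalize ay' - bx' = C at *
      rw [ha, hb]
      simp only [dotProduct_add, dotProduct_smul, smul_eq_mul, e1, e2]
      ring
  · rw [h.curl_dot_normal, hLL, smul_dotProduct, h'.curl_dot_normal, smul_eq_mul]

end Jet

end Wirtinger

/-! ### Surfaces in a conformal parameter and their complex notation -/

namespace Wirtinger

open Set Complex Filter Matrix
open scoped ComplexConjugate

/-- An expression in two vectors that is multiplied by `|c|²` when the pair `(a, b)` is transformed
so that `a - ib` is multiplied by `c`. -/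
def IsRotScale {V : Type*} [SMul ℝ V] (F : V3 → V3 → V) : Prop :=
  ∀ (a b : V3) (x y : ℝ), F (x • a + y • b) (-y • a + x • b) = (x ^ 2 + y ^ 2) • F a b

/-- A surface in a conformal parameter: frame components `a`, `b` of the coordinate vectors and `n`
of the normal, with the equation `Λ` of Maurer-Cartan and prescribed mean curvature, encoded
by `Θ`. -/
structure SurfaceData (Λ : V3 → V3 → V3) (Θ : V3 → V3 → V3 → ℝ) (U : Set ℂ) (a b n : ℂ → V3) :
    Prop where
  contDiff_fst : ContDiffOn ℝ 2 a U
  contDiff_snd : ContDiffOn ℝ 2 b U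
  contDiff_normal : ContDiffOn ℝ 2 n U
  unit : ∀ z ∈ U, n z ⬝ᵥ n z = 1
  orth : ∀ z ∈ U, a z ⬝ᵥ n z = 0
  rot : ∀ z ∈ U, b z = n z ⨯₃ a z
  ne : ∀ z ∈ U, a z ≠ 0
  maurerCartan : ∀ z ∈ U, fderiv ℝ a z I - fderiv ℝ b z 1 = Λ (a z) (b z)
  mean : ∀ z ∈ U, fderiv ℝ n z 1 ⬝ᵥ a z + fderiv ℝ n z I ⬝ᵥ b z = Θ (n z) (a z) (b z)

lemma hasFDerivAt_coord {f : ℂ → V3} {z : ℂ} (hf : DifferentiableAt ℝ f z) (k : Fin 3) :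
    HasFDerivAt (fun z => f z k) ((ContinuousLinearMap.proj k).comp (fderiv ℝ f z)) z :=
  (hasFDerivAt_pi'.1 hf.hasFDerivAt) k

lemma fderiv_dot {f g : ℂ → V3} {z : ℂ} (hf : DifferentiableAt ℝ f z)
    (hg : DifferentiableAt ℝ g z) (v : ℂ) :
    fderiv ℝ (fun z => f z ⬝ᵥ g z) z v = fderiv ℝ f z v ⬝ᵥ g z + f z ⬝ᵥ fderiv ℝ g z v := by
  have h := fun k => (hasFDerivAt_coord hf k).mul (hasFDerivAt_coord hg k)
  have h3 := (((h 0).add (h 1)).add (h 2)).fderiv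
  have e : (fun z => f z ⬝ᵥ g z) = (((fun z => f z 0) * fun z => g z 0) +
      ((fun z => f z 1) * fun z => g z 1)) + ((fun z => f z 2) * fun z => g z 2) := by
    funext z; simp [dot3]
  rw [e, h3]
  simp [dot3]
  ring

lemma dot_deriv_congr {f g f₂ g₂ : ℂ → V3} {z : ℂ} (hf : DifferentiableAt ℝ f z)
    (hg : DifferentiableAt ℝ g z) (hf₂ : DifferentiableAt ℝ f₂ z) (hg₂ : DifferentiableAt ℝ g₂ z)
    (h : ∀ᶠ y in 𝓝 z, f y ⬝ᵥ g y = f₂ y ⬝ᵥ g₂ y) (v : ℂ) :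
    fderiv ℝ f z v ⬝ᵥ g z + f z ⬝ᵥ fderiv ℝ g z v =
      fderiv ℝ f₂ z v ⬝ᵥ g₂ z + f₂ z ⬝ᵥ fderiv ℝ g₂ z v := by
  rw [← fderiv_dot hf hg, ← fderiv_dot hf₂ hg₂]
  have : (fun z => f z ⬝ᵥ g z) =ᶠ[𝓝 z] fun z => f₂ z ⬝ᵥ g₂ z := h
  rw [this.fderiv_eq]

section Data

variable {Λ : V3 → V3 → V3} {Θ : V3 → V3 → V3 → ℝ} {U : Set ℂ} {a b n : ℂ → V3}

lemma SurfaceData.differentiableAt (D : SurfaceData Λ Θ U a b n) (hU : IsOpen U) {z : ℂ}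
    (hz : z ∈ U) : DifferentiableAt ℝ a z ∧ DifferentiableAt ℝ b z ∧ DifferentiableAt ℝ n z :=
  ⟨(D.contDiff_fst.differentiableOn two_ne_zero).differentiableAt (hU.mem_nhds hz),
    (D.contDiff_snd.differentiableOn two_ne_zero).differentiableAt (hU.mem_nhds hz),
    (D.contDiff_normal.differentiableOn two_ne_zero).differentiableAt (hU.mem_nhds hz)⟩

lemma SurfaceData.jet (D : SurfaceData Λ Θ U a b n) (hU : IsOpen U) {z : ℂ} (hz : z ∈ U) :
    Jet (n z) (a z) (b z) (fderiv ℝ n z 1) (fderiv ℝ n z I) (fderiv ℝ a z 1) (fderiv ℝ a z I)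
      (fderiv ℝ b z 1) (fderiv ℝ b z I) (Λ (a z) (b z)) (Θ (n z) (a z) (b z)) := by
  obtain ⟨ha, hb, hn⟩ := D.differentiableAt hU hz
  have h0 : DifferentiableAt ℝ (fun _ : ℂ => (0 : V3)) z := differentiableAt_const _
  have hev : ∀ {p : ℂ → Prop}, (∀ y ∈ U, p y) → ∀ᶠ y in 𝓝 z, p y := fun h =>
    Filter.mem_of_superset (hU.mem_nhds hz) h
  have ean := dot_deriv_congr ha hn h0 h0 (hev fun y hy => by rw [D.orth y hy]; simp)
  have ebn := dot_deriv_congr hb hn h0 h0 (hev fun y hy => by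
    rw [D.rot y hy, dotProduct_comm, dot_self_cross]; simp)
  have eab := dot_deriv_congr ha hb h0 h0 (hev fun y hy => by
    rw [D.rot y hy, dot_cross_self]; simp)
  have eaa := dot_deriv_congr ha ha hb hb (hev fun y hy => by
    rw [D.rot y hy, cross_dot_self_eq (D.unit y hy) (D.orth y hy)])
  simp only [dotProduct_zero, zero_dotProduct, add_zero] at ean ebn eab
  have half : ∀ v, fderiv ℝ a z v ⬝ᵥ a z = fderiv ℝ b z v ⬝ᵥ b z := fun v => by
    have := eaa v
    rw [dotProduct_comm (a z), dotProduct_comm (b z)] at this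
    linarith
  exact ⟨D.unit z hz, D.orth z hz, D.rot z hz, D.ne z hz, ean 1, ebn I, ean I, ebn 1, eab 1, eab I,
    half 1, half I, D.maurerCartan z hz, D.mean z hz⟩

/-- The components of the complex tangent vector `(a - ib)/2`. -/
def cvec (a b : ℂ → V3) (k : Fin 3) (z : ℂ) : ℂ := ((a z k : ℂ) - I * (b z k : ℂ)) / 2

/-- The components of `∂n/∂z`. -/
def dnormal (n : ℂ → V3) (k : Fin 3) (z : ℂ) : ℂ := del (fun z => (n z k : ℂ)) z

lemma fderiv_ofReal_coord {f : ℂ → V3} {z : ℂ} (hf : DifferentiableAt ℝ f z) (k : Fin 3) (v : ℂ) :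
    fderiv ℝ (fun z => (f z k : ℂ)) z v = (fderiv ℝ f z v k : ℂ) := by
  have := (ofRealCLM.hasFDerivAt.comp z (hasFDerivAt_coord hf k)).fderiv
  rw [show (fun z => (f z k : ℂ)) = ofRealCLM ∘ fun z => f z k from rfl, this]
  simp

lemma dnormal_eq {z : ℂ} (hn : DifferentiableAt ℝ n z) (k : Fin 3) :
    dnormal n k z = ((fderiv ℝ n z 1 k : ℂ) - I * (fderiv ℝ n z I k : ℂ)) / 2 := by
  rw [dnormal, del, fderiv_ofReal_coord hn, fderiv_ofReal_coord hn]

lemma fderiv_cvec {z : ℂ} (ha : DifferentiableAt ℝ a z) (hb : DifferentiableAt ℝ b z) (k : Fin 3)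
    (v : ℂ) : fderiv ℝ (cvec a b k) z v =
      ((fderiv ℝ a z v k : ℂ) - I * (fderiv ℝ b z v k : ℂ)) / 2 := by
  have h1 : ∀ {f : ℂ → V3}, DifferentiableAt ℝ f z →
      HasFDerivAt (fun z => (f z k : ℂ)) (fderiv ℝ (fun z => (f z k : ℂ)) z) z := fun hf =>
    (ofRealCLM.hasFDerivAt.comp z (hasFDerivAt_coord hf k)).differentiableAt.hasFDerivAt
  have := (((h1 ha).sub ((h1 hb).const_mul I)).mul_const (2⁻¹ : ℂ)).fderiv
  rw [show cvec a b k = fun z => (((fun z => (a z k : ℂ)) - fun z => I * (b z k : ℂ)) z) * 2⁻¹ from by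
    funext z; simp [cvec, div_eq_mul_inv], this]
  simp [fderiv_ofReal_coord ha, fderiv_ofReal_coord hb]
  ring

/-- Divergence and curl are the real and imaginary parts, so `Jet.compare` governs `∂A/∂z̄`. -/
lemma dbar_cvec {z : ℂ} (ha : DifferentiableAt ℝ a z) (hb : DifferentiableAt ℝ b z) (k : Fin 3) :
    dbar (cvec a b k) z = (((fderiv ℝ a z 1 + fderiv ℝ b z I) k : ℝ) +
      I * ((fderiv ℝ a z I - fderiv ℝ b z 1) k : ℝ)) / 4 := by
  rw [dbar, fderiv_cvec ha hb, fderiv_cvec ha hb]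
  simp only [Pi.add_apply, Pi.sub_apply]
  push_cast
  linear_combination (-(fderiv ℝ b z I k : ℂ) / 4) * Complex.I_sq

lemma contDiffOn_coord {f : ℂ → V3} {m : ℕ∞ω} (hf : ContDiffOn ℝ m f U) (k : Fin 3) :
    ContDiffOn ℝ m (fun z => (f z k : ℂ)) U :=
  ofRealCLM.contDiff.comp_contDiffOn (contDiffOn_pi.1 hf k)

lemma SurfaceData.contDiffOn_cvec (D : SurfaceData Λ Θ U a b n) (k : Fin 3) :
    ContDiffOn ℝ 2 (cvec a b k) U :=
  ((contDiffOn_coord D.contDiff_fst k).sub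
    (contDiffOn_const.mul (contDiffOn_coord D.contDiff_snd k))).div_const 2

lemma SurfaceData.contDiffOn_dnormal (D : SurfaceData Λ Θ U a b n) (hU : IsOpen U) (k : Fin 3) :
    ContDiffOn ℝ 1 (dnormal n k) U :=
  contDiffOn_del hU (contDiffOn_coord D.contDiff_normal k)

/-- The `(1,0)`-component of `∂n/∂z`, up to a factor. -/
def diagPart (a b n : ℂ → V3) (z : ℂ) : ℂ := ∑ k, dnormal n k z * conj (cvec a b k z)

/-- The `(0,1)`-component of `∂n/∂z`, conjugated and up to a factor. -/
def offPart (a b n : ℂ → V3) (z : ℂ) : ℂ := ∑ k, conj (dnormal n k z) * conj (cvec a b k z)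

/-- The squared length of `(a - ib)/2`. -/
def cnorm (a b : ℂ → V3) (z : ℂ) : ℂ := ∑ k, cvec a b k z * conj (cvec a b k z)

/-- The Jacobian of the normal map. -/
def jac (n : ℂ → V3) (z : ℂ) : ℝ := (fderiv ℝ n z 1 ⨯₃ fderiv ℝ n z I) ⬝ᵥ n z

lemma diagPart_eq {z : ℂ} (hn : DifferentiableAt ℝ n z) :
    diagPart a b n z = ((fderiv ℝ n z 1 ⬝ᵥ a z + fderiv ℝ n z I ⬝ᵥ b z : ℝ) +
      I * (fderiv ℝ n z 1 ⬝ᵥ b z - fderiv ℝ n z I ⬝ᵥ a z : ℝ)) / 4 := by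
  simp only [diagPart, Fin.sum_univ_three, dnormal_eq hn, cvec, dot3, map_div₀, map_sub, map_mul,
    Complex.conj_I, Complex.conj_ofReal, Complex.conj_ofNat]
  push_cast
  linear_combination (-((fderiv ℝ n z I 0 : ℂ) * b z 0 + (fderiv ℝ n z I 1 : ℂ) * b z 1 +
    (fderiv ℝ n z I 2 : ℂ) * b z 2) / 4) * Complex.I_sq

lemma offPart_eq {z : ℂ} (hn : DifferentiableAt ℝ n z) :
    offPart a b n z = ((fderiv ℝ n z 1 ⬝ᵥ a z - fderiv ℝ n z I ⬝ᵥ b z : ℝ) +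
      I * (fderiv ℝ n z 1 ⬝ᵥ b z + fderiv ℝ n z I ⬝ᵥ a z : ℝ)) / 4 := by
  simp only [offPart, Fin.sum_univ_three, dnormal_eq hn, cvec, dot3, map_div₀, map_sub, map_mul,
    Complex.conj_I, Complex.conj_ofReal, Complex.conj_ofNat]
  push_cast
  linear_combination (((fderiv ℝ n z I 0 : ℂ) * b z 0 + (fderiv ℝ n z I 1 : ℂ) * b z 1 +
    (fderiv ℝ n z I 2 : ℂ) * b z 2) / 4) * Complex.I_sq

lemma cnorm_eq (D : SurfaceData Λ Θ U a b n) {z : ℂ} (hz : z ∈ U) :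
    cnorm a b z = (a z ⬝ᵥ a z / 2 : ℝ) := by
  have h : b z ⬝ᵥ b z = a z ⬝ᵥ a z := by
    rw [D.rot z hz, cross_dot_self_eq (D.unit z hz) (D.orth z hz)]
  have h2 : a z ⬝ᵥ a z / 2 = (a z ⬝ᵥ a z + b z ⬝ᵥ b z) / 4 := by rw [h]; ring
  rw [h2]
  simp only [cnorm, Fin.sum_univ_three, cvec, dot3, map_div₀, map_sub, map_mul,
    Complex.conj_I, Complex.conj_ofReal, Complex.conj_ofNat]
  push_cast
  linear_combination (-((b z 0 : ℂ) ^ 2 + (b z 1 : ℂ) ^ 2 + (b z 2 : ℂ) ^ 2) / 4) * Complex.I_sq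

lemma cnorm_ne_zero (D : SurfaceData Λ Θ U a b n) {z : ℂ} (hz : z ∈ U) : cnorm a b z ≠ 0 := by
  rw [cnorm_eq D hz]
  have := dot_self_pos (D.ne z hz)
  exact_mod_cast (by positivity)

/-- By the Cauchy-Binet identity `|diag|² - |off|²` is a quarter of `(n_x × n_y) · (a × b)`, and `a
× b = |a|² n` turns this into a positive multiple of the Jacobian. -/
lemma norm_offPart_lt (D : SurfaceData Λ Θ U a b n) (hU : IsOpen U) {z : ℂ} (hz : z ∈ U)
    (hj : 0 < jac n z) : ‖offPart a b n z‖ < ‖diagPart a b n z‖ := by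
  obtain ⟨ha, hb, hn⟩ := D.differentiableAt hU hz
  rw [← sq_lt_sq₀ (norm_nonneg _) (norm_nonneg _), ← Complex.normSq_eq_norm_sq,
    ← Complex.normSq_eq_norm_sq, diagPart_eq hn, offPart_eq hn]
  have hN : ∀ p q : ℝ, Complex.normSq (((p : ℂ) + I * (q : ℂ)) / 4) = (p ^ 2 + q ^ 2) / 16 := by
    intro p q
    rw [mul_comm I, Complex.normSq_div, Complex.normSq_add_mul_I]; norm_num
  rw [hN, hN, D.rot z hz]
  have hpos := dot_self_pos (D.ne z hz)
  have key : (fderiv ℝ n z 1 ⨯₃ fderiv ℝ n z I) ⬝ᵥ (a z ⨯₃ (n z ⨯₃ a z)) =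
      (a z ⬝ᵥ a z) * jac n z := by
    have e : a z ⨯₃ (n z ⨯₃ a z) = (a z ⬝ᵥ a z) • n z := by
      have h0 := D.orth z hz
      funext i
      simp only [dot3] at h0
      fin_cases i <;> simp [cross_apply, Matrix.cons_val, dot3]
      · linear_combination (-(a z 0)) * h0
      · linear_combination (-(a z 1)) * h0
      · linear_combination (-(a z 2)) * h0
    rw [e, dotProduct_smul, smul_eq_mul, jac]
  rw [cross_dot_cross] at key
  have : 0 < (a z ⬝ᵥ a z) * jac n z := mul_pos hpos hj
  nlinarith

end Data

end Wirtinger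

/-! ### Comparing two surfaces with corresponding normals -/

namespace Wirtinger

open Set Complex Filter Matrix
open scoped ComplexConjugate

/-- The coefficients of the quadratic differential attached to `A = (a - ib)/2`, `P = ∂n/∂z` and
the normal `N`. -/
def quadCoeff (A P N : Fin 3 → ℂ) (j k : Fin 3) : ℂ :=
  conj (A j) * (P ⨯₃ N) k / ∑ i, A i * conj (A i)

/-- A change of conformal parameter multiplies `A` and `P` by the same `c`. Numerator and
denominator both acquire `c conj c`, so the coefficients are functions on the surface. -/
lemma quadCoeff_smul {c : ℂ} (hc : c ≠ 0) (A P N : Fin 3 → ℂ) :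
    quadCoeff (c • A) (c • P) N = quadCoeff A P N := by
  funext j k
  have hs : ∑ i, (c • A) i * conj ((c • A) i) = (c * conj c) * ∑ i, A i * conj (A i) := by
    rw [Finset.mul_sum]
    refine Finset.sum_congr rfl fun i _ => ?_
    simp only [Pi.smul_apply, smul_eq_mul, map_mul]; ring
  have hcc : c * conj c ≠ 0 := mul_ne_zero hc ((map_ne_zero _).2 hc)
  rw [quadCoeff, quadCoeff, hs]
  simp only [map_smul, LinearMap.smul_apply, Pi.smul_apply, smul_eq_mul, map_mul]
  rw [← mul_div_mul_left (conj (A j) * (P ⨯₃ N) k) _ hcc]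
  congr 1; ring

/-- A quadratic form with matrix `quadCoeff` is a product of two linear forms. -/
lemma sum_quadCoeff_mul (A P N v : Fin 3 → ℂ) :
    ∑ j, ∑ k, quadCoeff A P N j k * (v j * v k) =
      (∑ j, v j * conj (A j)) * (∑ k, v k * (P ⨯₃ N) k) / ∑ i, A i * conj (A i) := by
  simp only [quadCoeff, Fin.sum_univ_three]
  ring

section Compare

variable {Λ : V3 → V3 → V3} {Θ : V3 → V3 → V3 → ℝ} {O W : Set ℂ} {a b n a' b' n' : ℂ → V3}
  {φ : ℂ → ℂ}

/-- The factor `t` with `a - ib = t (a' - ib')`. -/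
def scaleFactor (a a' b' : ℂ → V3) (φ : ℂ → ℂ) (z : ℂ) : ℂ :=
  ((a z ⬝ᵥ a' (φ z)) / (a' (φ z) ⬝ᵥ a' (φ z)) : ℝ) +
    ((a z ⬝ᵥ b' (φ z)) / (a' (φ z) ⬝ᵥ a' (φ z)) : ℝ) * I

/-- Two surfaces in conformal parameters, the normals of which correspond under `φ`. -/
structure Matched (Λ : V3 → V3 → V3) (Θ : V3 → V3 → V3 → ℝ) (O W : Set ℂ) (a b n a' b' n' : ℂ → V3)
    (φ : ℂ → ℂ) : Prop where
  torsion : IsRotScale Λ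
  trace : ∀ m, IsRotScale (Θ m)
  isOpen_fst : IsOpen O
  isOpen_snd : IsOpen W
  fst : SurfaceData Λ Θ O a b n
  snd : SurfaceData Λ Θ W a' b' n'
  contDiff : ContDiffOn ℝ 2 φ O
  mapsTo : MapsTo φ O W
  normal : ∀ z ∈ O, n z = n' (φ z)
  jac_pos : ∀ w ∈ W, 0 < jac n' w

namespace Matched

variable (M : Matched Λ Θ O W a b n a' b' n' φ)
include M

/-- Equal normals give equal tangent planes with equal orientation, and positive conformal bases of
one plane differ by a complex factor. -/
lemma rotScale {z : ℂ} (hz : z ∈ O) :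
    a z = (scaleFactor a a' b' φ z).re • a' (φ z) + (scaleFactor a a' b' φ z).im • b' (φ z) ∧
    b z = -(scaleFactor a a' b' φ z).im • a' (φ z) +
      (scaleFactor a a' b' φ z).re • b' (φ z) := by
  have hw := M.mapsTo hz
  have h := exists_rotScale (M.fst.unit z hz) (M.fst.orth z hz)
    (by rw [M.normal z hz]; exact M.snd.orth _ hw) (M.snd.ne _ hw)
  have hb : n z ⨯₃ a' (φ z) = b' (φ z) := by rw [M.normal z hz, M.snd.rot _ hw]
  rw [hb] at h
  have hre : (scaleFactor a a' b' φ z).re = (a z ⬝ᵥ a' (φ z)) / (a' (φ z) ⬝ᵥ a' (φ z)) := by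
    simp [scaleFactor]
  have him : (scaleFactor a a' b' φ z).im = (a z ⬝ᵥ b' (φ z)) / (a' (φ z) ⬝ᵥ a' (φ z)) := by
    simp [scaleFactor]
  rw [hre, him]
  exact ⟨h.1, (M.fst.rot z hz).trans h.2⟩

lemma cvec_eq {z : ℂ} (hz : z ∈ O) (k : Fin 3) :
    cvec a b k z = scaleFactor a a' b' φ z * cvec a' b' k (φ z) := by
  obtain ⟨h1, h2⟩ := M.rotScale hz
  have h1k := congrFun h1 k
  have h2k := congrFun h2 k
  simp only [Pi.add_apply, Pi.smul_apply, smul_eq_mul] at h1k h2k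
  rw [cvec, cvec, h1k, h2k]
  conv_rhs => rw [← Complex.re_add_im (scaleFactor a a' b' φ z)]
  push_cast
  linear_combination ((scaleFactor a a' b' φ z).im * (b' (φ z) k : ℂ) / 2) * Complex.I_sq

lemma scaleFactor_ne_zero {z : ℂ} (hz : z ∈ O) : scaleFactor a a' b' φ z ≠ 0 := by
  intro h
  have := (M.rotScale hz).1
  rw [h] at this
  exact M.fst.ne z hz (by simpa using this)

/-- This is where the structure equations enter: torsion and prescribed trace scale by `|t|²`, and
`Jet.compare` passes this on to everything they determine. The component `offPart` is not determined
in this way. -/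
lemma dbar_cvec_eq_and {z : ℂ} (hz : z ∈ O) :
    (∀ k, dbar (cvec a b k) z = scaleFactor a a' b' φ z * conj (scaleFactor a a' b' φ z) *
      dbar (cvec a' b' k) (φ z)) ∧
    diagPart a b n z = scaleFactor a a' b' φ z * conj (scaleFactor a a' b' φ z) *
      diagPart a' b' n' (φ z) := by
  have hw := M.mapsTo hz
  obtain ⟨h1, h2⟩ := M.rotScale hz
  obtain ⟨da, db, dn⟩ := M.fst.differentiableAt M.isOpen_fst hz
  obtain ⟨da', db', dn'⟩ := M.snd.differentiableAt M.isOpen_snd hw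
  have J := M.fst.jet M.isOpen_fst hz
  have J' := M.snd.jet M.isOpen_snd hw
  rw [← M.normal z hz] at J'
  have hL := M.torsion (a' (φ z)) (b' (φ z)) (scaleFactor a a' b' φ z).re
    (scaleFactor a a' b' φ z).im
  have hT := M.trace (n z) (a' (φ z)) (b' (φ z)) (scaleFactor a a' b' φ z).re
    (scaleFactor a a' b' φ z).im
  rw [← h1, ← h2] at hL hT
  obtain ⟨c1, c2, c3, c4⟩ := J.compare J' h1 h2 hL hT
  have hs : scaleFactor a a' b' φ z * conj (scaleFactor a a' b' φ z) =
      ((scaleFactor a a' b' φ z).re ^ 2 + (scaleFactor a a' b' φ z).im ^ 2 : ℝ) := by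
    rw [Complex.mul_conj, Complex.normSq_apply]; push_cast; ring
  rw [hs]
  constructor
  · intro k
    rw [dbar_cvec da db, dbar_cvec da' db', c1, c2]
    simp only [Pi.smul_apply, smul_eq_mul]
    push_cast; ring
  · rw [diagPart_eq dn, diagPart_eq dn', c3, c4]
    push_cast; ring

/-- Inserting `A = t A'` into `diagPart` gives `|t|²` times the right-hand component; the factor
`conj t` cancels. -/
lemma sum_dnormal_mul {z : ℂ} (hz : z ∈ O) :
    ∑ k, dnormal n k z * conj (cvec a' b' k (φ z)) =
      scaleFactor a a' b' φ z * diagPart a' b' n' (φ z) := by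
  have ht := M.scaleFactor_ne_zero hz
  have h := (M.dbar_cvec_eq_and hz).2
  have hc : conj (scaleFactor a a' b' φ z) ≠ 0 := (map_ne_zero _).2 ht
  apply mul_left_cancel₀ hc
  rw [← mul_assoc, mul_comm (conj (scaleFactor a a' b' φ z)) (scaleFactor a a' b' φ z), ← h,
    diagPart, Finset.mul_sum]
  refine Finset.sum_congr rfl fun k _ => ?_
  rw [M.cvec_eq hz, map_mul]; ring

lemma differentiableAt_map {z : ℂ} (hz : z ∈ O) : DifferentiableAt ℝ φ z :=
  (M.contDiff.differentiableOn two_ne_zero).differentiableAt (M.isOpen_fst.mem_nhds hz)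

lemma dnormal_comp {z : ℂ} (hz : z ∈ O) (k : Fin 3) :
    dnormal n k z = dnormal n' k (φ z) * del φ z + conj (dnormal n' k (φ z)) * conj (dbar φ z) := by
  have hw := M.mapsTo hz
  have hev : (fun z => (n z k : ℂ)) =ᶠ[𝓝 z] fun z => (fun w => (n' w k : ℂ)) (φ z) :=
    Filter.mem_of_superset (M.isOpen_fst.mem_nhds hz) fun y hy => by
      simp only [mem_ofPred_eq, M.normal y hy]
  have hd : DifferentiableAt ℝ (fun w => (n' w k : ℂ)) (φ z) :=
    ((contDiffOn_coord M.snd.contDiff_normal k).differentiableOn two_ne_zero).differentiableAt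
      (M.isOpen_snd.mem_nhds hw)
  -- The normal is real, so its two Wirtinger derivatives are conjugate.
  have hc : dbar (fun w => (n' w k : ℂ)) (φ z) = conj (del (fun w => (n' w k : ℂ)) (φ z)) := by
    rw [← dbar_conj hd]; simp
  rw [dnormal, del_congr hev, (del_dbar_comp hd (M.differentiableAt_map hz)).1, hc]
  rfl

lemma diagPart_ne_zero {z : ℂ} (hz : z ∈ O) : diagPart a' b' n' (φ z) ≠ 0 := by
  have := norm_offPart_lt M.snd M.isOpen_snd (M.mapsTo hz) (M.jac_pos _ (M.mapsTo hz))
  exact norm_pos_iff.1 ((norm_nonneg _).trans_lt this)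

/-- Pairing the chain rule `n_z = n'_w φ_z + conj(n'_w) conj(φ_z̄)` with `conj A'` gives `t · diag'
= diag' φ_z + off' conj(φ_z̄)`. -/
lemma scaleFactor_eq {z : ℂ} (hz : z ∈ O) : scaleFactor a a' b' φ z =
    del φ z + offPart a' b' n' (φ z) / diagPart a' b' n' (φ z) * conj (dbar φ z) := by
  have h0 := M.diagPart_ne_zero hz
  have h := M.sum_dnormal_mul hz
  simp only [M.dnormal_comp hz] at h
  have e : ∑ k, (dnormal n' k (φ z) * del φ z + conj (dnormal n' k (φ z)) * conj (dbar φ z)) *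
      conj (cvec a' b' k (φ z)) = diagPart a' b' n' (φ z) * del φ z +
        offPart a' b' n' (φ z) * conj (dbar φ z) := by
    rw [diagPart, offPart, Finset.sum_mul, Finset.sum_mul, ← Finset.sum_add_distrib]
    exact Finset.sum_congr rfl fun k _ => by ring
  rw [e] at h
  field_simp
  linear_combination -h

end Matched

lemma contDiffOn_conj {f : ℂ → ℂ} {m : ℕ∞ω} (hf : ContDiffOn ℝ m f O) :
    ContDiffOn ℝ m (fun z => conj (f z)) O :=
  Complex.conjCLE.contDiff.comp_contDiffOn hf

lemma contDiffOn_diagPart (D : SurfaceData Λ Θ O a b n) (hO : IsOpen O) :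
    ContDiffOn ℝ 1 (diagPart a b n) O :=
  ContDiffOn.sum fun k _ => (D.contDiffOn_dnormal hO k).mul
    (contDiffOn_conj ((D.contDiffOn_cvec k).of_le one_le_two))

lemma contDiffOn_offPart (D : SurfaceData Λ Θ O a b n) (hO : IsOpen O) :
    ContDiffOn ℝ 1 (offPart a b n) O :=
  ContDiffOn.sum fun k _ => (contDiffOn_conj (D.contDiffOn_dnormal hO k)).mul
    (contDiffOn_conj ((D.contDiffOn_cvec k).of_le one_le_two))

lemma contDiffOn_cnorm (D : SurfaceData Λ Θ O a b n) : ContDiffOn ℝ 1 (cnorm a b) O :=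
  ContDiffOn.sum fun k _ => ((D.contDiffOn_cvec k).of_le one_le_two).mul
    (contDiffOn_conj ((D.contDiffOn_cvec k).of_le one_le_two))

lemma contDiffOn_dot {f g : ℂ → V3} {m : ℕ∞ω} (hf : ContDiffOn ℝ m f O) (hg : ContDiffOn ℝ m g O) :
    ContDiffOn ℝ m (fun z => f z ⬝ᵥ g z) O := by
  simp only [dot3]
  have hf' := fun k => contDiffOn_pi.1 hf k
  have hg' := fun k => contDiffOn_pi.1 hg k
  exact (((hf' 0).mul (hg' 0)).add ((hf' 1).mul (hg' 1))).add ((hf' 2).mul (hg' 2))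

namespace Matched

variable (M : Matched Λ Θ O W a b n a' b' n' φ)
include M

lemma contDiffOn_scaleFactor : ContDiffOn ℝ 1 (scaleFactor a a' b' φ) O := by
  have ha' : ContDiffOn ℝ 2 (fun z => a' (φ z)) O := M.snd.contDiff_fst.comp M.contDiff M.mapsTo
  have hb' : ContDiffOn ℝ 2 (fun z => b' (φ z)) O := M.snd.contDiff_snd.comp M.contDiff M.mapsTo
  have hne : ∀ z ∈ O, a' (φ z) ⬝ᵥ a' (φ z) ≠ 0 := fun z hz =>
    (dot_self_pos (M.snd.ne _ (M.mapsTo hz))).ne'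
  have h1 := (contDiffOn_dot M.fst.contDiff_fst ha').div (contDiffOn_dot ha' ha') hne
  have h2 := (contDiffOn_dot M.fst.contDiff_fst hb').div (contDiffOn_dot ha' ha') hne
  exact ((ofRealCLM.contDiff.comp_contDiffOn h1).add
    ((ofRealCLM.contDiff.comp_contDiffOn h2).mul contDiffOn_const)).of_le one_le_two

lemma contDiffOn_conj_dbar : ContDiffOn ℝ 1 (fun z => conj (dbar φ z)) O :=
  contDiffOn_conj (contDiffOn_dbar M.isOpen_fst M.contDiff)

/-- The derivative `∂t/∂z̄` is a multiple of `∂φ/∂z̄`. -/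
lemma dbar_scaleFactor {z : ℂ} (hz : z ∈ O) :
    dbar (scaleFactor a a' b' φ) z * cnorm a' b' (φ z) = dbar φ z * (scaleFactor a a' b' φ z *
      ∑ k, (conj (offPart a' b' n' (φ z) / diagPart a' b' n' (φ z)) * dbar (cvec a' b' k) (φ z) -
        del (cvec a' b' k) (φ z)) * conj (cvec a' b' k (φ z))) := by
  have hw := M.mapsTo hz
  have hφ := M.differentiableAt_map hz
  have ht : DifferentiableAt ℝ (scaleFactor a a' b' φ) z :=
    (M.contDiffOn_scaleFactor.differentiableOn one_ne_zero).differentiableAt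
      (M.isOpen_fst.mem_nhds hz)
  have hA' : ∀ k, DifferentiableAt ℝ (cvec a' b' k) (φ z) := fun k =>
    ((M.snd.contDiffOn_cvec k).differentiableOn two_ne_zero).differentiableAt
      (M.isOpen_snd.mem_nhds hw)
  -- Computed from `A = t · (A' ∘ φ)` and `A_z̄ = |t|² A'_w̄`. Once `conj(φ_z)` is rewritten through
  -- `t` and `φ_z̄`, the terms without `φ_z̄` cancel.
  have hk : ∀ k, dbar (scaleFactor a a' b' φ) z * cvec a' b' k (φ z) =
      dbar φ z * (scaleFactor a a' b' φ z *
        (conj (offPart a' b' n' (φ z) / diagPart a' b' n' (φ z)) * dbar (cvec a' b' k) (φ z) -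
          del (cvec a' b' k) (φ z))) := by
    intro k
    have hev : cvec a b k =ᶠ[𝓝 z] fun z => scaleFactor a a' b' φ z * cvec a' b' k (φ z) :=
      Filter.mem_of_superset (M.isOpen_fst.mem_nhds hz) fun y hy => M.cvec_eq hy k
    have h1 := (M.dbar_cvec_eq_and hz).1 k
    rw [dbar_congr hev, dbar_mul (g := fun z => cvec a' b' k (φ z)) ht ((hA' k).comp z hφ),
      (del_dbar_comp (hA' k) hφ).2] at h1
    have h2 : conj (del φ z) = conj (scaleFactor a a' b' φ z) -
        conj (offPart a' b' n' (φ z) / diagPart a' b' n' (φ z)) * dbar φ z := by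
      rw [M.scaleFactor_eq hz, map_add, map_mul, Complex.conj_conj]; ring
    rw [h2] at h1
    linear_combination h1
  -- The vector identity is paired with `conj A'`, because a single component of `A'` may vanish.
  rw [cnorm, Finset.mul_sum, Finset.mul_sum, Finset.mul_sum]
  refine Finset.sum_congr rfl fun k _ => ?_
  linear_combination conj (cvec a' b' k (φ z)) * hk k

/-- The conjugate of `∂φ/∂z̄` satisfies a Carleman type inequality. -/
theorem norm_dbar_conj_dbar_le {z₀ : ℂ} (hz₀ : z₀ ∈ O) :
    ∃ K : ℝ, ∀ᶠ z in 𝓝 z₀, ‖dbar (fun z => conj (dbar φ z)) z‖ ≤ K * ‖conj (dbar φ z)‖ := by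
  set u : ℂ → ℂ := fun z => conj (dbar φ z) with hu
  set m : ℂ → ℂ := fun z => offPart a' b' n' (φ z) / diagPart a' b' n' (φ z) with hm
  set e : ℂ → ℂ := fun z => scaleFactor a a' b' φ z *
      (∑ k, (conj (m z) * dbar (cvec a' b' k) (φ z) -
        del (cvec a' b' k) (φ z)) * conj (cvec a' b' k (φ z))) / cnorm a' b' (φ z) with he
  have hO := M.isOpen_fst
  have hφ1 : ContDiffOn ℝ 1 φ O := M.contDiff.of_le one_le_two
  have hmC : ContDiffOn ℝ 1 m O := by
    simp only [hm, div_eq_mul_inv]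
    exact ((contDiffOn_offPart M.snd M.isOpen_snd).comp hφ1 M.mapsTo).mul
      (((contDiffOn_diagPart M.snd M.isOpen_snd).comp hφ1 M.mapsTo).inv
        fun z hz => M.diagPart_ne_zero hz)
  have hφc : ContinuousOn φ O := hφ1.continuousOn
  have heC : ContinuousOn e O := by
    refine (M.contDiffOn_scaleFactor.continuousOn.mul (continuousOn_finsetSum _ fun k _ => ?_)).div
      ((contDiffOn_cnorm M.snd).continuousOn.comp hφc M.mapsTo)
      fun z hz => cnorm_ne_zero M.snd (M.mapsTo hz)
    have hA := M.snd.contDiffOn_cvec k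
    have h1 := (contDiffOn_dbar (n := 1) M.isOpen_snd hA).continuousOn.comp hφc M.mapsTo
    have h2 := (contDiffOn_del (n := 1) M.isOpen_snd hA).continuousOn.comp hφc M.mapsTo
    have h3 := (contDiffOn_conj hA).continuousOn.comp hφc M.mapsTo
    exact (((contDiffOn_conj hmC).continuousOn.mul h1).sub h2).mul h3
  have hdm : ContinuousOn (dbar m) O := (contDiffOn_dbar (n := 0) hO hmC).continuousOn
  -- Two expressions for `t_z̄` are equated: `conj(u) e` from `dbar_scaleFactor`, and the derivative
  -- of `φ_z + m u`, in which `(φ_z)_z̄ = conj(u_z̄)`.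
  have heq : ∀ z ∈ O, conj (dbar u z) + m z * dbar u z = conj (u z) * e z - dbar m z * u z := by
    intro z hz
    have hnhds := hO.mem_nhds hz
    have hev : scaleFactor a a' b' φ =ᶠ[𝓝 z] fun z => del φ z + m z * u z :=
      Filter.mem_of_superset hnhds fun y hy => M.scaleFactor_eq hy
    have hdel : DifferentiableAt ℝ (del φ) z :=
      ((contDiffOn_del (n := 1) hO M.contDiff).differentiableOn one_ne_zero).differentiableAt hnhds
    have hdb : DifferentiableAt ℝ (dbar φ) z :=
      ((contDiffOn_dbar (n := 1) hO M.contDiff).differentiableOn one_ne_zero).differentiableAt hnhds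
    have hmd : DifferentiableAt ℝ m z :=
      (hmC.differentiableOn one_ne_zero).differentiableAt hnhds
    have hud : DifferentiableAt ℝ u z :=
      (M.contDiffOn_conj_dbar.differentiableOn one_ne_zero).differentiableAt hnhds
    have h1 := dbar_congr hev
    rw [dbar_add (g := fun z => m z * u z) hdel (hmd.mul hud), dbar_mul hmd hud,
      dbar_del_comm (M.contDiff.contDiffAt hnhds)] at h1
    have h2 : conj (dbar u z) = del (dbar φ) z := by rw [hu, dbar_conj hdb, Complex.conj_conj]
    have h3 := M.dbar_scaleFactor hz
    have h4 : dbar (scaleFactor a a' b' φ) z = conj (u z) * e z := by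
      rw [he, hu]
      simp only [Complex.conj_conj]
      rw [← mul_div_assoc, eq_div_iff (cnorm_ne_zero M.snd (M.mapsTo hz)), h3]
    rw [h2]
    linear_combination h4 - h1
  have hm1 : ‖m z₀‖ < 1 := by
    rw [hm, norm_div, div_lt_one (norm_pos_iff.2 (M.diagPart_ne_zero hz₀))]
    exact norm_offPart_lt M.snd M.isOpen_snd (M.mapsTo hz₀) (M.jac_pos _ (M.mapsTo hz₀))
  obtain ⟨c, hc1, hc2⟩ := exists_between hm1
  have hcont : ∀ {f : ℂ → ℂ}, ContinuousOn f O → ContinuousAt f z₀ := fun h =>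
    h.continuousAt (hO.mem_nhds hz₀)
  have ev1 := (hcont hmC.continuousOn).norm.eventually_lt_const hc1
  have ev2 := (hcont heC).norm.eventually_lt_const (lt_add_one _)
  have ev3 := (hcont hdm).norm.eventually_lt_const (lt_add_one _)
  -- Since `|m| < c < 1` near `z₀`, the left side of `heq` has norm at least `(1 - c)|u_z̄|`; the
  -- numerator bounds `|e| + |m_z̄|` near `z₀`.
  refine ⟨((‖e z₀‖ + 1) + (‖dbar m z₀‖ + 1)) / (1 - c), ?_⟩
  filter_upwards [ev1, ev2, ev3, hO.mem_nhds hz₀] with z h1 h2 h3 hz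
  have h := heq z hz
  have hpos : 0 < 1 - c := by linarith
  rw [div_mul_eq_mul_div, le_div_iff₀ hpos]
  have e1 : ‖dbar u z‖ ≤ ‖conj (dbar u z) + m z * dbar u z‖ + ‖m z‖ * ‖dbar u z‖ := by
    have := norm_sub_le (conj (dbar u z) + m z * dbar u z) (m z * dbar u z)
    rwa [add_sub_cancel_right, Complex.norm_conj, norm_mul (m z)] at this
  have e2 : ‖conj (dbar u z) + m z * dbar u z‖ ≤ (‖e z‖ + ‖dbar m z‖) * ‖u z‖ := by
    rw [h]
    refine (norm_sub_le _ _).trans (le_of_eq ?_)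
    rw [norm_mul, norm_mul, Complex.norm_conj]; ring
  nlinarith [norm_nonneg (dbar u z), norm_nonneg (u z)]

end Matched

end Compare

end Wirtinger

/-! ### The quadratic differential in conformal parameters -/

namespace Wirtinger

open Set Complex Filter Matrix
open scoped ComplexConjugate

section Quad

variable {Λ : V3 → V3 → V3} {Θ : V3 → V3 → V3 → ℝ} {O W : Set ℂ} {a b n a' b' n' : ℂ → V3}
  {φ : ℂ → ℂ}

/-- The coefficients of the quadratic differential, as functions of the parameter. -/
def quadCoeffAt (a b n : ℂ → V3) (z : ℂ) : Fin 3 → Fin 3 → ℂ :=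
  quadCoeff (fun k => cvec a b k z) (fun k => dnormal n k z) (fun k => (n z k : ℂ))

lemma contDiffOn_quadCoeffAt (D : SurfaceData Λ Θ O a b n) (hO : IsOpen O) (j k : Fin 3) :
    ContDiffOn ℝ 1 (fun z => quadCoeffAt a b n z j k) O := by
  have hP := fun k => D.contDiffOn_dnormal hO k
  have hn := fun k => (contDiffOn_coord D.contDiff_normal k).of_le one_le_two
  have hA := contDiffOn_conj ((D.contDiffOn_cvec j).of_le one_le_two)
  have hc : ContDiffOn ℝ 1 (fun z => ((fun k => dnormal n k z) ⨯₃ fun k => (n z k : ℂ)) k) O := by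
    fin_cases k <;> simp only [cross_apply, Matrix.cons_val, Fin.zero_eta, Fin.mk_one,
      Fin.reduceFinMk]
    · exact ((hP 1).mul (hn 2)).sub ((hP 2).mul (hn 1))
    · exact ((hP 2).mul (hn 0)).sub ((hP 0).mul (hn 2))
    · exact ((hP 0).mul (hn 1)).sub ((hP 1).mul (hn 0))
  simp only [quadCoeffAt, quadCoeff, div_eq_mul_inv]
  exact (hA.mul hc).mul ((contDiffOn_cnorm D).inv fun z hz => cnorm_ne_zero D hz)

/-- The quadratic form vanishes on `∂n/∂z`. -/
lemma sum_quadCoeffAt_dnormal (a b n : ℂ → V3) (z : ℂ) :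
    ∑ j, ∑ k, quadCoeffAt a b n z j k * (dnormal n j z * dnormal n k z) = 0 := by
  rw [quadCoeffAt, sum_quadCoeff_mul]
  have : ∑ k, dnormal n k z * ((fun k => dnormal n k z) ⨯₃ fun k => (n z k : ℂ)) k = 0 :=
    dot_self_cross (fun k => dnormal n k z) _
  rw [this]; simp

namespace Matched

variable (M : Matched Λ Θ O W a b n a' b' n' φ)
include M

/-- The first linear form contributes `t · diag'`. In the second, the part of `n_z` along `n'_w`
drops out and only the multiple `conj(φ_z̄)` of `conj(n'_w)` remains. -/
lemma sum_quadCoeffAt_mul {z : ℂ} (hz : z ∈ O) :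
    ∑ j, ∑ k, quadCoeffAt a' b' n' (φ z) j k * (dnormal n j z * dnormal n k z) =
      conj (dbar φ z) * (scaleFactor a a' b' φ z * diagPart a' b' n' (φ z) *
        (-(I / 2) * (jac n' (φ z) : ℂ)) / cnorm a' b' (φ z)) := by
  have hw := M.mapsTo hz
  obtain ⟨-, -, dn'⟩ := M.snd.differentiableAt M.isOpen_snd hw
  rw [quadCoeffAt, sum_quadCoeff_mul, M.sum_dnormal_mul hz]
  -- The constant comes from `det(conj P, P, N) = -(i/2) (n'_x × n'_y) · N` for `P = (n'_x - i
  -- n'_y)/2`.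
  have e : ∑ k, dnormal n k z * ((fun k => dnormal n' k (φ z)) ⨯₃ fun k => (n' (φ z) k : ℂ)) k =
      conj (dbar φ z) * (-(I / 2) * (jac n' (φ z) : ℂ)) := by
    simp only [M.dnormal_comp hz, Fin.sum_univ_three, cross_apply, Matrix.cons_val,
      dnormal_eq dn', jac, dot3, map_div₀, map_sub, map_mul, Complex.conj_I, Complex.conj_ofReal,
      Complex.conj_ofNat]
    push_cast
    ring
  rw [e, ← cnorm]
  ring

/-- The quadratic differential vanishes exactly where `φ` is holomorphic. -/
lemma factor_ne_zero {z : ℂ} (hz : z ∈ O) : scaleFactor a a' b' φ z * diagPart a' b' n' (φ z) *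
    (-(I / 2) * (jac n' (φ z) : ℂ)) / cnorm a' b' (φ z) ≠ 0 := by
  have hw := M.mapsTo hz
  have hj : (jac n' (φ z) : ℂ) ≠ 0 := by exact_mod_cast (M.jac_pos _ hw).ne'
  refine div_ne_zero (mul_ne_zero (mul_ne_zero (M.scaleFactor_ne_zero hz) (M.diagPart_ne_zero hz))
    (mul_ne_zero ?_ hj)) (cnorm_ne_zero M.snd hw)
  simp

lemma continuousOn_factor : ContinuousOn (fun z => scaleFactor a a' b' φ z *
    diagPart a' b' n' (φ z) * (-(I / 2) * (jac n' (φ z) : ℂ)) / cnorm a' b' (φ z)) O := by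
  have hφc : ContinuousOn φ O := M.contDiff.continuousOn
  have hfd := M.snd.contDiff_normal.continuousOn_fderiv_of_isOpen M.isOpen_snd one_le_two
  have hj : ContinuousOn (jac n') W := by
    have h1 : ∀ v k, ContinuousOn (fun z => fderiv ℝ n' z v k) W := fun v k =>
      (continuous_apply k).comp_continuousOn (hfd.clm_apply continuousOn_const)
    have h2 : ∀ k, ContinuousOn (fun z => n' z k) W := fun k =>
      (continuous_apply k).comp_continuousOn M.snd.contDiff_normal.continuousOn
    have e : jac n' = fun z =>
        (fderiv ℝ n' z 1 1 * fderiv ℝ n' z I 2 - fderiv ℝ n' z 1 2 * fderiv ℝ n' z I 1) * n' z 0 +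
        (fderiv ℝ n' z 1 2 * fderiv ℝ n' z I 0 - fderiv ℝ n' z 1 0 * fderiv ℝ n' z I 2) * n' z 1 +
        (fderiv ℝ n' z 1 0 * fderiv ℝ n' z I 1 - fderiv ℝ n' z 1 1 * fderiv ℝ n' z I 0) * n' z 2 := by
      funext z; rw [jac, dot3]; simp [cross_apply]
    rw [e]
    exact ((((h1 1 1).mul (h1 I 2)).sub ((h1 1 2).mul (h1 I 1))).mul (h2 0)).add
      ((((h1 1 2).mul (h1 I 0)).sub ((h1 1 0).mul (h1 I 2))).mul (h2 1)) |>.add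
      ((((h1 1 0).mul (h1 I 1)).sub ((h1 1 1).mul (h1 I 0))).mul (h2 2))
  exact ((M.contDiffOn_scaleFactor.continuousOn.mul
    ((contDiffOn_diagPart M.snd M.isOpen_snd).continuousOn.comp hφc M.mapsTo)).mul
      (continuousOn_const.mul (continuous_ofReal.comp_continuousOn (hj.comp hφc M.mapsTo)))).div
      ((contDiffOn_cnorm M.snd).continuousOn.comp hφc M.mapsTo)
      fun z hz => cnorm_ne_zero M.snd (M.mapsTo hz)

/-- The quadratic differential vanishes near `z₀` or has a zero of finite order there. -/
theorem quad_eventually_zero_or_pow_mul {z₀ : ℂ} (hz₀ : z₀ ∈ O) {q : ℂ → ℂ}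
    (hq : ∀ᶠ z in 𝓝 z₀, q z =
      ∑ j, ∑ k, quadCoeffAt a' b' n' (φ z) j k * (dnormal n j z * dnormal n k z)) :
    (∀ᶠ z in 𝓝 z₀, q z = 0) ∨ ∃ (k : ℕ) (g : ℂ → ℂ), (∀ᶠ z in 𝓝 z₀, ContinuousAt g z) ∧
      g z₀ ≠ 0 ∧ ∀ᶠ z in 𝓝 z₀, q z = (z - z₀) ^ k * g z := by
  have hnhds := M.isOpen_fst.mem_nhds hz₀
  obtain ⟨K, hK⟩ := M.norm_dbar_conj_dbar_le hz₀
  rcases eventually_zero_or_pow_mul (M.contDiffOn_conj_dbar.contDiffAt hnhds) hK with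
    h0 | ⟨k, g, hg, hg0, hgk⟩
  · left
    filter_upwards [h0, hq, hnhds] with z h1 h2 hz
    rw [h2, M.sum_quadCoeffAt_mul hz, h1, zero_mul]
  · right
    refine ⟨k, fun z => g z * (scaleFactor a a' b' φ z *
      diagPart a' b' n' (φ z) * (-(I / 2) * (jac n' (φ z) : ℂ)) / cnorm a' b' (φ z)), ?_,
      mul_ne_zero hg0 (M.factor_ne_zero hz₀), ?_⟩
    · filter_upwards [hg, M.isOpen_fst.mem_nhds hz₀] with z h1 hz
      exact h1.mul (M.continuousOn_factor.continuousAt (M.isOpen_fst.mem_nhds hz))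
    · filter_upwards [hgk, hq, hnhds] with z h1 h2 hz
      rw [h2, M.sum_quadCoeffAt_mul hz, h1]; ring

end Matched

end Quad

end Wirtinger

/-! ### The left invariant frame in charts and the Maurer-Cartan equation -/

namespace MetricLie

open Set Filter Wirtinger VectorField

/-- Mixed second derivatives of `y` agree. Differentiating `y_x = Φ(y) a` and `y_y = Φ(y) b`
crosswise leaves `Φ(a_y - b_x)` on one side and the bracket of the frame fields with frozen
coefficients on the other. -/
lemma fderiv_frame_eq_lieBracket {F : Type*} [NormedAddCommGroup F] [NormedSpace ℝ F]
    {Φ : F → V3 →L[ℝ] F} {y : ℂ → F} {a b : ℂ → V3} {z₀ : ℂ} (hΦ : DifferentiableAt ℝ Φ (y z₀))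
    (hy : ContDiffAt ℝ 2 y z₀) (ha : DifferentiableAt ℝ a z₀) (hb : DifferentiableAt ℝ b z₀)
    (h1 : ∀ᶠ z in 𝓝 z₀, fderiv ℝ y z 1 = Φ (y z) (a z))
    (hI : ∀ᶠ z in 𝓝 z₀, fderiv ℝ y z Complex.I = Φ (y z) (b z)) :
    Φ (y z₀) (fderiv ℝ a z₀ Complex.I - fderiv ℝ b z₀ 1) =
      lieBracket ℝ (fun x => Φ x (a z₀)) (fun x => Φ x (b z₀)) (y z₀) := by
  have hsymm : IsSymmSndFDerivAt ℝ y z₀ := hy.isSymmSndFDerivAt (by simp)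
  have hyd : DifferentiableAt ℝ y z₀ := hy.differentiableAt two_ne_zero
  have hd : DifferentiableAt ℝ (fderiv ℝ y) z₀ :=
    (hy.fderiv_right (m := 1) (by norm_num)).differentiableAt one_ne_zero
  have hsnd : ∀ v w, fderiv ℝ (fun z => fderiv ℝ y z v) z₀ w = fderiv ℝ (fderiv ℝ y) z₀ w v := by
    intro v w
    have := (hd.hasFDerivAt.clm_apply (hasFDerivAt_const v z₀)).fderiv
    rw [this]; simp
  have hcomp : ∀ {c : ℂ → V3}, DifferentiableAt ℝ c z₀ → ∀ w,
      fderiv ℝ (fun z => Φ (y z) (c z)) z₀ w =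
        fderiv ℝ Φ (y z₀) (fderiv ℝ y z₀ w) (c z₀) + Φ (y z₀) (fderiv ℝ c z₀ w) := by
    intro c hc w
    have := ((hΦ.hasFDerivAt.comp z₀ hyd.hasFDerivAt).clm_apply hc.hasFDerivAt).fderiv
    rw [show (fun z => Φ (y z) (c z)) = fun z => (Φ ∘ y) z (c z) from rfl, this]
    simp [add_comm]
  have hconst : ∀ c w, fderiv ℝ (fun x => Φ x c) (y z₀) w = fderiv ℝ Φ (y z₀) w c := by
    intro c w
    have := (hΦ.hasFDerivAt.clm_apply (hasFDerivAt_const c (y z₀))).fderiv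
    rw [this]; simp
  have e1 := hsnd 1 Complex.I
  have e2 := hsnd Complex.I 1
  rw [Filter.EventuallyEq.fderiv_eq (f := fun z => Φ (y z) (a z)) h1, hcomp ha] at e1
  rw [Filter.EventuallyEq.fderiv_eq (f := fun z => Φ (y z) (b z)) hI, hcomp hb] at e2
  rw [hsymm.eq 1 Complex.I] at e2
  rw [← e1, h1.self_of_nhds, hI.self_of_nhds] at e2
  rw [lieBracket, hconst, hconst, map_sub]
  rw [← sub_eq_zero] at e2 ⊢
  rw [← neg_eq_zero, ← e2]
  abel

lemma contDiffAt_extChartAt_comp {X : Type*} [TopologicalSpace X] [ChartedSpace E3 X]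
    [IsManifold (𝓡 3) ∞ X] {ψ : ℂ → X} {O : Set ℂ} (hO : IsOpen O)
    (hψ : ContMDiffOn 𝓘(ℝ, ℂ) (𝓡 3) 3 ψ O) {z₀ : ℂ} (hz₀ : z₀ ∈ O) :
    ContDiffAt ℝ 3 (fun w => extChartAt (𝓡 3) (ψ z₀) (ψ w)) z₀ := by
  have h := hψ.contMDiffAt (hO.mem_nhds hz₀)
  have h2 : ContMDiffAt (𝓡 3) 𝓘(ℝ, E3) 3 (extChartAt (𝓡 3) (ψ z₀)) (ψ z₀) :=
    contMDiffAt_extChartAt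
  exact (h2.comp z₀ h).contDiffAt

variable {X : Type*} [TopologicalSpace X] [ChartedSpace E3 X] [Group X] [LieGroup (𝓡 3) ∞ X]

instance instLieGroupMinSmoothness : LieGroup (𝓡 3) (minSmoothness ℝ 3) X := by
  rw [minSmoothness_of_isRCLikeNormedField]; infer_instance

variable {g : LeftInvariantMetric X} (E : OrthonormalFrame g)

/-- The left invariant vector field with given coordinates in the frame. -/
def OrthonormalFrame.vec (c : V3) (x : X) : TangentSpace (𝓡 3) x := ∑ i, c i • E.field i x

lemma OrthonormalFrame.vec_eq (c : V3) (x : X) :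
    E.vec c x = mulInvariantVectorField (E.basis.equivFun.symm c) x := by
  simp only [vec, field, mulInvariantVectorField, Module.Basis.equivFun_symm_apply, map_sum,
    map_smul]
  rfl

lemma OrthonormalFrame.inner_field (i j : Fin 3) (x : X) :
    g.metric.inner x (E.field i x) (E.field j x) = if i = j then 1 else 0 := by
  have h := g.left_invariant x 1 (E.basis i) (E.basis j)
  rw [E.orthonormal] at h
  rw [← h]
  -- Left translation by `x` lands at `x * 1`; the inner product is transported to `x` on the common
  -- model space `E3`.
  have key : ∀ y, y = x → ∀ u v : E3, g.metric.inner x u v = g.metric.inner y u v := by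
    rintro y rfl u v; rfl
  exact key (x * 1) (mul_one x) _ _

lemma OrthonormalFrame.inner_vec_field (c : V3) (j : Fin 3) (x : X) :
    g.metric.inner x (E.vec c x) (E.field j x) = c j := by
  simp [vec, map_sum, E.inner_field]

lemma OrthonormalFrame.vec_injective (x : X) : Function.Injective fun c => E.vec c x := by
  intro c d h
  funext j
  rw [← E.inner_vec_field c j x, ← E.inner_vec_field d j x]
  exact congrArg (fun v => g.metric.inner x v (E.field j x)) h

/-- The linear isomorphism from coordinates to tangent vectors given by the frame. -/
def OrthonormalFrame.vecL (x : X) : V3 →ₗ[ℝ] TangentSpace (𝓡 3) x where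
  toFun c := E.vec c x
  map_add' c d := by simp [vec, add_smul, Finset.sum_add_distrib]
  map_smul' r c := by simp [vec, mul_smul, Finset.smul_sum]

lemma OrthonormalFrame.vec_inner (x : X) (v : TangentSpace (𝓡 3) x) :
    E.vec (fun i => g.metric.inner x v (E.field i x)) x = v := by
  have hsurj : Function.Surjective (E.vecL x) := by
    have hfin : Module.finrank ℝ V3 = Module.finrank ℝ (TangentSpace (𝓡 3) x) := by
      change _ = Module.finrank ℝ E3
      simp
    have : FiniteDimensional ℝ (TangentSpace (𝓡 3) x) := inferInstanceAs (FiniteDimensional ℝ E3)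
    exact (LinearMap.injective_iff_surjective_of_finrank_eq_finrank hfin).1 (E.vec_injective x)
  obtain ⟨c, rfl⟩ := hsurj v
  congr 1
  funext i
  exact E.inner_vec_field c i x

/-- The frame components of the Lie bracket. -/
def OrthonormalFrame.torsion (a b : V3) : V3 :=
  E.basis.equivFun ⁅E.basis.equivFun.symm a, E.basis.equivFun.symm b⁆

/-- The bracket is alternating and bilinear, so it scales with the determinant of the change of
basis. -/
lemma lie_rotScale {L : Type*} [LieRing L] [LieAlgebra ℝ L] (u v : L) (x y : ℝ) :
    ⁅x • u + y • v, -(y • u) + x • v⁆ = (x ^ 2 + y ^ 2) • ⁅u, v⁆ := by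
  simp only [lie_add, add_lie, lie_neg, smul_lie, lie_smul, lie_self, smul_zero]
  rw [← lie_skew u v]
  module

lemma OrthonormalFrame.isRotScale_torsion : IsRotScale E.torsion := by
  intro a b x y
  set T := E.basis.equivFun.symm with hT
  have h1 : T (x • a + y • b) = x • T a + y • T b := by rw [map_add, map_smul, map_smul]
  have h2 : T (-y • a + x • b) = -(y • T a) + x • T b := by
    rw [map_add, map_smul, map_smul, neg_smul]
  rw [torsion, ← hT, h1, h2, lie_rotScale (L := GroupLieAlgebra (𝓡 3) X), map_smul]
  rfl

/-- The frame in the preferred chart at `x₀`. -/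
def OrthonormalFrame.chartFrame (x₀ : X) (y : E3) : V3 →L[ℝ] E3 :=
  ∑ i, (ContinuousLinearMap.proj (R := ℝ) (φ := fun _ : Fin 3 => ℝ) i).smulRight
    (mpullbackWithin 𝓘(ℝ, E3) (𝓡 3) (extChartAt (𝓡 3) x₀).symm (E.field i) (range (𝓡 3)) y : E3)

lemma OrthonormalFrame.chartFrame_apply (x₀ : X) (c : V3) (y : E3) :
    E.chartFrame x₀ y c = mpullbackWithin 𝓘(ℝ, E3) (𝓡 3) (extChartAt (𝓡 3) x₀).symm
      (fun x => E.vec c x) (range (𝓡 3)) y := by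
  simp only [chartFrame, mpullbackWithin_apply, vec, map_sum, map_smul,
    sum_apply]
  rfl

lemma OrthonormalFrame.chartFrame_extChartAt {x₀ x : X} (hx : x ∈ (extChartAt (𝓡 3) x₀).source)
    (c : V3) : E.chartFrame x₀ (extChartAt (𝓡 3) x₀ x) c =
      mfderiv (𝓡 3) 𝓘(ℝ, E3) (extChartAt (𝓡 3) x₀) x (E.vec c x) := by
  rw [E.chartFrame_apply, mpullbackWithin_apply]
  have h1 : (mfderivWithin 𝓘(ℝ, E3) (𝓡 3) (extChartAt (𝓡 3) x₀).symm (range (𝓡 3))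
      (extChartAt (𝓡 3) x₀ x)).inverse = mfderiv (𝓡 3) 𝓘(ℝ, E3) (extChartAt (𝓡 3) x₀) x :=
    ContinuousLinearMap.inverse_eq (mfderivWithin_extChartAt_symm_comp_mfderiv_extChartAt' hx)
      (mfderiv_extChartAt_comp_mfderivWithin_extChartAt_symm' hx)
  have h2 : ∀ x', x' = x → (E.vec c x' : E3) = E.vec c x := by rintro _ rfl; rfl
  exact (congrArg (fun w : E3 => (mfderivWithin 𝓘(ℝ, E3) (𝓡 3) (extChartAt (𝓡 3) x₀).symm
    (range (𝓡 3)) (extChartAt (𝓡 3) x₀ x)).inverse w)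
      (h2 _ ((extChartAt (𝓡 3) x₀).left_inv hx))).trans
    (congrArg (fun L : E3 →L[ℝ] E3 => L (E.vec c x)) h1)

lemma OrthonormalFrame.contDiffAt_chartFrame (x₀ : X) :
    ContDiffAt ℝ 2 (E.chartFrame x₀) (extChartAt (𝓡 3) x₀ x₀) := by
  refine ContDiffAt.sum fun i _ => ?_
  have hf : ContMDiffWithinAt (𝓡 3) (𝓡 3).tangent 2
      (fun x => (Bundle.TotalSpace.mk' E3 x (E.field i x) : TangentBundle (𝓡 3) X)) univ x₀ := by
    have := (contMDiff_mulInvariantVectorField (I := 𝓡 3) (G := X) (E.basis i)).contMDiffAt (x := x₀)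
    exact (this.of_le (le_minSmoothness)).contMDiffWithinAt
  have h := contMDiffWithinAt_mpullbackWithin_extChartAt_symm (n := 3) hf uniqueMDiffOn_univ
    (mem_univ x₀) (by norm_num)
  rw [contMDiffWithinAt_vectorSpace_iff_contDiffWithinAt] at h
  have h2 := h.contDiffAt (by
    rw [preimage_univ, inter_univ]; exact extChartAt_target_mem_nhds x₀)
  exact (ContinuousLinearMap.smulRightL ℝ V3 E3
    (ContinuousLinearMap.proj i)).contDiff.contDiffAt.comp _ h2

lemma OrthonormalFrame.isInvertible_chartFrame {x₀ x : X}
    (hx : x ∈ (extChartAt (𝓡 3) x₀).source) :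
    (E.chartFrame x₀ (extChartAt (𝓡 3) x₀ x)).IsInvertible := by
  have hinj : Function.Injective (E.chartFrame x₀ (extChartAt (𝓡 3) x₀ x)) := by
    intro c d h
    rw [E.chartFrame_extChartAt hx, E.chartFrame_extChartAt hx] at h
    exact E.vec_injective x ((isInvertible_mfderiv_extChartAt hx).injective h)
  have hfin : Module.finrank ℝ V3 = Module.finrank ℝ E3 := by simp
  exact ⟨(LinearEquiv.ofInjectiveOfFinrankEq _ hinj hfin).toContinuousLinearEquiv, by
    ext; rfl⟩

lemma OrthonormalFrame.vec_torsion (a b : V3) (x : X) :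
    E.vec (E.torsion a b) x = mlieBracket (𝓡 3) (fun x => E.vec a x) (fun x => E.vec b x) x := by
  have h1 : ∀ c, (fun x => E.vec c x) = mulInvariantVectorField (E.basis.equivFun.symm c) :=
    fun c => funext (E.vec_eq c)
  rw [h1, h1, ← mulInvariantVector_mlieBracket, E.vec_eq, torsion, LinearEquiv.symm_apply_apply]
  rfl

/-- The bracket on the manifold is by definition the pullback of the bracket in the preferred chart,
so taking the chart at the point itself reduces the claim to `vec_torsion`. -/
lemma OrthonormalFrame.chartFrame_torsion (a b : V3) (x₀ : X) :
    E.chartFrame x₀ (extChartAt (𝓡 3) x₀ x₀) (E.torsion a b) =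
      lieBracket ℝ (fun y => E.chartFrame x₀ y a) (fun y => E.chartFrame x₀ y b)
        (extChartAt (𝓡 3) x₀ x₀) := by
  have hr : (extChartAt (𝓡 3) x₀).symm ⁻¹' univ ∩ range (𝓡 3) = univ := by simp
  have h1 : lieBracketWithin ℝ
      (mpullbackWithin 𝓘(ℝ, E3) (𝓡 3) (extChartAt (𝓡 3) x₀).symm (fun x => E.vec a x)
        (range (𝓡 3)))
      (mpullbackWithin 𝓘(ℝ, E3) (𝓡 3) (extChartAt (𝓡 3) x₀).symm (fun x => E.vec b x)
        (range (𝓡 3))) ((extChartAt (𝓡 3) x₀).symm ⁻¹' univ ∩ range (𝓡 3))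
        (extChartAt (𝓡 3) x₀ x₀) =
      lieBracket ℝ (fun y => E.chartFrame x₀ y a) (fun y => E.chartFrame x₀ y b)
        (extChartAt (𝓡 3) x₀ x₀) := by
    rw [hr, ← lieBracketWithin_univ, funext (E.chartFrame_apply x₀ a),
      funext (E.chartFrame_apply x₀ b)]
  have hinv := isInvertible_mfderiv_extChartAt (I := 𝓡 3) (mem_extChartAt_source (I := 𝓡 3) x₀)
  rw [E.chartFrame_extChartAt (mem_extChartAt_source x₀), E.vec_torsion, ← h1]
  exact (hinv.inverse_apply_eq.1 rfl).symm

variable {ψ : ℂ → X} {O : Set ℂ}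

lemma OrthonormalFrame.eventually_fderiv_eq (hO : IsOpen O)
    (hψ : ContMDiffOn 𝓘(ℝ, ℂ) (𝓡 3) 3 ψ O) {z₀ : ℂ} (hz₀ : z₀ ∈ O) (v : ℂ) :
    ∀ᶠ z in 𝓝 z₀, ψ z ∈ (extChartAt (𝓡 3) (ψ z₀)).source ∧
      fderiv ℝ (fun w => extChartAt (𝓡 3) (ψ z₀) (ψ w)) z v =
        E.chartFrame (ψ z₀) (extChartAt (𝓡 3) (ψ z₀) (ψ z))
          (fun i => tangentComponent E ψ z i v) := by
  have hc : ContinuousAt ψ z₀ := (hψ.contMDiffAt (hO.mem_nhds hz₀)).continuousAt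
  filter_upwards [hO.mem_nhds hz₀, hc.preimage_mem_nhds (extChartAt_source_mem_nhds (I := 𝓡 3) (ψ z₀))]
    with z hz hs
  refine ⟨hs, ?_⟩
  have hd : MDifferentiableAt 𝓘(ℝ, ℂ) (𝓡 3) ψ z :=
    (hψ.contMDiffAt (hO.mem_nhds hz)).mdifferentiableAt (by norm_num)
  have hd2 : MDifferentiableAt (𝓡 3) 𝓘(ℝ, E3) (extChartAt (𝓡 3) (ψ z₀)) (ψ z) :=
    mdifferentiableAt_extChartAt (by rwa [← extChartAt_source (𝓡 3)])
  rw [E.chartFrame_extChartAt hs, ← mfderiv_eq_fderiv]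
  have := mfderiv_comp z hd2 hd
  have h2 := E.vec_inner (ψ z) (mfderiv 𝓘(ℝ, ℂ) (𝓡 3) ψ z v)
  refine (congrArg (fun L : ℂ →L[ℝ] E3 => L v) this).trans ?_
  exact (congrArg (fun w : E3 => (mfderiv (𝓡 3) 𝓘(ℝ, E3) (extChartAt (𝓡 3) (ψ z₀)) (ψ z)) w)
    h2).symm

/-- Near `z₀` the components are the inverse of the `C²` chart frame applied to the derivative of a
`C³` map. -/
lemma OrthonormalFrame.contDiffOn_tangentComponent (hO : IsOpen O)
    (hψ : ContMDiffOn 𝓘(ℝ, ℂ) (𝓡 3) 3 ψ O) (v : ℂ) :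
    ContDiffOn ℝ 2 (fun z i => tangentComponent E ψ z i v) O := by
  intro z₀ hz₀
  refine ContDiffAt.contDiffWithinAt ?_
  have hy := contDiffAt_extChartAt_comp hO hψ hz₀
  have h1 : ContDiffAt ℝ 2 (fun z => fderiv ℝ (fun w => extChartAt (𝓡 3) (ψ z₀) (ψ w)) z v) z₀ :=
    (hy.fderiv_right (m := 2) (by norm_num)).clm_apply contDiffAt_const
  have hinv := E.isInvertible_chartFrame (mem_extChartAt_source (I := 𝓡 3) (ψ z₀))
  have h2 : ContDiffAt ℝ 2 (fun z => (E.chartFrame (ψ z₀)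
      (extChartAt (𝓡 3) (ψ z₀) (ψ z))).inverse) z₀ :=
    ContDiffAt.comp (g := ContinuousLinearMap.inverse) z₀ hinv.contDiffAt_map_inverse
      (ContDiffAt.comp (g := E.chartFrame (ψ z₀)) z₀ (E.contDiffAt_chartFrame (ψ z₀))
        (hy.of_le (by norm_num)))
  refine (h2.clm_apply h1).congr_of_eventuallyEq ?_
  filter_upwards [E.eventually_fderiv_eq hO hψ hz₀ v] with z hz
  rw [hz.2, (E.isInvertible_chartFrame hz.1).inverse_apply_self]

/-- Both sides have the same image under the chart frame, which is injective. -/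
lemma OrthonormalFrame.maurerCartan (hO : IsOpen O)
    (hψ : ContMDiffOn 𝓘(ℝ, ℂ) (𝓡 3) 3 ψ O) {z₀ : ℂ} (hz₀ : z₀ ∈ O) :
    fderiv ℝ (fun z i => tangentComponent E ψ z i 1) z₀ Complex.I -
      fderiv ℝ (fun z i => tangentComponent E ψ z i Complex.I) z₀ 1 =
      E.torsion (fun i => tangentComponent E ψ z₀ i 1)
        (fun i => tangentComponent E ψ z₀ i Complex.I) := by
  have hd : ∀ v, DifferentiableAt ℝ (fun z i => tangentComponent E ψ z i v) z₀ := fun v =>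
    ((E.contDiffOn_tangentComponent hO hψ v).contDiffAt (hO.mem_nhds hz₀)).differentiableAt
      two_ne_zero
  have := fderiv_frame_eq_lieBracket (Φ := E.chartFrame (ψ z₀))
    (y := fun w => extChartAt (𝓡 3) (ψ z₀) (ψ w))
    ((E.contDiffAt_chartFrame (ψ z₀)).differentiableAt two_ne_zero)
    ((contDiffAt_extChartAt_comp hO hψ hz₀).of_le (by norm_num)) (hd 1) (hd Complex.I)
    ((E.eventually_fderiv_eq hO hψ hz₀ 1).mono fun z hz => hz.2)
    ((E.eventually_fderiv_eq hO hψ hz₀ Complex.I).mono fun z hz => hz.2)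
  rw [← E.chartFrame_torsion] at this
  exact (E.isInvertible_chartFrame (mem_extChartAt_source _)).injective this

end MetricLie

/-! ### From immersed surfaces to data in a fixed chart -/

namespace MetricLie

open Set Filter Wirtinger Matrix

lemma isManifold_real_of_complex (M : Type*) [TopologicalSpace M] [ChartedSpace ℂ M]
    [IsManifold 𝓘(ℂ, ℂ) ω M] : IsManifold 𝓘(ℝ, ℂ) ω M := by
  refine isManifold_of_contDiffOn 𝓘(ℝ, ℂ) ω M fun e e' he he' => ?_
  have h := (contDiffGroupoid ω 𝓘(ℂ, ℂ)).compatible he he'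
  rw [contDiffGroupoid, mem_groupoid_of_pregroupoid] at h
  exact h.1.restrict_scalars ℝ

variable {M : Type*} [TopologicalSpace M] [ChartedSpace ℂ M]

/-- The derivative of the inverse of the preferred chart at `p`. -/
def chartFactor (p : M) (z : ℂ) : ℂ :=
  mfderiv 𝓘(ℂ, ℂ) 𝓘(ℂ, ℂ) (chartAt ℂ p).symm z (1 : ℂ)

variable [IsManifold 𝓘(ℂ, ℂ) ω M]

/-- Tangent vectors at `q` are read in the preferred chart at `q`, while local computations use the
chart at a fixed `p`. The two differ by a holomorphic change of parameter, with derivative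
`chartFactor`. -/
lemma hasMFDerivAt_chart_symm {p : M} {z : ℂ} (hz : z ∈ (chartAt ℂ p).target) :
    HasMFDerivAt 𝓘(ℝ, ℂ) 𝓘(ℝ, ℂ) (chartAt ℂ p).symm z
      (chartFactor p z • (ContinuousLinearMap.id ℝ ℂ)) := by
  have h : MDifferentiableAt 𝓘(ℂ, ℂ) 𝓘(ℂ, ℂ) (chartAt ℂ p).symm z :=
    mdifferentiableAt_atlas_symm (chart_mem_atlas ℂ p) hz
  have h2 := h.hasMFDerivAt
  have h3 : HasMFDerivAt 𝓘(ℝ, ℂ) 𝓘(ℝ, ℂ) (chartAt ℂ p).symm z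
    ((show ℂ →L[ℂ] ℂ from mfderiv 𝓘(ℂ, ℂ) 𝓘(ℂ, ℂ) (chartAt ℂ p).symm z).restrictScalars ℝ) :=
    ⟨h2.1, h2.2.restrictScalars ℝ⟩
  refine h3.congr_mfderiv (ContinuousLinearMap.ext fun v => ?_)
  have key : ∀ L : ℂ →L[ℂ] ℂ, L v = L 1 * v := fun L => by
    rw [mul_comm, ← smul_eq_mul, ← L.map_smul, smul_eq_mul, mul_one]
  exact key _

lemma chartFactor_ne_zero {p : M} {z : ℂ} (hz : z ∈ (chartAt ℂ p).target) :
    chartFactor p z ≠ 0 := by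
  intro h0
  have h := (mdifferentiable_chart (I := 𝓘(ℂ, ℂ)) p).comp_symm_deriv hz
  have key : ∀ A B : ℂ →L[ℂ] ℂ, A.comp B = .id ℂ ℂ → B 1 ≠ 0 := fun A B h h0 => by
    have := congrArg (fun L : ℂ →L[ℂ] ℂ => L 1) h
    simp [h0] at this
  exact key _ _ h h0

variable {X : Type*} [TopologicalSpace X] [ChartedSpace E3 X] [Group X] [LieGroup (𝓡 3) ∞ X]
  {g : LeftInvariantMetric X} {E : OrthonormalFrame g}

/-- The frame components of `dψ(v)`. -/
def tangentVec (E : OrthonormalFrame g) {M : Type*} [TopologicalSpace M] [ChartedSpace ℂ M]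
    (ψ : M → X) (p : M) (v : ℂ) : V3 := fun i => tangentComponent E ψ p i v

omit [IsManifold 𝓘(ℂ, ℂ) ω M] in
lemma tangentVec_re_im (ψ : M → X) (p : M) (x y : ℝ) :
    tangentVec E ψ p (x + y * Complex.I) =
      x • tangentVec E ψ p 1 + y • tangentVec E ψ p Complex.I := by
  funext i
  have h : ((x : ℂ) + y * Complex.I) = x • (1 : ℂ) + y • Complex.I := by simp
  simp only [tangentVec, tangentComponent, h, map_add, map_smul, Pi.add_apply, Pi.smul_apply]
  rfl

lemma OrthonormalFrame.inner_eq_dot (x : X) (v w : TangentSpace (𝓡 3) x) :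
    g.metric.inner x v w = (fun i => g.metric.inner x v (E.field i x)) ⬝ᵥ
      (fun i => g.metric.inner x w (E.field i x)) := by
  conv_lhs => rw [← E.vec_inner x w]
  simp only [OrthonormalFrame.vec, map_sum, map_smul, dotProduct, smul_eq_mul]
  exact Finset.sum_congr rfl fun i _ => mul_comm _ _

/-- The Gauss map as a vector valued map. -/
def ImmersedSurface.gaussVec (σ : ImmersedSurface E M) (p : M) : V3 := fun i => (σ.gauss p : E3) i

lemma dot_self_of_mem_sphere (n : S2) : (fun i => (n : E3) i) ⬝ᵥ (fun i => (n : E3) i) = 1 := by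
  have h : ‖(n : E3)‖ = 1 := by simp
  rw [EuclideanSpace.norm_eq, Real.sqrt_eq_one] at h
  simpa [dotProduct, sq] using h

/-- The Gram determinant gives `det² = |A|⁴`, so positivity yields `det = |A|²`; hence `B - N × A`
is orthogonal to `N`, `A` and `N × A`. -/
lemma eq_cross_of_orthogonal {A B N : V3} (hN : N ⬝ᵥ N = 1) (hAN : A ⬝ᵥ N = 0) (hBN : B ⬝ᵥ N = 0)
    (hAB : A ⬝ᵥ B = 0) (hl : A ⬝ᵥ A = B ⬝ᵥ B) (hd : 0 < Matrix.det ![A, B, N]) :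
    A ≠ 0 ∧ B = N ⨯₃ A := by
  have hA : A ≠ 0 := by
    rintro rfl
    rw [← triple_product_eq_det] at hd
    simp at hd
  refine ⟨hA, ?_⟩
  rw [← sub_eq_zero]
  have hpos := dot_self_pos hA
  have hdet : Matrix.det ![A, B, N] = B ⬝ᵥ (N ⨯₃ A) := by
    rw [← triple_product_eq_det, triple_product_permutation]
  have hsq : Matrix.det ![A, B, N] ^ 2 = (A ⬝ᵥ A) ^ 2 := by
    have gram : Matrix.det ![A, B, N] ^ 2 = (A ⬝ᵥ A) * ((B ⬝ᵥ B) * (N ⬝ᵥ N) - (B ⬝ᵥ N) ^ 2) -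
        (A ⬝ᵥ B) * ((A ⬝ᵥ B) * (N ⬝ᵥ N) - (B ⬝ᵥ N) * (A ⬝ᵥ N)) +
        (A ⬝ᵥ N) * ((A ⬝ᵥ B) * (B ⬝ᵥ N) - (B ⬝ᵥ B) * (A ⬝ᵥ N)) := by
      rw [hdet]; simp only [dot3, cross_apply, Matrix.cons_val]; ring
    rw [gram, hN, hAN, hBN, hAB, ← hl]; ring
  have heq : Matrix.det ![A, B, N] = A ⬝ᵥ A := by
    rwa [sq_eq_sq₀ hd.le hpos.le] at hsq
  refine eq_zero_of_dot_eq_zero hN hAN hA ?_ ?_ ?_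
  · rw [sub_dotProduct, hBN, dotProduct_comm, dot_self_cross]; simp
  · rw [sub_dotProduct, dotProduct_comm, hAB, dotProduct_comm, dot_cross_self]; simp
  · rw [sub_dotProduct, ← hdet, heq, cross_dot_self_eq hN hAN, sub_self]

omit [IsManifold 𝓘(ℂ, ℂ) ω M] in
lemma ImmersedSurface.tangentVec_frame (σ : ImmersedSurface E M) (p : M) :
    tangentVec E σ.map p 1 ≠ 0 ∧
    tangentVec E σ.map p 1 ⬝ᵥ σ.gaussVec p = 0 ∧
    tangentVec E σ.map p Complex.I = σ.gaussVec p ⨯₃ tangentVec E σ.map p 1 := by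
  obtain ⟨l, -, hl⟩ := σ.conformal p
  have hdot : ∀ v w, tangentVec E σ.map p v ⬝ᵥ tangentVec E σ.map p w = l * inner ℝ v w :=
    fun v w => by rw [← hl]; exact (OrthonormalFrame.inner_eq_dot _ _ _).symm
  have hn : ∀ v, tangentVec E σ.map p v ⬝ᵥ σ.gaussVec p = 0 := fun v => by
    rw [← σ.normal p v, OrthonormalFrame.leftTranslate, map_sum]
    simp only [map_smul, smul_eq_mul, dotProduct]
    exact Finset.sum_congr rfl fun i _ => mul_comm _ _
  obtain ⟨h1, h2⟩ := eq_cross_of_orthogonal (dot_self_of_mem_sphere (σ.gauss p)) (hn 1)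
    (hn Complex.I) (by rw [hdot]; simp) (by rw [hdot, hdot]; simp) (σ.orientation p)
  exact ⟨h1, hn 1, h2⟩

lemma tangentVec_comp_chart_symm {ψ : M → X} (hψ : MDifferentiable 𝓘(ℝ, ℂ) (𝓡 3) ψ) {p : M} {z : ℂ}
    (hz : z ∈ (chartAt ℂ p).target) (v : ℂ) :
    tangentVec E (ψ ∘ (chartAt ℂ p).symm) z v =
      tangentVec E ψ ((chartAt ℂ p).symm z) (chartFactor p z * v) := by
  have h1 := (hψ ((chartAt ℂ p).symm z)).hasMFDerivAt
  have h := (h1.comp z (hasMFDerivAt_chart_symm hz)).mfderiv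
  funext i
  simp only [tangentVec, tangentComponent, dMap]
  rw [h]
  rfl

/-- A real valued function on the sphere, extended by zero. -/
def extendSphere (h : S2 → ℝ) (m : V3) : ℝ :=
  open Classical in
  if hm : WithLp.toLp 2 m ∈ Metric.sphere (0 : E3) 1 then h ⟨WithLp.toLp 2 m, hm⟩ else 0

lemma extendSphere_apply (h : S2 → ℝ) (n : S2) : extendSphere h (fun i => (n : E3) i) = h n := by
  have : WithLp.toLp 2 (fun i => (n : E3) i) = (n : E3) := rfl
  rw [extendSphere, dif_pos (this ▸ n.2)]

/-- The components `⟨∇_a m, c⟩` of the connection. -/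
def OrthonormalFrame.connection (E : OrthonormalFrame g) (a m c : V3) : ℝ :=
  ∑ i, ∑ k, (∑ j, m j * E.christoffel i j k) * (a i * c k)

/-- The prescribed trace of the differential of the Gauss map. -/
def OrthonormalFrame.meanForm (E : OrthonormalFrame g) (h : S2 → ℝ) (m a b : V3) : ℝ :=
  -(extendSphere h m * (a ⬝ᵥ a + b ⬝ᵥ b) + (E.connection a m a + E.connection b m b))

/-- For a fixed normal this is the sum of the values of one quadratic form on `a` and `b`, and a
rotation with scaling multiplies such a trace by the squared scale. -/
lemma OrthonormalFrame.isRotScale_meanForm (E : OrthonormalFrame g) (h : S2 → ℝ) (m : V3) :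
    IsRotScale (E.meanForm h m) := by
  intro a b x y
  simp only [meanForm, connection, dot3, Fin.sum_univ_three, Pi.add_apply, Pi.smul_apply,
    smul_eq_mul]
  ring

/-- Carries the mean curvature equation from the preferred chart at a point to another chart: all
terms are traces and scale alike under `x + iy`. -/
lemma trace_rotScale (G : Fin 3 → Fin 3 → ℝ) (H : ℝ) (d₁ d₂ t₁ t₂ : V3) (x y : ℝ)
    (h0 : d₁ ⬝ᵥ t₁ + d₂ ⬝ᵥ t₂ + (H * (t₁ ⬝ᵥ t₁ + t₂ ⬝ᵥ t₂) +
      ((∑ i, ∑ k, G i k * (t₁ i * t₁ k)) + ∑ i, ∑ k, G i k * (t₂ i * t₂ k))) = 0) :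
    (x • d₁ + y • d₂) ⬝ᵥ (x • t₁ + y • t₂) + (-y • d₁ + x • d₂) ⬝ᵥ (-y • t₁ + x • t₂) =
      -(H * ((x • t₁ + y • t₂) ⬝ᵥ (x • t₁ + y • t₂) +
        (-y • t₁ + x • t₂) ⬝ᵥ (-y • t₁ + x • t₂)) +
      ((∑ i, ∑ k, G i k * ((x • t₁ + y • t₂) i * (x • t₁ + y • t₂) k)) +
        ∑ i, ∑ k, G i k * ((-y • t₁ + x • t₂) i * (-y • t₁ + x • t₂) k))) := by
  simp only [dot3, Fin.sum_univ_three, Pi.add_apply, Pi.smul_apply, smul_eq_mul] at *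
  linear_combination (x ^ 2 + y ^ 2) * h0

namespace ImmersedSurface

/-- The frame components of `∂ψ/∂x` in the preferred chart at `p`. -/
def localFst (σ : ImmersedSurface E M) (p : M) (z : ℂ) : V3 :=
  tangentVec E (σ.map ∘ (chartAt ℂ p).symm) z 1

/-- The frame components of `∂ψ/∂y` in the preferred chart at `p`. -/
def localSnd (σ : ImmersedSurface E M) (p : M) (z : ℂ) : V3 :=
  tangentVec E (σ.map ∘ (chartAt ℂ p).symm) z Complex.I

/-- The Gauss map in the preferred chart at `p`. -/
def localNormal (σ : ImmersedSurface E M) (p : M) (z : ℂ) : V3 :=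
  σ.gaussVec ((chartAt ℂ p).symm z)

variable (σ : ImmersedSurface E M) {p : M} {z : ℂ}

lemma localFst_eq (hz : z ∈ (chartAt ℂ p).target) : σ.localFst p z =
    (chartFactor p z).re • tangentVec E σ.map ((chartAt ℂ p).symm z) 1 +
      (chartFactor p z).im • tangentVec E σ.map ((chartAt ℂ p).symm z) Complex.I := by
  rw [localFst, tangentVec_comp_chart_symm (σ.contMDiff.mdifferentiable (by norm_num)) hz, ← tangentVec_re_im, mul_one,
    Complex.re_add_im]

lemma localSnd_eq (hz : z ∈ (chartAt ℂ p).target) : σ.localSnd p z =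
    -(chartFactor p z).im • tangentVec E σ.map ((chartAt ℂ p).symm z) 1 +
      (chartFactor p z).re • tangentVec E σ.map ((chartAt ℂ p).symm z) Complex.I := by
  rw [localSnd, tangentVec_comp_chart_symm (σ.contMDiff.mdifferentiable (by norm_num)) hz, ← tangentVec_re_im]
  congr 1
  conv_lhs => rw [← Complex.re_add_im (chartFactor p z)]
  push_cast
  linear_combination (chartFactor p z).im * Complex.I_sq

lemma localSnd_eq_cross (hz : z ∈ (chartAt ℂ p).target) :
    σ.localFst p z ≠ 0 ∧ σ.localFst p z ⬝ᵥ σ.localNormal p z = 0 ∧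
      σ.localSnd p z = σ.localNormal p z ⨯₃ σ.localFst p z := by
  obtain ⟨h1, h2, h3⟩ := σ.tangentVec_frame ((chartAt ℂ p).symm z)
  have hn := dot_self_of_mem_sphere (σ.gauss ((chartAt ℂ p).symm z))
  change σ.gaussVec _ ⬝ᵥ σ.gaussVec _ = 1 at hn
  have h4 := cross_cross_eq_neg hn h2
  rw [σ.localFst_eq hz, σ.localSnd_eq hz, h3, localNormal]
  generalize tangentVec E σ.map ((chartAt ℂ p).symm z) 1 = A at *
  generalize σ.gaussVec ((chartAt ℂ p).symm z) = N at *
  have hc := chartFactor_ne_zero hz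
  generalize chartFactor p z = c at *
  refine ⟨fun h0 => ?_, ?_, ?_⟩
  · have hAA := dot_self_pos h1
    have e1 : A ⬝ᵥ (c.re • A + c.im • (N ⨯₃ A)) = c.re * (A ⬝ᵥ A) := by
      rw [dotProduct_add, dotProduct_smul, dotProduct_smul, dot_cross_self]; simp
    have e2 : (N ⨯₃ A) ⬝ᵥ (c.re • A + c.im • (N ⨯₃ A)) = c.im * (A ⬝ᵥ A) := by
      rw [dotProduct_add, dotProduct_smul, dotProduct_smul, dotProduct_comm, dot_cross_self,
        cross_dot_self_eq hn h2]; simp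
    rw [h0, dotProduct_zero] at e1 e2
    apply hc
    apply Complex.ext
    · simpa [hAA.ne'] using e1.symm
    · simpa [hAA.ne'] using e2.symm
  · rw [add_dotProduct, smul_dotProduct, smul_dotProduct, h2, dotProduct_comm, dot_self_cross]
    simp
  · rw [map_add, map_smul, map_smul, h4]
    module

/-- No regularity of the Gauss map is part of the definition of a surface; this formula derives it
from that of the tangent vectors. -/
lemma localNormal_eq (hz : z ∈ (chartAt ℂ p).target) : σ.localNormal p z =
    (σ.localFst p z ⬝ᵥ σ.localFst p z)⁻¹ • (σ.localFst p z ⨯₃ σ.localSnd p z) := by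
  obtain ⟨h1, h2, h3⟩ := σ.localSnd_eq_cross hz
  rw [h3, eq_inv_smul_iff₀ (dot_self_pos h1).ne']
  generalize σ.localFst p z = A at *
  generalize σ.localNormal p z = N at *
  simp only [dot3] at *
  funext i
  fin_cases i <;> simp [cross_apply]
  · linear_combination A 0 * h2
  · linear_combination A 1 * h2
  · linear_combination A 2 * h2

end ImmersedSurface

end MetricLie

/-! ### Regularity and the structure equations in a chart -/

namespace MetricLie

open Set Filter Wirtinger Matrix

variable {X : Type*} [TopologicalSpace X] [ChartedSpace E3 X] [Group X] [LieGroup (𝓡 3) ∞ X]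
  {g : LeftInvariantMetric X} {E : OrthonormalFrame g}
  {M : Type*} [TopologicalSpace M] [ChartedSpace ℂ M] [IsManifold 𝓘(ℂ, ℂ) ω M]

namespace ImmersedSurface

variable (σ : ImmersedSurface E M)

lemma contMDiffOn_comp_chart_symm (p : M) :
    ContMDiffOn 𝓘(ℝ, ℂ) (𝓡 3) 3 (σ.map ∘ (chartAt ℂ p).symm) (chartAt ℂ p).target := by
  have : IsManifold 𝓘(ℝ, ℂ) ω M := isManifold_real_of_complex M
  have : IsManifold 𝓘(ℝ, ℂ) 3 M := .of_le (n := ω) (by simp)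
  exact σ.contMDiff.comp_contMDiffOn (contMDiffOn_chart_symm (I := 𝓘(ℝ, ℂ)) (n := 3) (x := p))

lemma contDiffOn_localFst (p : M) : ContDiffOn ℝ 2 (σ.localFst p) (chartAt ℂ p).target :=
  E.contDiffOn_tangentComponent (chartAt ℂ p).open_target (σ.contMDiffOn_comp_chart_symm p) 1

lemma contDiffOn_localSnd (p : M) : ContDiffOn ℝ 2 (σ.localSnd p) (chartAt ℂ p).target :=
  E.contDiffOn_tangentComponent (chartAt ℂ p).open_target (σ.contMDiffOn_comp_chart_symm p) _

lemma contDiffOn_localNormal (p : M) : ContDiffOn ℝ 2 (σ.localNormal p) (chartAt ℂ p).target := by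
  have ha := contDiffOn_pi.1 (σ.contDiffOn_localFst p)
  have hb := contDiffOn_pi.1 (σ.contDiffOn_localSnd p)
  have hdot := contDiffOn_dot (σ.contDiffOn_localFst p) (σ.contDiffOn_localFst p)
  have hc : ContDiffOn ℝ 2 (fun z => σ.localFst p z ⨯₃ σ.localSnd p z) (chartAt ℂ p).target := by
    refine contDiffOn_pi.2 fun k => ?_
    fin_cases k <;> simp only [cross_apply, Matrix.cons_val, Fin.zero_eta, Fin.mk_one,
      Fin.reduceFinMk]
    · exact ((ha 1).mul (hb 2)).sub ((ha 2).mul (hb 1))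
    · exact ((ha 2).mul (hb 0)).sub ((ha 0).mul (hb 2))
    · exact ((ha 0).mul (hb 1)).sub ((ha 1).mul (hb 0))
  refine ((hdot.inv fun z hz => ?_).smul hc).congr fun z hz => σ.localNormal_eq hz
  exact (dot_self_pos (σ.localSnd_eq_cross hz).1).ne'

lemma contMDiff_gaussVec : ContMDiff 𝓘(ℝ, ℂ) 𝓘(ℝ, V3) 2 σ.gaussVec := by
  have : IsManifold 𝓘(ℝ, ℂ) ω M := isManifold_real_of_complex M
  have : IsManifold 𝓘(ℝ, ℂ) 2 M := .of_le (n := ω) (by simp)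
  intro p
  have h1 : ContMDiffAt 𝓘(ℝ, ℂ) 𝓘(ℝ, V3) 2 (σ.localNormal p) (chartAt ℂ p p) :=
    ((σ.contDiffOn_localNormal p).contDiffAt ((chartAt ℂ p).open_target.mem_nhds
      (mem_chart_target ℂ p))).contMDiffAt
  have h2 : ContMDiffAt 𝓘(ℝ, ℂ) 𝓘(ℝ, ℂ) 2 (chartAt ℂ p) p :=
    contMDiffAt_of_mem_maximalAtlas (IsManifold.chart_mem_maximalAtlas p) (mem_chart_source ℂ p)
  refine (h1.comp p h2).congr_of_eventuallyEq ?_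
  filter_upwards [(chartAt ℂ p).open_source.mem_nhds (mem_chart_source ℂ p)] with q hq
  simp only [Function.comp_apply, localNormal, (chartAt ℂ p).left_inv hq]

lemma fderiv_localNormal {p : M} {z : ℂ} (hz : z ∈ (chartAt ℂ p).target) (v : ℂ) (k : Fin 3) :
    fderiv ℝ (σ.localNormal p) z v k =
      dCoord σ.gauss ((chartAt ℂ p).symm z) k (chartFactor p z * v) := by
  have hn : DifferentiableAt ℝ (σ.localNormal p) z :=
    ((σ.contDiffOn_localNormal p).differentiableOn two_ne_zero).differentiableAt
      ((chartAt ℂ p).open_target.mem_nhds hz)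
  have h1 : MDifferentiableAt 𝓘(ℝ, ℂ) 𝓘(ℝ, ℝ) (fun q => (σ.gauss q : E3) k)
      ((chartAt ℂ p).symm z) :=
    (contMDiff_pi_space.1 σ.contMDiff_gaussVec k).mdifferentiable (by norm_num) _
  have h := (h1.hasMFDerivAt.comp z (hasMFDerivAt_chart_symm hz)).mfderiv
  have h2 := (hasFDerivAt_coord hn k).fderiv
  have h3 : fderiv ℝ (σ.localNormal p) z v k = fderiv ℝ (fun z => σ.localNormal p z k) z v := by
    rw [h2]; rfl
  rw [h3, ← mfderiv_eq_fderiv]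
  exact congrArg (fun L : ℂ →L[ℝ] ℝ => L v) h

/-- The differential of the vector valued Gauss map. -/
def gaussDeriv (q : M) (v : ℂ) : V3 := fun k => dCoord σ.gauss q k v

omit [IsManifold 𝓘(ℂ, ℂ) ω M] in
lemma gaussDeriv_re_im (q : M) (x y : ℝ) : σ.gaussDeriv q (x + y * Complex.I) =
    x • σ.gaussDeriv q 1 + y • σ.gaussDeriv q Complex.I := by
  funext k
  have h : ((x : ℂ) + y * Complex.I) = x • (1 : ℂ) + y • Complex.I := by simp
  simp only [gaussDeriv, h, map_add, map_smul, Pi.add_apply, Pi.smul_apply]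

lemma fderiv_localNormal_one {p : M} {z : ℂ} (hz : z ∈ (chartAt ℂ p).target) :
    fderiv ℝ (σ.localNormal p) z 1 =
      (chartFactor p z).re • σ.gaussDeriv ((chartAt ℂ p).symm z) 1 +
        (chartFactor p z).im • σ.gaussDeriv ((chartAt ℂ p).symm z) Complex.I := by
  rw [← gaussDeriv_re_im, Complex.re_add_im]
  funext k
  rw [σ.fderiv_localNormal hz, mul_one]
  rfl

lemma fderiv_localNormal_I {p : M} {z : ℂ} (hz : z ∈ (chartAt ℂ p).target) :
    fderiv ℝ (σ.localNormal p) z Complex.I =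
      -(chartFactor p z).im • σ.gaussDeriv ((chartAt ℂ p).symm z) 1 +
        (chartFactor p z).re • σ.gaussDeriv ((chartAt ℂ p).symm z) Complex.I := by
  rw [← gaussDeriv_re_im]
  funext k
  rw [σ.fderiv_localNormal hz, gaussDeriv]
  congr 1
  conv_lhs => rw [← Complex.re_add_im (chartFactor p z)]
  push_cast
  linear_combination (chartFactor p z).im * Complex.I_sq

lemma local_mean {h : S2 → ℝ} (hσ : σ.HasPrescribedMeanCurvature h) {p : M} {z : ℂ}
    (hz : z ∈ (chartAt ℂ p).target) :
    fderiv ℝ (σ.localNormal p) z 1 ⬝ᵥ σ.localFst p z +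
      fderiv ℝ (σ.localNormal p) z Complex.I ⬝ᵥ σ.localSnd p z =
      E.meanForm h (σ.localNormal p z) (σ.localFst p z) (σ.localSnd p z) := by
  set q := (chartAt ℂ p).symm z with hq
  rw [σ.fderiv_localNormal_one hz, σ.fderiv_localNormal_I hz, σ.localFst_eq hz, σ.localSnd_eq hz, OrthonormalFrame.meanForm,
    OrthonormalFrame.connection, OrthonormalFrame.connection]
  -- It remains to check the equation in the basis `1`, `i` at `q`, where it is the definition of
  -- the mean curvature.
  apply trace_rotScale
  obtain ⟨ha0, haN, hb⟩ := σ.tangentVec_frame q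
  have hpos := dot_self_pos ha0
  have hN : σ.gaussVec q ⬝ᵥ σ.gaussVec q = 1 := dot_self_of_mem_sphere (σ.gauss q)
  have hbb : tangentVec E σ.map q Complex.I ⬝ᵥ tangentVec E σ.map q Complex.I =
      tangentVec E σ.map q 1 ⬝ᵥ tangentVec E σ.map q 1 := by
    rw [hb, cross_dot_self_eq hN haN]
  have hm := hσ q
  have hinner : g.metric.inner (σ.map q) (dMap σ.map q 1) (dMap σ.map q 1) =
    tangentVec E σ.map q 1 ⬝ᵥ tangentVec E σ.map q 1 := OrthonormalFrame.inner_eq_dot _ _ _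
  rw [meanCurvature, hinner, div_eq_iff (by positivity)] at hm
  rw [hbb, show extendSphere h (σ.localNormal p z) = h (σ.gauss q) from extendSphere_apply h _]
  have hII : ∀ v, σ.secondFundamentalForm q v v = -(σ.gaussDeriv q v ⬝ᵥ tangentVec E σ.map q v +
      ∑ i, ∑ k, (∑ j, σ.localNormal p z j * E.christoffel i j k) *
        (tangentVec E σ.map q v i * tangentVec E σ.map q v k)) := by
    intro v
    have e1 : ∀ i, tangentComponent E σ.map q i v = tangentVec E σ.map q v i := fun _ => rfl
    have e2 : ∀ i, (σ.gauss q : E3) i = σ.localNormal p z i := fun _ => rfl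
    have e3 : ∀ i, dCoord σ.gauss q i v = σ.gaussDeriv q v i := fun _ => rfl
    simp only [secondFundamentalForm, covDerivNormal, e1, e2, e3, dot3, Fin.sum_univ_three]
    ring
  rw [hII, hII] at hm
  linear_combination -hm

/-- The Jacobian in the chart is `|chartFactor|²` times the determinant from the orientation
hypothesis. -/
lemma local_jac_pos (hG : IsOrientedDiffeoOntoImage σ.gauss) {p : M} {z : ℂ}
    (hz : z ∈ (chartAt ℂ p).target) : 0 < jac (σ.localNormal p) z := by
  have hd := hG.orientation ((chartAt ℂ p).symm z)
  have h0 : 0 < Matrix.det ![σ.gaussDeriv ((chartAt ℂ p).symm z) 1,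
    σ.gaussDeriv ((chartAt ℂ p).symm z) Complex.I, σ.localNormal p z] := hd
  rw [← triple_product_eq_det, triple_product_permutation, triple_product_permutation] at h0
  have hc : 0 < (chartFactor p z).re ^ 2 + (chartFactor p z).im ^ 2 := by
    have := Complex.normSq_pos.2 (chartFactor_ne_zero hz)
    rw [Complex.normSq_apply] at this
    linarith
  have h1 := mul_pos hc h0
  rw [jac, σ.fderiv_localNormal_one hz, σ.fderiv_localNormal_I hz]
  refine h1.trans_eq ?_
  simp only [dot3, cross_apply, Matrix.cons_val, Pi.add_apply, Pi.smul_apply, smul_eq_mul]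
  ring

/-- The local data of an immersed surface with prescribed mean curvature. -/
theorem surfaceData {h : S2 → ℝ} (hσ : σ.HasPrescribedMeanCurvature h) (p : M) :
    SurfaceData E.torsion (E.meanForm h) (chartAt ℂ p).target
      (σ.localFst p) (σ.localSnd p) (σ.localNormal p) where
  contDiff_fst := σ.contDiffOn_localFst p
  contDiff_snd := σ.contDiffOn_localSnd p
  contDiff_normal := σ.contDiffOn_localNormal p
  unit _ _ := dot_self_of_mem_sphere _
  orth _ hz := (σ.localSnd_eq_cross hz).2.1
  rot _ hz := (σ.localSnd_eq_cross hz).2.2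
  ne _ hz := (σ.localSnd_eq_cross hz).1
  maurerCartan _ hz := E.maurerCartan (chartAt ℂ p).open_target (σ.contMDiffOn_comp_chart_symm p) hz
  mean _ hz := σ.local_mean hσ hz

end ImmersedSurface

end MetricLie

/-! ### Regularity of the transition map between Gauss images -/

namespace Wirtinger

open Set Filter Matrix

lemma injective_of_jac_pos {n : ℂ → V3} {w : ℂ} (hj : 0 < jac n w) :
    Function.Injective (fderiv ℝ n w) := by
  rw [injective_iff_map_eq_zero]
  intro v hv
  by_contra hv0
  have h : v = v.re • (1 : ℂ) + v.im • Complex.I := by simp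
  rw [h, map_add, map_smul, map_smul] at hv
  apply hj.ne'
  have e : ∀ i, v.re * fderiv ℝ n w 1 i + v.im * fderiv ℝ n w Complex.I i = 0 := fun i =>
    congrFun hv i
  have h1 : v.re • (fderiv ℝ n w 1 ⨯₃ fderiv ℝ n w Complex.I) = 0 := by
    have := congrArg (fun u => u ⨯₃ fderiv ℝ n w Complex.I) hv
    simpa using this
  have h2 : v.im • (fderiv ℝ n w 1 ⨯₃ fderiv ℝ n w Complex.I) = 0 := by
    have := congrArg (fun u => fderiv ℝ n w 1 ⨯₃ u) hv
    simpa using this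
  have h3 : fderiv ℝ n w 1 ⨯₃ fderiv ℝ n w Complex.I = 0 := by
    by_contra h4
    rw [smul_eq_zero_iff_left h4] at h1 h2
    exact hv0 (Complex.ext h1 h2)
  rw [jac, h3, zero_dotProduct]

/-- Composing `n'` with a left inverse `π` of its derivative gives a local diffeomorphism of the
plane, and continuity of `φ` selects the branch `φ = (π ∘ n')⁻¹ ∘ π ∘ n`. The order `2` matters,
since `∂φ/∂z̄` has to be `C¹`. -/
lemma contDiffAt_of_comp_eq {n n' : ℂ → V3} {φ : ℂ → ℂ} {z₀ : ℂ}
    (hn' : ContDiffAt ℝ 2 n' (φ z₀)) (hinj : Function.Injective (fderiv ℝ n' (φ z₀)))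
    (hn : ContDiffAt ℝ 2 n z₀) (hφ : ContinuousAt φ z₀) (h : ∀ᶠ z in 𝓝 z₀, n z = n' (φ z)) :
    ContDiffAt ℝ 2 φ z₀ := by
  obtain ⟨π₀, hπ₀⟩ := LinearMap.exists_leftInverse_of_injective
    (fderiv ℝ n' (φ z₀)).toLinearMap (LinearMap.ker_eq_bot.2 hinj)
  set π := LinearMap.toContinuousLinearMap π₀ with hπ
  have hF : ContDiffAt ℝ 2 (fun w => π (n' w)) (φ z₀) := π.contDiff.contDiffAt.comp _ hn'
  have hd : HasFDerivAt (fun w => π (n' w))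
      ((ContinuousLinearEquiv.refl ℝ ℂ : ℂ ≃L[ℝ] ℂ) : ℂ →L[ℝ] ℂ) (φ z₀) := by
    have h1 := π.hasFDerivAt.comp (φ z₀) (hn'.differentiableAt two_ne_zero).hasFDerivAt
    refine h1.congr_fderiv (ContinuousLinearMap.ext fun v => ?_)
    exact congrArg (fun L : ℂ →ₗ[ℝ] ℂ => L v) hπ₀
  have hinv := hF.to_localInverse hd two_ne_zero
  have hstrict := hF.hasStrictFDerivAt' hd two_ne_zero
  have hl := hstrict.eventually_left_inverse
  have key : φ =ᶠ[𝓝 z₀] fun z => hF.localInverse hd two_ne_zero (π (n z)) := by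
    filter_upwards [h, hφ.eventually hl] with z h1 h2
    rw [h1]
    exact h2.symm
  refine ContDiffAt.congr_of_eventuallyEq ?_ key
  have h0 : π (n z₀) = π (n' (φ z₀)) := by rw [h.self_of_nhds]
  refine ContDiffAt.comp z₀ ?_ (π.contDiff.contDiffAt.comp _ hn)
  rw [h0]
  exact hinv

lemma SurfaceData.mono {Λ : V3 → V3 → V3} {Θ : V3 → V3 → V3 → ℝ} {U O : Set ℂ} {a b n : ℂ → V3}
    (D : SurfaceData Λ Θ U a b n) (h : O ⊆ U) : SurfaceData Λ Θ O a b n where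
  contDiff_fst := D.contDiff_fst.mono h
  contDiff_snd := D.contDiff_snd.mono h
  contDiff_normal := D.contDiff_normal.mono h
  unit z hz := D.unit z (h hz)
  orth z hz := D.orth z (h hz)
  rot z hz := D.rot z (h hz)
  ne z hz := D.ne z (h hz)
  maurerCartan z hz := D.maurerCartan z (h hz)
  mean z hz := D.mean z (h hz)

end Wirtinger

/-! ### The coefficients on the sphere and the local form of the differential -/

namespace MetricLie

open Set Filter Wirtinger Matrix

variable {X : Type*} [TopologicalSpace X] [ChartedSpace E3 X] [Group X] [LieGroup (𝓡 3) ∞ X]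
  {g : LeftInvariantMetric X} {E : OrthonormalFrame g}
  {S : Type*} [TopologicalSpace S] [ChartedSpace ℂ S] [IsManifold 𝓘(ℂ, ℂ) ω S]
  {M : Type*} [TopologicalSpace M] [ChartedSpace ℂ M] [IsManifold 𝓘(ℂ, ℂ) ω M]

omit [IsManifold 𝓘(ℂ, ℂ) ω S] in
lemma IsOrientedDiffeoOntoImage.isOpenEmbedding {G : S → S2} (hG : IsOrientedDiffeoOntoImage G) :
    Topology.IsOpenEmbedding G :=
  .of_continuous_injective_isOpenMap hG.localDiffeo.contMDiff.continuous hG.injective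
    hG.localDiffeo.isOpenMap

/-- The coordinate expression of a map in the preferred charts at `p` and at the image of `p`. -/
def chartExpr (f : M → S) (p : M) (z : ℂ) : ℂ := chartAt ℂ (f p) (f ((chartAt ℂ p).symm z))

/-- The domain on which `chartExpr` is meaningful. -/
def chartDomain (f : M → S) (p : M) : Set ℂ :=
  (chartAt ℂ p).target ∩ (chartAt ℂ p).symm ⁻¹' (f ⁻¹' (chartAt ℂ (f p)).source)

omit [IsManifold 𝓘(ℂ, ℂ) ω S] [IsManifold 𝓘(ℂ, ℂ) ω M] in
lemma isOpen_chartDomain {f : M → S} (hf : Continuous f) (p : M) : IsOpen (chartDomain f p) :=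
  (chartAt ℂ p).isOpen_inter_preimage_symm ((chartAt ℂ (f p)).open_source.preimage hf)

omit [IsManifold 𝓘(ℂ, ℂ) ω S] [IsManifold 𝓘(ℂ, ℂ) ω M] in
lemma mem_chartDomain (f : M → S) (p : M) : chartAt ℂ p p ∈ chartDomain f p :=
  ⟨mem_chart_target ℂ p, by simp⟩

theorem matched {h : S2 → ℝ} {σ : ImmersedSurface E S} (hσ : σ.HasPrescribedMeanCurvature h)
    (hG : IsOrientedDiffeoOntoImage σ.gauss) {τ : ImmersedSurface E M}
    (hτ : τ.HasPrescribedMeanCurvature h) {f : M → S} (hf : Continuous f)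
    (hfG : ∀ p, τ.gauss p = σ.gauss (f p)) (p : M) :
    Matched E.torsion (E.meanForm h) (chartDomain f p) (chartAt ℂ (f p)).target
      (τ.localFst p) (τ.localSnd p) (τ.localNormal p)
      (σ.localFst (f p)) (σ.localSnd (f p)) (σ.localNormal (f p)) (chartExpr f p) := by
  have hnormal : ∀ z ∈ chartDomain f p,
      τ.localNormal p z = σ.localNormal (f p) (chartExpr f p z) := by
    intro z hz
    funext k
    have := (chartAt ℂ (f p)).left_inv hz.2
    simp only [ImmersedSurface.localNormal, ImmersedSurface.gaussVec, chartExpr, hfG, this]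
  have hmaps : MapsTo (chartExpr f p) (chartDomain f p) (chartAt ℂ (f p)).target :=
    fun z hz => (chartAt ℂ (f p)).map_source hz.2
  exact
  { torsion := E.isRotScale_torsion
    trace := E.isRotScale_meanForm h
    isOpen_fst := isOpen_chartDomain hf p
    isOpen_snd := (chartAt ℂ (f p)).open_target
    fst := (τ.surfaceData hτ p).mono inter_subset_left
    snd := σ.surfaceData hσ (f p)
    contDiff := fun z hz => by
      have hc : ContinuousAt (chartExpr f p) z :=
        ContinuousAt.comp (g := chartAt ℂ (f p)) (f := f ∘ (chartAt ℂ p).symm) (x := z)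
          ((chartAt ℂ (f p)).continuousAt hz.2)
          (ContinuousAt.comp (g := f) (f := (chartAt ℂ p).symm) (x := z) hf.continuousAt
            ((chartAt ℂ p).continuousAt_symm hz.1))
      refine (contDiffAt_of_comp_eq (n := τ.localNormal p) (n' := σ.localNormal (f p))
        ((σ.contDiffOn_localNormal (f p)).contDiffAt
          ((chartAt ℂ (f p)).open_target.mem_nhds (hmaps hz)))
        (injective_of_jac_pos (σ.local_jac_pos hG (hmaps hz)))
        ((τ.contDiffOn_localNormal p).contDiffAt ((chartAt ℂ p).open_target.mem_nhds hz.1))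
        hc ?_).contDiffWithinAt
      exact Filter.mem_of_superset ((isOpen_chartDomain hf p).mem_nhds hz) hnormal
    mapsTo := hmaps
    normal := hnormal
    jac_pos := fun w hw => σ.local_jac_pos hG hw }

namespace ImmersedSurface

variable (σ : ImmersedSurface E M)

/-- The coefficients `b_{jk}` at a point of the surface. -/
def coefAt (q : M) : Fin 3 → Fin 3 → ℂ :=
  quadCoeff (fun k => ((tangentVec E σ.map q 1 k : ℂ) -
    Complex.I * (tangentVec E σ.map q Complex.I k : ℂ)) / 2)
    (fun k => delCoord σ.gauss q k 1) (fun k => (σ.gaussVec q k : ℂ))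

lemma dnormal_localNormal {p : M} {z : ℂ} (hz : z ∈ (chartAt ℂ p).target) (k : Fin 3) :
    dnormal (σ.localNormal p) k z =
      delCoord σ.gauss ((chartAt ℂ p).symm z) k (chartFactor p z) := by
  have hn : DifferentiableAt ℝ (σ.localNormal p) z :=
    ((σ.contDiffOn_localNormal p).differentiableOn two_ne_zero).differentiableAt
      ((chartAt ℂ p).open_target.mem_nhds hz)
  rw [dnormal_eq hn, σ.fderiv_localNormal hz, σ.fderiv_localNormal hz, mul_one, mul_comm _ Complex.I]
  rfl

/-- Passing to the chart multiplies tangent vector and normal derivative by the same `chartFactor`,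
to which `quadCoeff` is insensitive. -/
lemma quadCoeffAt_local {p : M} {z : ℂ} (hz : z ∈ (chartAt ℂ p).target) :
    quadCoeffAt (σ.localFst p) (σ.localSnd p) (σ.localNormal p) z =
      σ.coefAt ((chartAt ℂ p).symm z) := by
  have h1 : (fun k => dnormal (σ.localNormal p) k z) = chartFactor p z •
      fun k => delCoord σ.gauss ((chartAt ℂ p).symm z) k 1 := by
    funext k
    rw [σ.dnormal_localNormal hz, Pi.smul_apply, smul_eq_mul, ← delCoord_mul, mul_one]
  have h2 : (fun k => cvec (σ.localFst p) (σ.localSnd p) k z) = chartFactor p z •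
      fun k => ((tangentVec E σ.map ((chartAt ℂ p).symm z) 1 k : ℂ) -
        Complex.I * (tangentVec E σ.map ((chartAt ℂ p).symm z) Complex.I k : ℂ)) / 2 := by
    funext k
    rw [cvec, σ.localFst_eq hz, σ.localSnd_eq hz]
    simp only [Pi.add_apply, Pi.smul_apply, smul_eq_mul]
    conv_rhs => rw [← Complex.re_add_im (chartFactor p z)]
    push_cast
    linear_combination ((chartFactor p z).im *
      (tangentVec E σ.map ((chartAt ℂ p).symm z) Complex.I k : ℂ) / 2) * Complex.I_sq
  rw [quadCoeffAt, h1, h2, quadCoeff_smul (chartFactor_ne_zero hz)]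
  rfl

/-- The coefficients `b_{jk}` on the sphere. -/
def sphereCoef : S2 → Fin 3 → Fin 3 → ℂ := Function.extend σ.gauss σ.coefAt 0

omit [IsManifold 𝓘(ℂ, ℂ) ω M] in
lemma sphereCoef_gauss (hG : IsOrientedDiffeoOntoImage σ.gauss) (q : M) :
    σ.sphereCoef (σ.gauss q) = σ.coefAt q :=
  hG.injective.extend_apply _ _ q

/-- Near a point of the image the coefficients are `C¹` functions of the chart of the surface
composed with a local inverse of the Gauss map. -/
theorem contMDiffOn_sphereCoef {h : S2 → ℝ} (hσ : σ.HasPrescribedMeanCurvature h)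
    (hG : IsOrientedDiffeoOntoImage σ.gauss) (j k : Fin 3) :
    ContMDiffOn (𝓡 2) 𝓘(ℝ, ℂ) 1 (fun n => σ.sphereCoef n j k) (range σ.gauss) := by
  have : IsManifold 𝓘(ℝ, ℂ) ω M := isManifold_real_of_complex M
  have : IsManifold 𝓘(ℝ, ℂ) 1 M := .of_le (n := ω) (by simp)
  rintro _ ⟨s, rfl⟩
  obtain ⟨Φ, hs, hΦ⟩ := hG.localDiffeo s
  have hsn : Φ.symm (σ.gauss s) = s := by rw [hΦ hs]; exact Φ.left_inv hs
  have ht : σ.gauss s ∈ Φ.target := by rw [hΦ hs]; exact Φ.map_source hs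
  have h1 : ContMDiffAt (𝓡 2) 𝓘(ℝ, ℂ) 1 Φ.symm (σ.gauss s) :=
    Φ.contMDiffOn_invFun.contMDiffAt (Φ.open_target.mem_nhds ht)
  have h2 : ContMDiffAt 𝓘(ℝ, ℂ) 𝓘(ℝ, ℂ) 1 (chartAt ℂ s) (Φ.symm (σ.gauss s)) := by
    rw [hsn]
    exact contMDiffAt_of_mem_maximalAtlas (IsManifold.chart_mem_maximalAtlas s)
      (mem_chart_source ℂ s)
  have h3 : ContMDiffAt 𝓘(ℝ, ℂ) 𝓘(ℝ, ℂ) 1 (fun z => quadCoeffAt (σ.localFst s) (σ.localSnd s)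
      (σ.localNormal s) z j k) (chartAt ℂ s (Φ.symm (σ.gauss s))) := by
    rw [hsn]
    exact ((contDiffOn_quadCoeffAt (σ.surfaceData hσ s) (chartAt ℂ s).open_target j k).contDiffAt
      ((chartAt ℂ s).open_target.mem_nhds (mem_chart_target ℂ s))).contMDiffAt
  refine ContMDiffAt.contMDiffWithinAt ?_
  refine (ContMDiffAt.comp (σ.gauss s) h3 (ContMDiffAt.comp (σ.gauss s) h2 h1))
    |>.congr_of_eventuallyEq ?_
  have hsrc : Φ.symm ⁻¹' (chartAt ℂ s).source ∈ 𝓝 (σ.gauss s) :=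
    h1.continuousAt.preimage_mem_nhds ((chartAt ℂ s).open_source.mem_nhds
      (by rw [hsn]; exact mem_chart_source ℂ s))
  filter_upwards [Φ.open_target.mem_nhds ht, hsrc] with n hn hn2
  have hG2 : σ.gauss (Φ.symm n) = n := by
    rw [hΦ (Φ.symm.map_source hn)]
    exact Φ.right_inv hn
  simp only [Function.comp_apply]
  rw [σ.quadCoeffAt_local ((chartAt ℂ s).map_source hn2), (chartAt ℂ s).left_inv hn2,
    ← σ.sphereCoef_gauss hG, hG2]

lemma coeff_gaussQuadraticDifferential (b : S2 → Fin 3 → Fin 3 → ℂ) {p : M} {z : ℂ}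
    (hz : z ∈ (chartAt ℂ p).target) :
    (gaussQuadraticDifferential b σ.gauss).coeff p z =
      ∑ j, ∑ k, b (σ.gauss ((chartAt ℂ p).symm z)) j k *
        (dnormal (σ.localNormal p) j z * dnormal (σ.localNormal p) k z) := by
  simp only [σ.dnormal_localNormal hz]
  rfl

end ImmersedSurface

/-- Homogeneity: every complex tangent vector is a multiple of the coordinate vector `chartFactor`.
-/
lemma QuadraticDifferential.isZero_iff_coeff (Q : QuadraticDifferential M) {p : M} {z : ℂ}
    (hz : z ∈ (chartAt ℂ p).target) : Q.IsZero ((chartAt ℂ p).symm z) ↔ Q.coeff p z = 0 := by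
  refine ⟨fun h => h _, fun h v => ?_⟩
  have hc := chartFactor_ne_zero hz
  have hv : ∀ v : ℂ, Q.form ((chartAt ℂ p).symm z) v = 0 := by
    intro v
    have h1 := Q.form_smul ((chartAt ℂ p).symm z) (v / chartFactor p z) (chartFactor p z)
    have h2 : ((v / chartFactor p z) • chartFactor p z : ℂ) = v := by
      rw [smul_eq_mul, div_mul_cancel₀ _ hc]
    have h3 : Q.form ((chartAt ℂ p).symm z) (chartFactor p z) = 0 := h
    rw [h3, mul_zero] at h1
    rw [← h2]
    exact h1
  exact hv v

theorem ImmersedSurface.vanishesIdentically (σ : ImmersedSurface E S)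
    (hG : IsOrientedDiffeoOntoImage σ.gauss) :
    (gaussQuadraticDifferential σ.sphereCoef σ.gauss).VanishesIdentically := by
  intro p
  have hz := mem_chart_target ℂ p
  rw [← (chartAt ℂ p).left_inv (mem_chart_source ℂ p), QuadraticDifferential.isZero_iff_coeff _ hz,
    σ.coeff_gaussQuadraticDifferential _ hz, σ.sphereCoef_gauss hG, ← σ.quadCoeffAt_local hz,
    sum_quadCoeffAt_dnormal]

/-! ### Isolated zeros and their index -/

section Pair

variable {h : S2 → ℝ} {σ : ImmersedSurface E S} (hσ : σ.HasPrescribedMeanCurvature h)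
  (hG : IsOrientedDiffeoOntoImage σ.gauss) {τ : ImmersedSurface E M}
  (hτ : τ.HasPrescribedMeanCurvature h) {f : M → S} (hf : Continuous f)
  (hfG : ∀ p, τ.gauss p = σ.gauss (f p))
include hG hfG

lemma coeff_eq_sum_quadCoeffAt {p : M} {z : ℂ} (hz : z ∈ chartDomain f p) :
    (gaussQuadraticDifferential σ.sphereCoef τ.gauss).coeff p z =
      ∑ j, ∑ k, quadCoeffAt (σ.localFst (f p)) (σ.localSnd (f p)) (σ.localNormal (f p))
        (chartExpr f p z) j k *
        (dnormal (τ.localNormal p) j z * dnormal (τ.localNormal p) k z) := by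
  rw [τ.coeff_gaussQuadraticDifferential _ hz.1, hfG, σ.sphereCoef_gauss hG, chartExpr,
    σ.quadCoeffAt_local ((chartAt ℂ (f p)).map_source hz.2),
    (chartAt ℂ (f p)).left_inv hz.2]

include hσ hτ hf

/-- Near each point the quadratic differential vanishes or has the form `(z - z₀)^k g(z)`. -/
theorem coeff_eventually_zero_or_pow_mul (p : M) :
    (∀ᶠ z in 𝓝 (chartAt ℂ p p),
      (gaussQuadraticDifferential σ.sphereCoef τ.gauss).coeff p z = 0) ∨
    ∃ (k : ℕ) (w : ℂ → ℂ), (∀ᶠ z in 𝓝 (chartAt ℂ p p), ContinuousAt w z) ∧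
      w (chartAt ℂ p p) ≠ 0 ∧ ∀ᶠ z in 𝓝 (chartAt ℂ p p),
        (gaussQuadraticDifferential σ.sphereCoef τ.gauss).coeff p z =
          (z - chartAt ℂ p p) ^ k * w z :=
  (matched hσ hG hτ hf hfG p).quad_eventually_zero_or_pow_mul (mem_chartDomain f p)
    (Filter.mem_of_superset ((isOpen_chartDomain hf p).mem_nhds (mem_chartDomain f p))
      fun _ hz => coeff_eq_sum_quadCoeffAt hG hfG hz)

end Pair

/-- A quadratic differential with local expressions `(z - z₀)^k g(z)` or zero on a connected
surface either vanishes identically or has isolated zeros of negative index. -/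
theorem QuadraticDifferential.isolated_of_local [ConnectedSpace M] (Q : QuadraticDifferential M)
    (hQ : ∀ p : M, (∀ᶠ z in 𝓝 (chartAt ℂ p p), Q.coeff p z = 0) ∨
      ∃ (k : ℕ) (w : ℂ → ℂ), (∀ᶠ z in 𝓝 (chartAt ℂ p p), ContinuousAt w z) ∧
        w (chartAt ℂ p p) ≠ 0 ∧
        ∀ᶠ z in 𝓝 (chartAt ℂ p p), Q.coeff p z = (z - chartAt ℂ p p) ^ k * w z)
    (hne : ¬ Q.VanishesIdentically) (p : M) (hp : Q.IsZero p) :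
    Q.IsIsolatedAt p ∧ ∃ j : ℚ, j < 0 ∧ Q.HasIndex p j := by
  have transfer : ∀ (p : M) {P : ℂ → Prop}, (∀ᶠ z in 𝓝 (chartAt ℂ p p), P z) →
      ∀ᶠ q in 𝓝 p, q ∈ (chartAt ℂ p).source ∧ P (chartAt ℂ p q) := fun p P hP =>
    Filter.Eventually.and ((chartAt ℂ p).open_source.mem_nhds (mem_chart_source ℂ p))
      (((chartAt ℂ p).continuousAt (mem_chart_source ℂ p)).eventually hP)
  have zero_iff : ∀ {p q : M}, q ∈ (chartAt ℂ p).source →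
      (Q.IsZero q ↔ Q.coeff p (chartAt ℂ p q) = 0) := fun {p q} hq => by
    rw [← Q.isZero_iff_coeff ((chartAt ℂ p).map_source hq), (chartAt ℂ p).left_inv hq]
  have isolated : ∀ {p : M} {k : ℕ} {w : ℂ → ℂ}, (∀ᶠ z in 𝓝 (chartAt ℂ p p), ContinuousAt w z) →
      w (chartAt ℂ p p) ≠ 0 →
      (∀ᶠ z in 𝓝 (chartAt ℂ p p), Q.coeff p z = (z - chartAt ℂ p p) ^ k * w z) →
      Q.IsIsolatedAt p := by
    intro p k w hw hw0 hk
    have h1 := transfer p (hk.and (hw.self_of_nhds.eventually_ne hw0))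
    refine (h1.filter_mono nhdsWithin_le_nhds).mp (eventually_nhdsWithin_of_forall ?_)
    rintro q hqp ⟨hq, hq1, hq2⟩ hq0
    rw [zero_iff hq, hq1] at hq0
    refine (mul_ne_zero (pow_ne_zero k ?_) hq2) hq0
    exact sub_ne_zero.2 fun h => hqp ((chartAt ℂ p).injOn hq (mem_chart_source ℂ p) h)
  -- The interior of the zero set is also closed: at a point outside it the finite order alternative
  -- holds, so nearby points are limits of nonzeros.
  have hclopen : IsClopen {p : M | ∀ᶠ q in 𝓝 p, Q.IsZero q} := by
    refine ⟨⟨?_⟩, isOpen_setOfPred_eventually_nhds⟩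
    rw [isOpen_iff_mem_nhds]
    intro p hp
    rcases hQ p with h0 | ⟨k, w, hw, hw0, hk⟩
    · exact absurd ((transfer p h0).mono fun q hq => (zero_iff hq.1).2 hq.2) hp
    · have hi : ∀ᶠ q in 𝓝[≠] p, ¬ Q.IsZero q := isolated hw hw0 hk
      rw [eventually_nhdsWithin_iff] at hi
      filter_upwards [hi] with q hq
      by_cases hqp : q = p
      · rwa [hqp]
      · exact fun h => hq hqp h.self_of_nhds
  rcases isClopen_iff.1 hclopen with he | hu
  · rcases hQ p with h0 | ⟨k, w, hw, hw0, hk⟩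
    · have : p ∈ {p : M | ∀ᶠ q in 𝓝 p, Q.IsZero q} :=
        (transfer p h0).mono fun q hq => (zero_iff hq.1).2 hq.2
      rw [he] at this
      exact this.elim
    · refine ⟨isolated hw hw0 hk, -(k : ℚ) / 2, ?_, k, hasWindingNumber_pow_mul hw hw0 hk, by simp⟩
      -- An actual zero has positive order, which makes the index strictly negative.
      have hk0 : k ≠ 0 := by
        rintro rfl
        have h1 := (zero_iff (mem_chart_source ℂ p)).1 hp
        rw [hk.self_of_nhds] at h1
        simp [hw0] at h1
      have : (0 : ℚ) < k := by exact_mod_cast Nat.pos_of_ne_zero hk0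
      linarith
  · exact absurd (fun q => (show q ∈ {p : M | ∀ᶠ q in 𝓝 p, Q.IsZero q} by
      rw [hu]; trivial).self_of_nhds) hne

end MetricLie

/-! ### Rigidity: equality up to a left translation -/

namespace MetricLie

open Set Filter Wirtinger Matrix

section Constant

variable {M : Type*} [TopologicalSpace M] [ChartedSpace ℂ M] [IsManifold 𝓘(ℂ, ℂ) ω M]
  {X : Type*} [TopologicalSpace X] [ChartedSpace E3 X]

lemma eventually_eq_of_mfderiv_eq_zero [IsManifold (𝓡 3) ∞ X] {F : M → X}
    (hF : MDifferentiable 𝓘(ℝ, ℂ) (𝓡 3) F)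
    (h0 : ∀ (p : M) (v : ℂ), (mfderiv 𝓘(ℝ, ℂ) (𝓡 3) F p v : E3) = 0) (p : M) : ∀ᶠ q in 𝓝 p, F q = F p := by
  set κ := chartAt ℂ p with hκ
  have hpt : κ p ∈ κ.target := mem_chart_target ℂ p
  have hps : κ p ∈ κ.symm ⁻¹' (F ⁻¹' (extChartAt (𝓡 3) (F p)).source) := by
    simp [hκ]
  have hnhds : κ.target ∩ κ.symm ⁻¹' (F ⁻¹' (extChartAt (𝓡 3) (F p)).source) ∈ 𝓝 (κ p) :=
    (κ.isOpen_inter_preimage_symm ((isOpen_extChartAt_source _).preimage hF.continuous)).mem_nhds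
      ⟨hpt, hps⟩
  obtain ⟨r, hr, hball⟩ := Metric.mem_nhds_iff.1 hnhds
  have hd : ∀ z ∈ Metric.ball (κ p) r,
      HasFDerivAt (fun z => extChartAt (𝓡 3) (F p) (F (κ.symm z))) (0 : ℂ →L[ℝ] E3) z := by
    intro z hz
    obtain ⟨hz1, hz2⟩ := hball hz
    have hsrc : F (κ.symm z) ∈ (chartAt E3 (F p)).source := by
      rw [← extChartAt_source (𝓡 3)]; exact hz2
    have h1 := (mdifferentiableAt_extChartAt hsrc).hasMFDerivAt.comp z
      ((hF (κ.symm z)).hasMFDerivAt.comp z (hasMFDerivAt_chart_symm hz1))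
    refine h1.hasFDerivAt.congr_fderiv (ContinuousLinearMap.ext fun v : ℂ => ?_)
    exact (congrArg (fun w : E3 => mfderiv (𝓡 3) 𝓘(ℝ, E3) (extChartAt (𝓡 3) (F p))
      (F (κ.symm z)) w) (h0 (κ.symm z) (chartFactor p z * v))).trans (map_zero _)
  have hconst : ∀ z ∈ Metric.ball (κ p) r,
      extChartAt (𝓡 3) (F p) (F (κ.symm z)) = extChartAt (𝓡 3) (F p) (F (κ.symm (κ p))) := by
    intro z hz
    refine Convex.is_const_of_fderivWithin_eq_zero (𝕜 := ℝ)
      (f := fun z => extChartAt (𝓡 3) (F p) (F (κ.symm z))) (convex_ball (κ p) r)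
      (fun w hw => (hd w hw).differentiableAt.differentiableWithinAt) (fun w hw => ?_) hz
      (Metric.mem_ball_self hr)
    rw [fderivWithin_of_isOpen Metric.isOpen_ball hw, (hd w hw).fderiv]
  filter_upwards [κ.open_source.mem_nhds (mem_chart_source ℂ p),
    (κ.continuousAt (mem_chart_source ℂ p)).preimage_mem_nhds (Metric.ball_mem_nhds _ hr)]
    with q hq hq2
  have h1 := hconst _ hq2
  have h2 := (hball hq2).2
  rw [κ.left_inv hq, κ.left_inv (mem_chart_source ℂ p)] at h1
  rw [mem_preimage, mem_preimage, κ.left_inv hq] at h2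
  exact (extChartAt (𝓡 3) (F p)).injOn h2 (mem_extChartAt_source _) h1

end Constant

variable {X : Type*} [TopologicalSpace X] [ChartedSpace E3 X] [Group X] [LieGroup (𝓡 3) ∞ X]
  {g : LeftInvariantMetric X} {E : OrthonormalFrame g}
  {S : Type*} [TopologicalSpace S] [ChartedSpace ℂ S] [IsManifold 𝓘(ℂ, ℂ) ω S]
  {M : Type*} [TopologicalSpace M] [ChartedSpace ℂ M] [IsManifold 𝓘(ℂ, ℂ) ω M]

/-- The differential of `(x, y) ↦ x * y⁻¹` vanishes on pairs of left translates of one vector. -/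
lemma mfderiv_div_invariant (x y : X) (ξ : GroupLieAlgebra (𝓡 3) X) :
    (mfderiv ((𝓡 3).prod (𝓡 3)) (𝓡 3) (fun q : X × X => q.1 * q.2⁻¹) (x, y)
      (mulInvariantVectorField ξ x, mulInvariantVectorField ξ y) : E3) = 0 := by
  have hμ : MDifferentiable ((𝓡 3).prod (𝓡 3)) (𝓡 3) (fun q : X × X => q.1 * q.2⁻¹) :=
    (contMDiff_fst.mul contMDiff_snd.inv : ContMDiff _ _ ∞ _).mdifferentiable (by simp)
  have hL : ∀ x : X, MDifferentiableAt (𝓡 3) (𝓡 3) (fun c => x * c) 1 := fun x =>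
    ((contMDiff_mul_left : ContMDiff (𝓡 3) (𝓡 3) ∞ (fun c => x * c)).mdifferentiable (by simp)) 1
  have h1 := (hL x).hasMFDerivAt.prodMk (hL y).hasMFDerivAt
  have h2 := ((hμ (x * 1, y * 1)).hasMFDerivAt.comp (1 : X) h1).mfderiv
  -- The pair of left translates is the derivative at `1` of `c ↦ (x c, y c)`, along which the
  -- quotient is constant.
  have h3 : ((fun q : X × X => q.1 * q.2⁻¹) ∘ fun c : X => (x * c, y * c)) = fun _ => x * y⁻¹ := by
    funext c; simp
  rw [h3, mfderiv_const] at h2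
  have h4 := congrArg (fun L : E3 →L[ℝ] E3 => L ξ) h2
  have key : ∀ x' y', x' = x → y' = y → ∀ w : E3 × E3,
      (mfderiv ((𝓡 3).prod (𝓡 3)) (𝓡 3) (fun q : X × X => q.1 * q.2⁻¹) (x', y') w : E3) =
      mfderiv ((𝓡 3).prod (𝓡 3)) (𝓡 3) (fun q : X × X => q.1 * q.2⁻¹) (x, y) w := by
    rintro _ _ rfl rfl w; rfl
  exact (key _ _ (mul_one x) (mul_one y) _).symm.trans h4.symm

/-- Two maps of a connected surface with the same Maurer-Cartan form differ by a left
translation. -/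
theorem exists_eq_mul_of_tangentVec_eq [ConnectedSpace M] {f k : M → X}
    (hf : MDifferentiable 𝓘(ℝ, ℂ) (𝓡 3) f) (hk : MDifferentiable 𝓘(ℝ, ℂ) (𝓡 3) k)
    (h : ∀ p v, tangentVec E f p v = tangentVec E k p v) : ∃ x, ∀ p, f p = x * k p := by
  have hμ : MDifferentiable ((𝓡 3).prod (𝓡 3)) (𝓡 3) (fun q : X × X => q.1 * q.2⁻¹) :=
    (contMDiff_fst.mul contMDiff_snd.inv : ContMDiff _ _ ∞ _).mdifferentiable (by simp)
  have hF : ∀ p, HasMFDerivAt 𝓘(ℝ, ℂ) (𝓡 3) (fun p => f p * (k p)⁻¹) p _ := fun p =>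
    (hμ (f p, k p)).hasMFDerivAt.comp p ((hf p).hasMFDerivAt.prodMk (hk p).hasMFDerivAt)
  have hvec : ∀ {f : M → X} (p : M) (v : ℂ), (mfderiv 𝓘(ℝ, ℂ) (𝓡 3) f p v : E3) =
      mulInvariantVectorField (E.basis.equivFun.symm (tangentVec E f p v)) (f p) := fun p v =>
    (E.vec_inner _ _).symm.trans (E.vec_eq _ _)
  -- Equal frame components make the pair of derivatives one of left translates of a single vector,
  -- which the differential of the quotient kills.
  have hconst : IsLocallyConstant fun p => f p * (k p)⁻¹ := by
    rw [IsLocallyConstant.iff_eventually_eq]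
    refine eventually_eq_of_mfderiv_eq_zero (fun p => (hF p).mdifferentiableAt) fun p v => ?_
    rw [(hF p).mfderiv]
    refine Eq.trans ?_ (mfderiv_div_invariant (f p) (k p)
      (E.basis.equivFun.symm (tangentVec E f p v)))
    have e : ((mfderiv 𝓘(ℝ, ℂ) (𝓡 3) f p v, mfderiv 𝓘(ℝ, ℂ) (𝓡 3) k p v) : E3 × E3) =
        (mulInvariantVectorField (E.basis.equivFun.symm (tangentVec E f p v)) (f p),
          mulInvariantVectorField (E.basis.equivFun.symm (tangentVec E f p v)) (k p)) := by
      refine Prod.ext (hvec p v) ?_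
      have h1 := hvec (f := k) p v
      rw [← h] at h1
      exact h1
    exact congrArg (fun w : E3 × E3 => (mfderiv ((𝓡 3).prod (𝓡 3)) (𝓡 3)
      (fun q : X × X => q.1 * q.2⁻¹) (f p, k p) w : E3)) e
  obtain ⟨p₀⟩ : Nonempty M := inferInstance
  refine ⟨f p₀ * (k p₀)⁻¹, fun p => ?_⟩
  rw [← hconst.apply_eq_of_preconnectedSpace p p₀]
  simp

omit [IsManifold 𝓘(ℂ, ℂ) ω M] in
lemma tangentVec_congr {ψ₁ ψ₂ : M → X} {p : M} (h : ψ₁ =ᶠ[𝓝 p] ψ₂) (v : ℂ) :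
    tangentVec E ψ₁ p v = tangentVec E ψ₂ p v := by
  have key : ∀ (i : Fin 3) (x x' : X) (L L' : ℂ →L[ℝ] E3), x = x' → L = L' →
      g.metric.inner x (L v) (E.field i x) = g.metric.inner x' (L' v) (E.field i x') := by
    rintro i _ _ _ _ rfl rfl; rfl
  funext i
  exact key i _ _ _ _ h.self_of_nhds h.mfderiv_eq

lemma tangentVec_comp {ψ : ℂ → X} {φ : ℂ → ℂ} {z : ℂ}
    (hψ : MDifferentiableAt 𝓘(ℝ, ℂ) (𝓡 3) ψ (φ z)) (hφ : DifferentiableAt ℝ φ z) (v : ℂ) :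
    tangentVec E (ψ ∘ φ) z v = tangentVec E ψ (φ z) (fderiv ℝ φ z v) := by
  have h := (hψ.hasMFDerivAt.comp z hφ.hasFDerivAt.hasMFDerivAt).mfderiv
  funext i
  simp only [tangentVec, tangentComponent, dMap]
  rw [h]
  rfl

section Rigidity

variable {h : S2 → ℝ} {σ : ImmersedSurface E S} (hσ : σ.HasPrescribedMeanCurvature h)
  (hG : IsOrientedDiffeoOntoImage σ.gauss) {τ : ImmersedSurface E M}
  (hτ : τ.HasPrescribedMeanCurvature h) {f : M → S} (hf : Continuous f)
  (hfG : ∀ p, τ.gauss p = σ.gauss (f p))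
include hσ hG hτ hf hfG

lemma mdifferentiable_of_gauss_eq : MDifferentiable 𝓘(ℝ, ℂ) 𝓘(ℝ, ℂ) f := by
  have : IsManifold 𝓘(ℝ, ℂ) ω M := isManifold_real_of_complex M
  have : IsManifold 𝓘(ℝ, ℂ) 1 M := .of_le (n := ω) (by simp)
  intro p
  have hz := mem_chartDomain f p
  have Mt := matched hσ hG hτ hf hfG p
  have hκ : MDifferentiableAt 𝓘(ℝ, ℂ) 𝓘(ℝ, ℂ) (chartAt ℂ p) p :=
    mdifferentiableAt_atlas (chart_mem_atlas ℂ p) (mem_chart_source ℂ p)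
  have hφ : MDifferentiableAt 𝓘(ℝ, ℂ) 𝓘(ℝ, ℂ) (chartExpr f p) (chartAt ℂ p p) :=
    (Mt.differentiableAt_map hz).mdifferentiableAt
  have hκ2 : MDifferentiableAt 𝓘(ℝ, ℂ) 𝓘(ℝ, ℂ) (chartAt ℂ (f p)).symm
      (chartExpr f p (chartAt ℂ p p)) :=
    (hasMFDerivAt_chart_symm (Mt.mapsTo hz)).mdifferentiableAt
  refine (MDifferentiableAt.comp p hκ2 (MDifferentiableAt.comp p hφ hκ)).congr_of_eventuallyEq ?_
  filter_upwards [(chartAt ℂ p).open_source.mem_nhds (mem_chart_source ℂ p),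
    hf.continuousAt.preimage_mem_nhds ((chartAt ℂ (f p)).open_source.mem_nhds
      (mem_chart_source ℂ (f p)))] with q hq hq2
  simp only [Function.comp_apply, chartExpr, (chartAt ℂ p).left_inv hq]
  exact ((chartAt ℂ (f p)).left_inv hq2).symm

variable (hQ : (gaussQuadraticDifferential σ.sphereCoef τ.gauss).VanishesIdentically)
include hQ

lemma dbar_chartExpr_eq_zero {p : M} {z : ℂ} (hz : z ∈ chartDomain f p) :
    dbar (chartExpr f p) z = 0 := by
  have Mt := matched hσ hG hτ hf hfG p
  have h1 := (QuadraticDifferential.isZero_iff_coeff _ hz.1).1 (hQ ((chartAt ℂ p).symm z))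
  rw [coeff_eq_sum_quadCoeffAt hG hfG hz, Mt.sum_quadCoeffAt_mul hz] at h1
  exact (map_eq_zero _).1 ((mul_eq_zero.1 h1).resolve_right (Mt.factor_ne_zero hz))

/-- When `φ_z̄ = 0`, the formula for `t` reduces to `t = φ_z`. -/
lemma fderiv_chartExpr {p : M} {z : ℂ} (hz : z ∈ chartDomain f p) (v : ℂ) :
    fderiv ℝ (chartExpr f p) z v = scaleFactor (τ.localFst p) (σ.localFst (f p))
      (σ.localSnd (f p)) (chartExpr f p) z * v := by
  have Mt := matched hσ hG hτ hf hfG p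
  have h0 := dbar_chartExpr_eq_zero hσ hG hτ hf hfG hQ hz
  rw [Mt.scaleFactor_eq hz, fderiv_eq_del_add_dbar, h0]
  simp

/-- The factor `t` relating the tangent bases equals `φ_z`, which is also the factor produced by the
chain rule for `ψ_S ∘ f`. -/
lemma tangentVec_eq_of_vanishes (p : M) (v : ℂ) :
    tangentVec E τ.map p v = tangentVec E (σ.map ∘ f) p v := by
  have Mt := matched hσ hG hτ hf hfG p
  have hz := mem_chartDomain f p
  have hσd : MDifferentiable 𝓘(ℝ, ℂ) (𝓡 3) σ.map := σ.contMDiff.mdifferentiable (by norm_num)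
  have hτd : MDifferentiable 𝓘(ℝ, ℂ) (𝓡 3) τ.map := τ.contMDiff.mdifferentiable (by norm_num)
  have hfd := mdifferentiable_of_gauss_eq hσ hG hτ hf hfG
  set z := chartAt ℂ p p with hzdef
  obtain ⟨u, rfl⟩ : ∃ u, v = chartFactor p z * u :=
    ⟨v / chartFactor p z, (mul_div_cancel₀ v (chartFactor_ne_zero hz.1)).symm⟩
  have hp : (chartAt ℂ p).symm z = p := (chartAt ℂ p).left_inv (mem_chart_source ℂ p)
  have h1 := tangentVec_comp_chart_symm (E := E) hτd hz.1 u
  have h2 := tangentVec_comp_chart_symm (E := E) (hσd.comp hfd) hz.1 u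
  rw [hp] at h1 h2
  rw [← h1, ← h2]
  have hev : (σ.map ∘ f) ∘ (chartAt ℂ p).symm =ᶠ[𝓝 z]
      (σ.map ∘ (chartAt ℂ (f p)).symm) ∘ chartExpr f p := by
    filter_upwards [(isOpen_chartDomain hf p).mem_nhds hz] with w hw
    simp only [Function.comp_apply, chartExpr, (chartAt ℂ (f p)).left_inv hw.2]
  have hd2 : MDifferentiableAt 𝓘(ℝ, ℂ) (𝓡 3) (σ.map ∘ (chartAt ℂ (f p)).symm) (chartExpr f p z) :=
    (hσd _).comp _ (hasMFDerivAt_chart_symm (Mt.mapsTo hz)).mdifferentiableAt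
  rw [tangentVec_congr hev, tangentVec_comp hd2 (Mt.differentiableAt_map hz),
    fderiv_chartExpr hσ hG hτ hf hfG hQ hz]
  obtain ⟨e1, e2⟩ := Mt.rotScale hz
  set t := scaleFactor (τ.localFst p) (σ.localFst (f p)) (σ.localSnd (f p)) (chartExpr f p) z
  have ea : tangentVec E (τ.map ∘ (chartAt ℂ p).symm) z 1 = _ := e1
  have eb : tangentVec E (τ.map ∘ (chartAt ℂ p).symm) z Complex.I = _ := e2
  have l1 := tangentVec_re_im (E := E) (τ.map ∘ (chartAt ℂ p).symm) z u.re u.im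
  have l2 := tangentVec_re_im (E := E) (σ.map ∘ (chartAt ℂ (f p)).symm) (chartExpr f p z)
    (t * u).re (t * u).im
  rw [Complex.re_add_im] at l1 l2
  rw [l1, l2, ea, eb, Complex.mul_re, Complex.mul_im]
  simp only [ImmersedSurface.localFst, ImmersedSurface.localSnd]
  module

/-- The derivative of `φ` is multiplication by `t ≠ 0`, hence surjective, so `f` maps neighbourhoods
to neighbourhoods. -/
lemma isOpen_range_of_vanishes : IsOpen (range f) := by
  rw [isOpen_iff_mem_nhds]
  rintro _ ⟨p, rfl⟩
  have Mt := matched hσ hG hτ hf hfG p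
  have hz := mem_chartDomain f p
  set z := chartAt ℂ p p with hzdef
  have hp : (chartAt ℂ p).symm z = p := (chartAt ℂ p).left_inv (mem_chart_source ℂ p)
  have hs := (Mt.contDiff.contDiffAt ((isOpen_chartDomain hf p).mem_nhds hz)).hasStrictFDerivAt
    two_ne_zero
  have hsurj : (fderiv ℝ (chartExpr f p) z).range = ⊤ := by
    rw [LinearMap.range_eq_top]
    intro v
    refine ⟨v / scaleFactor (τ.localFst p) (σ.localFst (f p)) (σ.localSnd (f p))
      (chartExpr f p) z, ?_⟩
    exact (fderiv_chartExpr hσ hG hτ hf hfG hQ hz _).trans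
      (mul_div_cancel₀ v (Mt.scaleFactor_ne_zero hz))
  have hmap := hs.map_nhds_eq_of_surj hsurj
  have hφz : chartExpr f p z = chartAt ℂ (f p) (f p) := by rw [chartExpr, hp]
  have h1 : chartExpr f p '' chartDomain f p ∈ 𝓝 (chartAt ℂ (f p) (f p)) := by
    rw [← hφz, ← hmap]
    exact image_mem_map ((isOpen_chartDomain hf p).mem_nhds hz)
  filter_upwards [(chartAt ℂ (f p)).open_source.mem_nhds (mem_chart_source ℂ (f p)),
    ((chartAt ℂ (f p)).continuousAt (mem_chart_source ℂ (f p))).preimage_mem_nhds h1]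
    with s hs1 ⟨w, hw, hws⟩
  exact ⟨(chartAt ℂ p).symm w, (chartAt ℂ (f p)).injOn hw.2 hs1 hws⟩

theorem exists_translation_of_vanishes [ConnectedSpace M] : ∃ (x : X) (V : Set S), IsOpen V ∧
    range τ.map = (fun s => x * σ.map s) '' V := by
  have hσd : MDifferentiable 𝓘(ℝ, ℂ) (𝓡 3) σ.map := σ.contMDiff.mdifferentiable (by norm_num)
  have hτd : MDifferentiable 𝓘(ℝ, ℂ) (𝓡 3) τ.map := τ.contMDiff.mdifferentiable (by norm_num)
  obtain ⟨x, hx⟩ := exists_eq_mul_of_tangentVec_eq (E := E) hτd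
    (hσd.comp (mdifferentiable_of_gauss_eq hσ hG hτ hf hfG))
    (tangentVec_eq_of_vanishes hσ hG hτ hf hfG hQ)
  refine ⟨x, range f, isOpen_range_of_vanishes hσ hG hτ hf hfG hQ, ?_⟩
  rw [← range_comp]
  exact congrArg range (funext hx)

end Rigidity

lemma exists_continuous_lift {Y Z : Type*} [TopologicalSpace Y] [TopologicalSpace Z]
    {W : Type*} [TopologicalSpace W] {G : Y → Z} (hG : Topology.IsOpenEmbedding G) {ν : W → Z}
    (hν : Continuous ν) (h : range ν ⊆ range G) :
    ∃ f : W → Y, Continuous f ∧ ∀ p, ν p = G (f p) := by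
  choose f hf using fun p => h (mem_range_self p)
  refine ⟨f, ?_, fun p => (hf p).symm⟩
  rw [hG.isInducing.continuous_iff]
  exact hν.congr fun p => (hf p).symm

lemma ImmersedSurface.continuous_gauss (σ : ImmersedSurface E M) : Continuous σ.gauss := by
  have h := σ.contMDiff_gaussVec.continuous
  exact continuous_induced_rng.2 ((PiLp.continuous_toLp 2 _).comp h)

end MetricLie

end

theorem mainTheorem7
    {X : Type*} [TopologicalSpace X] [T2Space X] [ChartedSpace MetricLie.E3 X] [Group X]
    [LieGroup (𝓡 3) ∞ X] [SimplyConnectedSpace X]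
    (g : MetricLie.LeftInvariantMetric X) (E : MetricLie.OrthonormalFrame g)
    (h : MetricLie.S2 → ℝ) (hh : ContMDiff (𝓡 2) 𝓘(ℝ, ℝ) 1 h)
    {S : Type*} [TopologicalSpace S] [T2Space S] [ConnectedSpace S] [ChartedSpace ℂ S]
    [IsManifold 𝓘(ℂ, ℂ) ω S]
    (σ : MetricLie.ImmersedSurface E S) (hσ : σ.HasPrescribedMeanCurvature h)
    (hG : MetricLie.IsOrientedDiffeoOntoImage σ.gauss) :
    ∃ b : MetricLie.S2 → Fin 3 → Fin 3 → ℂ,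
      (∀ j k, ContMDiffOn (𝓡 2) 𝓘(ℝ, ℂ) 1 (fun n => b n j k) (Set.range σ.gauss)) ∧
      (MetricLie.gaussQuadraticDifferential b σ.gauss).VanishesIdentically ∧
      ∀ (M : Type*) [TopologicalSpace M] [T2Space M] [ConnectedSpace M] [ChartedSpace ℂ M]
        [IsManifold 𝓘(ℂ, ℂ) ω M]
        (τ : MetricLie.ImmersedSurface E M), τ.HasPrescribedMeanCurvature h →
        Set.range τ.gauss ⊆ Set.range σ.gauss →
        ((MetricLie.gaussQuadraticDifferential b τ.gauss).VanishesIdentically →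
          ∃ (x : X) (V : Set S), IsOpen V ∧
            Set.range τ.map = (fun s => x * σ.map s) '' V) ∧
        (¬ (MetricLie.gaussQuadraticDifferential b τ.gauss).VanishesIdentically →
          ∀ p : M, (MetricLie.gaussQuadraticDifferential b τ.gauss).IsZero p →
            (MetricLie.gaussQuadraticDifferential b τ.gauss).IsIsolatedAt p ∧
            ∃ j : ℚ, j < 0 ∧ (MetricLie.gaussQuadraticDifferential b τ.gauss).HasIndex p j) := by
  refine ⟨σ.sphereCoef, σ.contMDiffOn_sphereCoef hσ hG, σ.vanishesIdentically hG, ?_⟩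
  intro M _ _ _ _ _ τ hτ hsub
  obtain ⟨f, hf, hfG⟩ :=
    MetricLie.exists_continuous_lift hG.isOpenEmbedding τ.continuous_gauss hsub
  exact ⟨fun hQ => MetricLie.exists_translation_of_vanishes hσ hG hτ hf hfG hQ,
    MetricLie.QuadraticDifferential.isolated_of_local _
      (MetricLie.coeff_eventually_zero_or_pow_mul hσ hG hτ hf hfG)⟩
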